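/- Let $\mathbb K$ be an algebraically closed field containing an ordered field $k$ (for instance $k=\mathbb R\subset\mathbb K=\mathbb C$). Let $(W,S)$ be a Coxeter system with length function $\ell$; a *reflection* is a conjugate of an element of $S$. Let $V$ be a finite-dimensional reflection-faithful representation of $W$ over $\mathbb K$, i.e. $V$ is faithful and $x\in W$ is a reflection if and only if its fixed space $V^x$ has codimension $1$. Let $\Delta=\{\alpha_s\}_{s\in S}\subset V^*$ be a simple system of roots: $\Delta$ is linearly independent, $\ker\alpha_s=V^s$, and every $w\alpha_s$ ($w\in W$, $s\in S$) is a $k$-linear combination of simple roots whose coefficients are all $\ge 0$ or all $\le 0$. Put $D=\{\lambda\in V:\alpha_s(\lambda)\in k_{\ge 0}\text{ for all }s\in S\}$; the Tits cone is $\bigcup_{w\in W}w(D)$. Let $R$ be the algebra of regular functions on $V$, graded with $V^*$ in degree $2$. For $g\in W$ let $R^{g}$ be the subalgebra of $g$-invariants. For a set $S'$ of reflections in $W$, a *Soergel bimodule for $S'$* is a graded $(R,R)$-bimodule which is isomorphic to a graded direct summand of a finite direct sum of grading shifts of Bott–Samelson bimodules $R\otimes_{R^{s_1}}R\otimes_{R^{s_2}}\cdots\otimes_{R^{s_n}}R$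 with $n\ge 0$ and $s_1,\dots,s_n\in S'$. For $p\in V$ let $\mathfrak m_p\subset R$ be the maximal ideal of functions vanishing at $p$, and $\mathbb K_p=R/\mathfrak m_p$. For an $R$-module $N$ let $\operatorname{res}_p N\subseteq N$ be the submodule of elements annihilated by some power of $\mathfrak m_p$. Let $B$ be a Soergel bimodule for $S$, let $a$ be a point of the Tits cone and $\mathfrak a=\mathfrak m_a$. Let $\operatorname{Stab}(a)\subseteq W$ be the stabiliser of $a$, let $S_a$ be the set of those reflections $r\in\operatorname{Stab}(a)$ for which there is no reflection $r'\ne r$ in $\operatorname{Stab}(a)$ with $\ell(r'r)<\ell(r)$, and let $T_a\subseteq W$ be the set of elements $t$ which have minimal length in their coset $t\operatorname{Stab}(a)$. Then the left $R$-module $B\otimes_R\mathbb K_{\mathfrak a}$ is the internal direct sum $$B\otimes_R\mathbb K_{\mathfrak a}=\bigoplus_{t\in T_a}\operatorname{res}_{ta}\bigl(B\otimes_R\mathbb K_{\mathfrak a}\bigr),$$ and for every $t\in T_a$: 1. $(t\operatorname{Stab}(a)t^{-1},\,tS_at^{-1})$ is a Coxeter system; 2. there is a Soergel bimodule $C$ for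 $tS_at^{-1}$ such that $\operatorname{res}_{ta}(B\otimes_R\mathbb K_{\mathfrak a})\cong C\otimes_R\mathbb K_{ta}$ as left $R$-modules. -/

import Mathlib

open scoped TensorProduct

universe u v w

noncomputable section

namespace SoergelSpec

/-! ## Bimodules over a commutative algebra and their specialisations

For a commutative `K`-algebra `R`, an `(R, R)`-bimodule on which the two actions of `K` agree is
the same thing as a module over `R ⊗[K] R`: the left action of `r` is the action of `r ⊗ 1`, the
right action of `r` is the action of `1 ⊗ r`. -/

section Bimodules

/-- The bimodule `B`, regarded as an `R`-module through the *right* action of `R`. -/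
def RightModule (_K _R B : Type*) : Type _ := B

variable (K : Type u) (R : Type w) [CommRing K] [CommRing R] [Algebra K R]

section
variable (B : Type*) [AddCommGroup B] [Module (R ⊗[K] R) B]

instance : AddCommGroup (RightModule K R B) := inferInstanceAs (AddCommGroup B)

/-- The bimodule structure is retained. -/
instance : Module (R ⊗[K] R) (RightModule K R B) := inferInstanceAs (Module (R ⊗[K] R) B)

/-- `R` acts through the right action. -/
instance : Module R (RightModule K R B) :=
  Module.compHom B (Algebra.TensorProduct.includeRight : R →ₐ[K] R ⊗[K] R).toRingHom

instance : SMulCommClass R (R ⊗[K] R) (RightModule K R B) where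
  smul_comm r e b :=
    smul_comm ((Algebra.TensorProduct.includeRight : R →ₐ[K] R ⊗[K] R) r) e (show B from b)

/-- The specialisation `B ⊗_R (R / 𝔞)` of a bimodule `B`: the tensor product is formed over the
right action of `R` on `B`. -/
def Specialisation (𝔞 : Ideal R) : Type _ := RightModule K R B ⊗[R] (R ⧸ 𝔞)

instance (𝔞 : Ideal R) : AddCommGroup (Specialisation K R B 𝔞) :=
  inferInstanceAs (AddCommGroup (RightModule K R B ⊗[R] (R ⧸ 𝔞)))

/-- The specialisation is a (left) `R`-module through the left action of `R` on `B`. -/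
instance (𝔞 : Ideal R) : Module R (Specialisation K R B 𝔞) :=
  letI : Module (R ⊗[K] R) (Specialisation K R B 𝔞) :=
    inferInstanceAs (Module (R ⊗[K] R) (RightModule K R B ⊗[R] (R ⧸ 𝔞)))
  Module.compHom _ (Algebra.TensorProduct.includeLeft : R →ₐ[K] R ⊗[K] R).toRingHom

end

/-- A commutative ring `A` with two homomorphisms from `R` (the algebra structure, giving the left
action, and `right`, giving the right action), together with a family of additive subgroups
indexed by `ℤ` (its homogeneous pieces). Bott–Samelson bimodules are of this form. -/
structure GradedBialgebra where
  carrier : Type w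
  [commRing : CommRing carrier]
  [algebraBase : Algebra K carrier]
  [algebraLeft : Algebra R carrier]
  [tower : IsScalarTower K R carrier]
  right : R →ₐ[K] carrier
  deg : ℤ → AddSubgroup carrier

attribute [instance] GradedBialgebra.commRing GradedBialgebra.algebraBase
  GradedBialgebra.algebraLeft GradedBialgebra.tower

variable {K R}

/-- The underlying bimodule: `(r ⊗ r') • x = r * x * r'`. -/
instance (A : GradedBialgebra.{u, w} K R) : Module (R ⊗[K] R) A.carrier :=
  Module.compHom A.carrier
    (Algebra.TensorProduct.productMap (IsScalarTower.toAlgHom K R A.carrier) A.right).toRingHom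

/-- The regular bimodule `R`, where `degR` is the grading of `R`. -/
def GradedBialgebra.unit (degR : ℤ → AddSubgroup R) : GradedBialgebra.{u, w} K R where
  carrier := R
  right := AlgHom.id K R
  deg := degR

/-- The bimodule `R ⊗_P A` for a subalgebra `P` of `R` (acting on `A` from the left): `R` acts from
the left on `R` and from the right on `A`, and the degrees of homogeneous elements add up. -/
def GradedBialgebra.cons (degR : ℤ → AddSubgroup R) (P : Subalgebra K R)
    (A : GradedBialgebra.{u, w} K R) : GradedBialgebra.{u, w} K R where
  carrier := R ⊗[P] A.carrier
  right := ((Algebra.TensorProduct.includeRight : A.carrier →ₐ[P] R ⊗[P] A.carrier).restrictScalars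
    K).comp A.right
  deg n := AddSubgroup.closure
    {x | ∃ i j : ℤ, i + j = n ∧ ∃ f ∈ degR i, ∃ y ∈ A.deg j, x = f ⊗ₜ[P] y}

end Bimodules

/-! ## Regular functions on a vector space -/

section RegularFunctions

variable (K : Type u) (V : Type v) [Field K] [AddCommGroup V] [Module K V]

/-- The algebra of regular (polynomial) functions on `V`: the `K`-algebra of functions on `V`
generated by the linear forms. -/
def regularFunctions : Subalgebra K (V → K) :=
  Algebra.adjoin K (Set.range fun (φ : Module.Dual K V) (x : V) => φ x)

/-- The `K`-algebra `R = R(V)`. -/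
def Reg : Type (max u v) := ↥(regularFunctions K V)

instance : CommRing (Reg K V) := inferInstanceAs (CommRing (regularFunctions K V))

instance : Algebra K (Reg K V) := inferInstanceAs (Algebra K (regularFunctions K V))

variable {V}

/-- The value of a regular function at the point `x`. -/
def evalAt (x : V) : Reg K V →ₐ[K] K :=
  (Pi.evalAlgHom K (fun _ : V => K) x).comp (regularFunctions K V).val

/-- The maximal ideal of the point `a`: the functions vanishing at `a`. -/
def pointIdeal (a : V) : Ideal (Reg K V) := RingHom.ker (evalAt K a)

variable (V)

/-- The grading of `R` in which linear forms have degree `2`: for `d : ℕ`, the functions that are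
homogeneous of polynomial degree `d` have degree `2 * d`. -/
def regDeg (n : ℤ) : AddSubgroup (Reg K V) :=
  AddSubgroup.closure
    {f | ∃ d : ℕ, n = 2 * d ∧ ∀ (c : K) (x : V), evalAt K (c • x) f = c ^ d * evalAt K x f}

variable {K V}

/-- The invariants of a linear endomorphism `g` of `V` in `R`. -/
def invariants (g : V →ₗ[K] V) : Subalgebra K (Reg K V) where
  carrier := {f | ∀ x, evalAt K (g x) f = evalAt K x f}
  mul_mem' {f h} hf hh x := by rw [map_mul, map_mul, hf x, hh x]
  add_mem' {f h} hf hh x := by rw [map_add, map_add, hf x, hh x]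
  algebraMap_mem' r x := by rw [AlgHom.commutes, AlgHom.commutes]

variable (K) in
/-- The summand supported at the point `p` of an `R`-module `N` with zero-dimensional support: the
elements annihilated by a power of the maximal ideal of `p`. -/
def supportedAt (p : V) (N : Type*) [AddCommGroup N] [Module (Reg K V) N] :
    Submodule (Reg K V) N :=
  ⨆ n : ℕ, Submodule.torsionBySet (Reg K V) N ((pointIdeal K p ^ n : Ideal (Reg K V)) : Set (Reg K V))

end RegularFunctions

/-! ## Soergel bimodules -/

section Soergel

variable {K : Type u} {V : Type v} [Field K] [AddCommGroup V] [Module K V]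
variable {W : Type*} [Group W] (ρ : Representation K W V)

/-- The Bott–Samelson bimodule `B(s, t, …, u) = R ⊗_{R^s} R ⊗_{R^t} ⋯ ⊗_{R^u} R` of a sequence of
elements of `W`. -/
def bottSamelson : List W → GradedBialgebra.{u, max u v} K (Reg K V)
  | [] => GradedBialgebra.unit (regDeg K V)
  | s :: l => GradedBialgebra.cons (regDeg K V) (invariants (ρ s)) (bottSamelson l)

/-- The bimodule `B`, with homogeneous pieces `deg`, is a Soergel bimodule for the set `S` of simple
reflections: it is (isomorphic to) a graded direct summand of a finite direct sum of grading shifts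
of Bott–Samelson bimodules of sequences in `S`. The inclusion `ι` and the projection `π` are
homogeneous of degree zero; this forces `B` to be the direct sum of the pieces `deg n`, and makes
them compatible with the action of `R ⊗ R`. -/
def IsSoergelBimodule (S : Set W) (B : Type*) [AddCommGroup B] [Module (Reg K V ⊗[K] Reg K V) B]
    (deg : ℤ → AddSubgroup B) : Prop :=
  ∃ (n : ℕ) (l : Fin n → List W) (d : Fin n → ℤ)
    (ι : B →ₗ[Reg K V ⊗[K] Reg K V] ((i : Fin n) → (bottSamelson ρ (l i)).carrier))
    (π : ((i : Fin n) → (bottSamelson ρ (l i)).carrier) →ₗ[Reg K V ⊗[K] Reg K V] B),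
    (∀ i, ∀ s ∈ l i, s ∈ S) ∧
    (∀ b, π (ι b) = b) ∧
    (∀ m, ∀ b ∈ deg m, ∀ i, ι b i ∈ (bottSamelson ρ (l i)).deg (m + d i)) ∧
    (∀ m x, (∀ i, x i ∈ (bottSamelson ρ (l i)).deg (m + d i)) → π x ∈ deg m)

variable (K) in
/-- The specialisation `B ⊗_R 𝕂_𝔞` of an `(R, R)`-bimodule at the maximal ideal of the point `a`. -/
abbrev SpecialisationAt (a : V) (B : Type*) [AddCommGroup B]
    [Module (Reg K V ⊗[K] Reg K V) B] : Type _ :=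
  Specialisation K (Reg K V) B (pointIdeal K a)

/-- The `R`-module `N` is isomorphic to the specialisation at the point `b` of a Soergel bimodule for
the set `S` of simple reflections. -/
def IsSoergelModuleAt (S : Set W) (b : V) (N : Type*) [AddCommGroup N] [Module (Reg K V) N] : Prop :=
  ∃ (C : Type (max u v)) (_ : AddCommGroup C) (_ : Module (Reg K V ⊗[K] Reg K V) C)
    (deg : ℤ → AddSubgroup C),
    IsSoergelBimodule ρ S C deg ∧ Nonempty (N ≃ₗ[Reg K V] SpecialisationAt K b C)

end Soergel

/-! ## Coxeter systems and the Tits cone -/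

section Coxeter

variable {K : Type u} {V : Type v} [Field K] [AddCommGroup V] [Module K V]
variable {W : Type*} [Group W] {I : Type*} {M : CoxeterMatrix I} (cs : CoxeterSystem M W)
variable (ρ : Representation K W V)

/-- A representation is reflection faithful if it is faithful and the elements whose fixed space has
codimension one are exactly the reflections (the conjugates of the simple reflections). -/
structure IsReflectionFaithful : Prop where
  faithful : Function.Injective ρ
  codim_one_iff (x : W) :
    Module.finrank K (LinearMap.ker (ρ x - 1)) + 1 = Module.finrank K V ↔ cs.IsReflection x

/-- The linear forms `α i` are a simple system of roots for `(W, S)` acting on `V`, with respect to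
the ordered field `k ⊆ K`: they are linearly independent, `α i` cuts out the reflecting hyperplane of
the `i`-th simple reflection, and every root (translate of a simple root by `W`) is a linear
combination of simple roots with coefficients in `k` which are all `≥ 0` or all `≤ 0`. -/
structure IsSimpleSystem (k : Type*) [Field k] [LinearOrder k] [Algebra k K]
    (α : I → Module.Dual K V) : Prop where
  linearIndependent : LinearIndependent K α
  apply_eq_zero_iff (i : I) (x : V) : α i x = 0 ↔ ρ (cs.simple i) x = x
  same_sign (x : W) (i : I) : ∃ c : I →₀ k, ((∀ j, 0 ≤ c j) ∨ (∀ j, c j ≤ 0)) ∧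
    α i ∘ₗ ρ x = c.sum fun j e => algebraMap k K e • α j

/-- The dominant chamber `D`: all `⟨p, α⟩`, for `α` a simple root, lie in `k` and are `≥ 0`. -/
def dominantChamber (k : Type*) [Field k] [LinearOrder k] [Algebra k K]
    (α : I → Module.Dual K V) : Set V :=
  {p | ∀ i, ∃ e : k, 0 ≤ e ∧ α i p = algebraMap k K e}

/-- The Tits cone, the union of the `w(D)` for `w ∈ W`. -/
def titsCone (k : Type*) [Field k] [LinearOrder k] [Algebra k K]
    (α : I → Module.Dual K V) : Set V :=
  ⋃ x : W, ρ x '' dominantChamber k α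

/-- The stabiliser of a point. -/
def stab (a : V) : Subgroup W where
  carrier := {x | ρ x a = a}
  one_mem' := by simp
  mul_mem' {x y} hx hy := by
    change ρ (x * y) a = a
    rw [map_mul, Module.End.mul_apply, show ρ y a = a from hy, show ρ x a = a from hx]
  inv_mem' {x} hx := by
    change ρ x⁻¹ a = a
    conv_lhs => rw [← show ρ x a = a from hx]
    simp

/-- The simple reflections of `Stab(a)` determined by the length function of `(W, S)`: the
reflections `r ∈ Stab(a)` such that no other reflection `r' ∈ Stab(a)` makes `r` shorter. -/
def stabSimple (a : V) : Set W :=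
  {r | cs.IsReflection r ∧ r ∈ stab ρ a ∧
    ∀ r', cs.IsReflection r' → r' ∈ stab ρ a → cs.length (r' * r) < cs.length r → r' = r}

/-- The elements which have minimal length in their coset modulo `Stab(a)`. -/
def minimalReps (a : V) : Set W :=
  {t | ∀ x ∈ stab ρ a, cs.length t ≤ cs.length (t * x)}

/-- `(H, S)` is a Coxeter system, for a subgroup `H` of `W` and a set `S` of elements of `W`. -/
def IsCoxeterPair (H : Subgroup W) (S : Set W) : Prop :=
  ∃ (N : CoxeterMatrix S) (cs' : CoxeterSystem N H), ∀ s : S, (cs'.simple s : W) = s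

end Coxeter

end SoergelSpec

end

/-!
# Specialisations of Soergel bimodules at points of the Tits cone

Write `R` for the algebra of regular functions on `V`, `𝔪_p` for the ideal of a point `p`, and
`H = Stab(a)`. The argument has three ingredients.

**Roots.** Every reflection `r` has a positive root, unique up to a scalar, and reflection
faithfulness makes `r` depend only on its hyperplane (`IsRootOf.eq_of_smul`). Hence a simple
reflection permutes the other positive roots up to scalars, which gives the strong exchange property:
`ℓ(r x) < ℓ(x)` if and only if `x⁻¹` makes the positive root of `r` negative
(`IsRootOf.length_mul_lt_iff`). So `t` is of minimal length in `t H` if and only if it keeps the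
positive roots vanishing at `a` positive (`mem_minimalReps_iff`); distinct such `t` move `a` to
distinct points (`eq_of_preservesPos`), and for a simple reflection `s` there are two cases: either
`s t` is minimal again, or `s` fixes `t a` and `t⁻¹ s t` belongs to `S_a`
(`simple_mul_mem_minimalReps`, `conj_simple_mem_stabSimple`). A point of the Tits cone is the image
of a dominant point by an element compatible with positivity, so `(H, S_a)` is conjugate to a
standard parabolic pair (`isCoxeterPair_stab`). That a parabolic pair is a Coxeter system is proved
by letting the abstract Coxeter group with the matrix of orders act on `V` and comparing its length
function with the positivity of roots (`isCoxeterPair_closure`).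

**Bott–Samelson bimodules.** The specialisation at `a` of a Bott–Samelson bimodule of a word is
killed by a product of powers of the ideals of finitely many points of `W a`
(`exists_finset_support`), so that it is the direct sum of its parts supported at these points
(`isInternal_supportedAt`). The part at `t a` is computed letter by letter
(`nonempty_localSplitting`). If `s` fixes `t a`, then `R ⊗_{R^s} -` can be applied to a splitting of
the shorter word. If `s` moves `t a`, then the form `α` with kernel `V^s` is invertible near `t a`,
where `R ⊗_{R^s} A` becomes the sum of `A` and of its left twist by `s` (`exists_splitting`). The
result is a sum of Bott–Samelson bimodules of words in `t S_a t⁻¹`, with the right action twisted by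
`t`; the twist moves the specialisation from the point `a` to the point `t a`.

**Direct summands.** Let `B` be cut out of a sum of Bott–Samelson bimodules by an idempotent. Near
`(q, a)`, where `q = t a`, the latter splits off a sum `M'` of Bott–Samelson bimodules for
`t S_a t⁻¹`, and the idempotent of `B` induces an endomorphism `X` of `M'` which is idempotent modulo
`M' 𝔪_q`, but which is not homogeneous in general. To obtain a graded summand of `M'`, one replaces `X` by an equivalent homogeneous idempotent
(`GradingDatum.exists_idempotent`). All reflections in `t S_a t⁻¹` fix `q`, so that the translation
by `q` lifts to `M'` and reduces this to `q = 0`. There the endomorphisms of `M' ⊗_R R/𝔪_0` coming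
from `M'` form a finite-dimensional graded algebra, in which every idempotent is equivalent to a
homogeneous one by a Krull–Schmidt exchange argument (`exists_homogeneous_idemEquiv`); the homogeneous
idempotent lifts to `M'`, since the kernel is nil in degree zero, and its translate back to `q` is
conjugate to it by a unipotent endomorphism. The image of the lift is a Soergel bimodule with the
required specialisation (`exists_range_equiv`, `isSoergelModuleAt_of_splitting`).
-/

noncomputable section

namespace SoergelSpec

/-! ### Regular functions -/

section RegularFunctions

variable {K : Type u} {V : Type v} [Field K] [AddCommGroup V] [Module K V]

theorem Reg.ext {f h : Reg K V} (H : ∀ x, evalAt K x f = evalAt K x h) : f = h :=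
  Subtype.ext (funext H)

/-- A linear form, as a regular function. -/
def linForm (φ : Module.Dual K V) : Reg K V :=
  ⟨fun x => φ x, Algebra.subset_adjoin ⟨φ, rfl⟩⟩

@[simp] theorem evalAt_linForm (φ : Module.Dual K V) (x : V) : evalAt K x (linForm φ) = φ x := rfl

@[elab_as_elim]
theorem Reg.induction {p : Reg K V → Prop} (lin : ∀ φ, p (linForm φ))
    (const : ∀ c : K, p (algebraMap K _ c)) (add : ∀ f h, p f → p h → p (f + h))
    (mul : ∀ f h, p f → p h → p (f * h)) (f : Reg K V) : p f := by
  obtain ⟨f, hf⟩ := f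
  induction hf using Algebra.adjoin_induction with
  | mem x hx => obtain ⟨φ, rfl⟩ := hx; exact lin φ
  | algebraMap r => exact const r
  | add x y hx hy h1 h2 => exact add _ _ h1 h2
  | mul x y hx hy h1 h2 => exact mul _ _ h1 h2

/-- Composition of regular functions with an affine self-map of `V`. -/
def pull (φ : V →ᵃ[K] V) : Reg K V →ₐ[K] Reg K V where
  toFun f := ⟨fun x => evalAt K (φ x) f, by
    induction f using Reg.induction with
    | lin ψ =>
      have : (fun x => evalAt K (φ x) (linForm ψ)) =
          (fun x => (ψ ∘ₗ φ.linear) x) + algebraMap K (V → K) (ψ (φ 0)) := by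
        funext x
        change ψ (φ x) = ψ (φ.linear x) + ψ (φ 0)
        rw [← map_add]
        congr 1
        simpa using φ.map_vadd 0 x
      rw [this]
      exact add_mem (Algebra.subset_adjoin ⟨_, rfl⟩) (Subalgebra.algebraMap_mem _ _)
    | const c =>
      simp only [AlgHom.commutes]
      exact Subalgebra.algebraMap_mem _ _
    | add f h hf hh => simp only [map_add]; exact add_mem hf hh
    | mul f h hf hh => simp only [map_mul]; exact mul_mem hf hh⟩
  map_one' := rfl
  map_mul' _ _ := rfl
  map_zero' := rfl
  map_add' _ _ := rfl
  commutes' _ := rfl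

theorem pull_pull_of_comp {φ ψ : V →ᵃ[K] V} (h : ∀ x, ψ (φ x) = x) (f : Reg K V) :
    pull φ (pull ψ f) = f :=
  Reg.ext fun x => congrArg (fun y => evalAt K y f) (h x)

theorem mem_invariants {g : V →ₗ[K] V} {f : Reg K V} :
    f ∈ invariants g ↔ ∀ x, evalAt K (g x) f = evalAt K x f := Iff.rfl

theorem mem_pointIdeal {a : V} {f : Reg K V} : f ∈ pointIdeal K a ↔ evalAt K a f = 0 := Iff.rfl

instance pointIdeal_isMaximal (a : V) : (pointIdeal K a).IsMaximal :=
  RingHom.ker_isMaximal_of_surjective _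
    (fun c => ⟨algebraMap K _ c, by rw [AlgHom.commutes]; rfl⟩)

/-- Distinct points are separated by a regular function. -/
theorem exists_evalAt_eq_zero_ne {a b : V} (h : a ≠ b) :
    ∃ f : Reg K V, evalAt K a f = 0 ∧ evalAt K b f ≠ 0 := by
  have hba : b - a ≠ 0 := sub_ne_zero.2 h.symm
  obtain ⟨ψ, hψ⟩ : ∃ ψ : Module.Dual K V, ψ (b - a) ≠ 0 := by
    by_contra! hc
    exact hba ((Module.forall_dual_apply_eq_zero_iff K _).1 hc)
  refine ⟨linForm ψ - algebraMap K _ (ψ a), ?_, ?_⟩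
  · rw [map_sub, AlgHom.commutes]; simp
  · rw [map_sub, AlgHom.commutes]
    simpa [sub_eq_zero] using fun e => hψ (by rw [map_sub, e, sub_self])

theorem pointIdeal_injective {a b : V} (h : a ≠ b) : pointIdeal K a ≠ pointIdeal K b := by
  obtain ⟨f, h1, h2⟩ := exists_evalAt_eq_zero_ne (K := K) h
  exact fun e => h2 (mem_pointIdeal.1 (e ▸ mem_pointIdeal.2 h1))

end RegularFunctions

/-! ### Left and right multiplications on bimodules -/

section Bimodules

variable {K : Type u} {R : Type w} [CommRing K] [CommRing R] [Algebra K R]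
variable {M N : Type*} [AddCommGroup M] [Module (R ⊗[K] R) M] [AddCommGroup N]
  [Module (R ⊗[K] R) N]

variable (K M) in
/-- Left multiplication on a bimodule. -/
def lm : R →+* Module.End (R ⊗[K] R) M :=
  (Module.toModuleEnd (R ⊗[K] R) M).comp
    (Algebra.TensorProduct.includeLeft : R →ₐ[K] R ⊗[K] R).toRingHom

variable (K M) in
/-- Right multiplication on a bimodule. -/
def rm : R →+* Module.End (R ⊗[K] R) M :=
  (Module.toModuleEnd (R ⊗[K] R) M).comp
    (Algebra.TensorProduct.includeRight : R →ₐ[K] R ⊗[K] R).toRingHom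

theorem lm_apply (r : R) (m : M) : lm K M r m = (r ⊗ₜ[K] (1 : R)) • m := rfl

theorem rm_apply (r : R) (m : M) : rm K M r m = ((1 : R) ⊗ₜ[K] r) • m := rfl

theorem tmul_smul_eq (r r' : R) (m : M) : (r ⊗ₜ[K] r') • m = lm K M r (rm K M r' m) := by
  rw [lm_apply, rm_apply, smul_smul]; simp

theorem lm_rm_comm (r r' : R) (m : M) : lm K M r (rm K M r' m) = rm K M r' (lm K M r m) := by
  rw [lm_apply, rm_apply, smul_smul, lm_apply, rm_apply, smul_smul]; simp

theorem lm_lm_comm (r r' : R) (m : M) : lm K M r (lm K M r' m) = lm K M r' (lm K M r m) := by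
  rw [← Module.End.mul_apply, ← map_mul, mul_comm, map_mul, Module.End.mul_apply]

theorem lm_mul_apply (r r' : R) (m : M) : lm K M (r * r') m = lm K M r (lm K M r' m) := by
  rw [map_mul, Module.End.mul_apply]

theorem rm_mul_apply (r r' : R) (m : M) : rm K M (r * r') m = rm K M r (rm K M r' m) := by
  rw [map_mul, Module.End.mul_apply]

theorem map_lm (f : M →ₗ[R ⊗[K] R] N) (r : R) (m : M) : f (lm K M r m) = lm K N r (f m) :=
  map_smul _ _ _

theorem map_rm (f : M →ₗ[R ⊗[K] R] N) (r : R) (m : M) : f (rm K M r m) = rm K N r (f m) :=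
  map_smul _ _ _

/-- An additive map which commutes with the left and the right action is a homomorphism of
bimodules. -/
def ofLmRm (f : M →+ N) (hl : ∀ (r : R) m, f (lm K M r m) = lm K N r (f m))
    (hr : ∀ (r : R) m, f (rm K M r m) = rm K N r (f m)) : M →ₗ[R ⊗[K] R] N where
  toFun := f
  map_add' := map_add f
  map_smul' t m := by
    induction t with
    | zero => simp
    | tmul r r' => simp only [tmul_smul_eq, hl, hr, RingHom.id_apply]
    | add x y hx hy => simp only [add_smul, map_add, hx, hy]

variable (K M) in
/-- The sub-bimodule `M · 𝔞`. -/
def rsub (𝔞 : Ideal R) : Submodule (R ⊗[K] R) M where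
  toAddSubmonoid := (AddSubgroup.closure {x | ∃ r ∈ 𝔞, ∃ m, x = rm K M r m}).toAddSubmonoid
  smul_mem' t m hm := by
    change m ∈ AddSubgroup.closure _ at hm
    change t • m ∈ AddSubgroup.closure _
    induction hm using AddSubgroup.closure_induction with
    | mem x hx =>
      obtain ⟨r, hr, m, rfl⟩ := hx
      exact AddSubgroup.subset_closure ⟨r, hr, t • m, (map_smul _ _ _).symm⟩
    | zero => simp
    | add x y _ _ hx hy => rw [smul_add]; exact add_mem hx hy
    | neg x _ hx => rw [smul_neg]; exact neg_mem hx

theorem rm_mem_rsub {𝔞 : Ideal R} {r : R} (hr : r ∈ 𝔞) (m : M) : rm K M r m ∈ rsub K M 𝔞 :=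
  AddSubgroup.subset_closure ⟨r, hr, m, rfl⟩

theorem lm_mem_rsub {𝔞 : Ideal R} (r : R) {m : M} (hm : m ∈ rsub K M 𝔞) :
    lm K M r m ∈ rsub K M 𝔞 := Submodule.smul_mem _ _ hm

/-- An additive map sends `M · 𝔞` into `N · 𝔟` as soon as it does so on products. -/
theorem map_mem_rsub_of {𝔞 𝔟 : Ideal R} (f : M →+ N)
    (h : ∀ r ∈ 𝔞, ∀ m, f (rm K M r m) ∈ rsub K N 𝔟) {m : M} (hm : m ∈ rsub K M 𝔞) :
    f m ∈ rsub K N 𝔟 := by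
  change m ∈ AddSubgroup.closure _ at hm
  induction hm using AddSubgroup.closure_induction with
  | mem x hx => obtain ⟨r, hr, m, rfl⟩ := hx; exact h r hr m
  | zero => simp
  | add x y _ _ hx hy => rw [map_add]; exact add_mem hx hy
  | neg x _ hx => rw [map_neg]; exact neg_mem hx

theorem map_mem_rsub {𝔞 : Ideal R} (f : M →ₗ[R ⊗[K] R] N) {m : M} (hm : m ∈ rsub K M 𝔞) :
    f m ∈ rsub K N 𝔞 :=
  map_mem_rsub_of f.toAddMonoidHom
    (fun r hr m => by
      change f (rm K M r m) ∈ _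
      rw [map_rm]; exact rm_mem_rsub hr _) hm

/-- If `φ` is twisted on the right by `ψ` and `ψ` sends `𝔞` into `𝔟`, then `φ` sends `M · 𝔞` into
`N · 𝔟`. -/
theorem map_mem_rsub_of_twist {𝔞 𝔟 : Ideal R} (f : M →+ N) (ψ : R → R)
    (hf : ∀ (r : R) m, f (rm K M r m) = rm K N (ψ r) (f m)) (hψ : ∀ r ∈ 𝔞, ψ r ∈ 𝔟) {m : M}
    (hm : m ∈ rsub K M 𝔞) : f m ∈ rsub K N 𝔟 :=
  map_mem_rsub_of f (fun r hr m => by rw [hf]; exact rm_mem_rsub (hψ r hr) _) hm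

theorem mem_rsub_pi {ι : Type*} [Fintype ι] {A : ι → Type*} [∀ i, AddCommGroup (A i)]
    [∀ i, Module (R ⊗[K] R) (A i)] {𝔞 : Ideal R} {x : ∀ i, A i} :
    x ∈ rsub K (∀ i, A i) 𝔞 ↔ ∀ i, x i ∈ rsub K (A i) 𝔞 := by
  classical
  constructor
  · intro hx i
    exact map_mem_rsub (LinearMap.proj i : (∀ i, A i) →ₗ[R ⊗[K] R] A i) hx
  · intro hx
    rw [← LinearMap.sum_single_apply A x]
    exact Submodule.sum_mem _ fun i _ => map_mem_rsub (LinearMap.single (R ⊗[K] R) A i) (hx i)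

/-! ### The specialisation as a quotient -/

variable (K) in
/-- The class of an element of a bimodule in the specialisation. -/
def spMk (𝔞 : Ideal R) : M →+ Specialisation K R M 𝔞 where
  toFun m := (show RightModule K R M from m) ⊗ₜ[R] (1 : R ⧸ 𝔞)
  map_zero' := TensorProduct.zero_tmul _ _
  map_add' _ _ := TensorProduct.add_tmul _ _ _

theorem lm_spMk (𝔞 : Ideal R) (r : R) (m : M) : spMk K 𝔞 (lm K M r m) = r • spMk K 𝔞 m := rfl

theorem spMk_surjective (𝔞 : Ideal R) :
    Function.Surjective (spMk K (M := M) 𝔞 : M → Specialisation K R M 𝔞) := by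
  intro x
  change RightModule K R M ⊗[R] (R ⧸ 𝔞) at x
  induction x with
  | zero => exact ⟨0, map_zero _⟩
  | tmul m y =>
    obtain ⟨r, rfl⟩ := Ideal.Quotient.mk_surjective y
    refine ⟨rm K M r m, ?_⟩
    change (r • m) ⊗ₜ[R] (1 : R ⧸ 𝔞) = _
    rw [TensorProduct.smul_tmul]
    congr 1
    rw [Algebra.smul_def, mul_one]; rfl
  | add x y hx hy =>
    obtain ⟨a, rfl⟩ := hx
    obtain ⟨b, rfl⟩ := hy
    exact ⟨a + b, map_add _ _ _⟩

theorem spMk_eq_zero_iff {𝔞 : Ideal R} {m : M} :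
    spMk K 𝔞 m = 0 ↔ m ∈ rsub K M 𝔞 := by
  constructor
  · intro h
    have h2 : Submodule.Quotient.mk (show RightModule K R M from m) =
        (0 : RightModule K R M ⧸ (𝔞 • (⊤ : Submodule R (RightModule K R M)))) := by
      have := congrArg (TensorProduct.tensorQuotEquivQuotSMul (RightModule K R M) 𝔞) h
      erw [map_zero, TensorProduct.tensorQuotEquivQuotSMul_tmul_mk (M := RightModule K R M) 𝔞 m 1]
        at this
      have h1 : ((1 : R) • (show RightModule K R M from m)) = m := one_smul R _
      rwa [h1] at this
    have h2 := (Submodule.Quotient.mk_eq_zero _).1 h2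
    refine Submodule.smul_induction_on
      (p := fun x : RightModule K R M => (show M from x) ∈ rsub K M 𝔞) h2 ?_ ?_
    · intro r hr x _; exact rm_mem_rsub hr _
    · intro x y hx hy; exact add_mem hx hy
  · intro h
    change m ∈ AddSubgroup.closure _ at h
    induction h using AddSubgroup.closure_induction with
    | mem x hx =>
      obtain ⟨r, hr, m, rfl⟩ := hx
      change (r • (show RightModule K R M from m)) ⊗ₜ[R] (1 : R ⧸ 𝔞) = 0
      rw [TensorProduct.smul_tmul]
      have : r • (1 : R ⧸ 𝔞) = 0 := by
        rw [Algebra.smul_def, mul_one]; exact Ideal.Quotient.eq_zero_iff_mem.2 hr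
      rw [this, TensorProduct.tmul_zero]
    | zero => exact map_zero _
    | add x y _ _ hx hy => rw [map_add, hx, hy, add_zero]
    | neg x _ hx => rw [map_neg, hx, neg_zero]

/-- The additive map of specialisations induced by a map compatible with the two ideals. -/
def spMapAux {𝔞 𝔟 : Ideal R} (f : M →+ N) (hf : ∀ m ∈ rsub K M 𝔞, f m ∈ rsub K N 𝔟) :
    Specialisation K R M 𝔞 →+ Specialisation K R N 𝔟 :=
  (QuotientAddGroup.lift (spMk K (M := M) 𝔞).ker ((spMk K 𝔟).comp f) (fun m hm =>
    spMk_eq_zero_iff.2 (hf m (spMk_eq_zero_iff.1 hm)))).comp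
    (QuotientAddGroup.quotientKerEquivOfSurjective (spMk K 𝔞)
      (spMk_surjective 𝔞)).symm.toAddMonoidHom

theorem spMapAux_spMk {𝔞 𝔟 : Ideal R} (f : M →+ N)
    (hf : ∀ m ∈ rsub K M 𝔞, f m ∈ rsub K N 𝔟) (m : M) :
    spMapAux f hf (spMk K 𝔞 m) = spMk K 𝔟 (f m) := by
  have : (QuotientAddGroup.quotientKerEquivOfSurjective (spMk K (M := M) 𝔞)
      (spMk_surjective 𝔞)).symm (spMk K 𝔞 m) = QuotientAddGroup.mk m := by
    rw [AddEquiv.symm_apply_eq]; rfl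
  change QuotientAddGroup.lift (spMk K (M := M) 𝔞).ker ((spMk K 𝔟).comp f) (fun m hm =>
    spMk_eq_zero_iff.2 (hf m (spMk_eq_zero_iff.1 hm)))
    ((QuotientAddGroup.quotientKerEquivOfSurjective (spMk K (M := M) 𝔞)
      (spMk_surjective 𝔞)).symm (spMk K 𝔞 m)) = _
  rw [this]
  rfl

/-- The map of specialisations induced by a left linear map compatible with the two ideals. -/
def spMap {𝔞 𝔟 : Ideal R} (f : M →+ N) (hl : ∀ (r : R) m, f (lm K M r m) = lm K N r (f m))
    (hf : ∀ m ∈ rsub K M 𝔞, f m ∈ rsub K N 𝔟) :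
    Specialisation K R M 𝔞 →ₗ[R] Specialisation K R N 𝔟 where
  toFun := spMapAux f hf
  map_add' := map_add _
  map_smul' r x := by
    obtain ⟨m, rfl⟩ := spMk_surjective 𝔞 x
    rw [← lm_spMk, spMapAux_spMk, spMapAux_spMk, hl, lm_spMk, RingHom.id_apply]

@[simp] theorem spMap_spMk {𝔞 𝔟 : Ideal R} (f : M →+ N)
    (hl : ∀ (r : R) m, f (lm K M r m) = lm K N r (f m))
    (hf : ∀ m ∈ rsub K M 𝔞, f m ∈ rsub K N 𝔟) (m : M) :
    spMap f hl hf (spMk K 𝔞 m) = spMk K 𝔟 (f m) := spMapAux_spMk f hf m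

end Bimodules

/-! ### The bimodules `R ⊗_P A` -/

section Cons

variable {K : Type u} {R : Type w} [CommRing K] [CommRing R] [Algebra K R]

theorem lm_carrier (A : GradedBialgebra.{u, w} K R) (r : R) (x : A.carrier) :
    lm K A.carrier r x = r • x := by
  change (Algebra.TensorProduct.productMap (IsScalarTower.toAlgHom K R A.carrier) A.right
    (r ⊗ₜ[K] (1 : R))) * x = r • x
  rw [Algebra.TensorProduct.productMap_apply_tmul, map_one, mul_one, Algebra.smul_def]
  rfl

theorem rm_carrier (A : GradedBialgebra.{u, w} K R) (r : R) (x : A.carrier) :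
    rm K A.carrier r x = A.right r * x := by
  change (Algebra.TensorProduct.productMap (IsScalarTower.toAlgHom K R A.carrier) A.right
    ((1 : R) ⊗ₜ[K] r)) * x = A.right r * x
  rw [Algebra.TensorProduct.productMap_apply_tmul, map_one, one_mul]

theorem lm_unit_eq_rm (degR : ℤ → AddSubgroup R) (r : R)
    (x : (GradedBialgebra.unit (K := K) degR).carrier) :
    lm K (GradedBialgebra.unit (K := K) degR).carrier r x =
      rm K (GradedBialgebra.unit (K := K) degR).carrier r x := by
  rw [lm_carrier, rm_carrier]
  rfl

variable {degR : ℤ → AddSubgroup R} {P : Subalgebra K R} {A : GradedBialgebra.{u, w} K R}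

variable (degR P A) in
/-- The elementary tensors of `R ⊗_P A`. -/
def ctmul : R →+ A.carrier →+ (GradedBialgebra.cons degR P A).carrier :=
  AddMonoidHom.mk' (fun f => AddMonoidHom.mk' (fun y => f ⊗ₜ[P] y)
    fun y z => TensorProduct.tmul_add f y z) fun f g => by
      ext y
      exact TensorProduct.add_tmul f g y

theorem lm_ctmul (r f : R) (y : A.carrier) :
    lm K (GradedBialgebra.cons degR P A).carrier r (ctmul degR P A f y) =
      ctmul degR P A (r * f) y := by
  rw [lm_carrier]
  exact TensorProduct.smul_tmul' r f y

theorem rm_ctmul (r f : R) (y : A.carrier) :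
    rm K (GradedBialgebra.cons degR P A).carrier r (ctmul degR P A f y) =
      ctmul degR P A f (rm K A.carrier r y) := by
  rw [rm_carrier, rm_carrier]
  change ((1 : R) ⊗ₜ[P] A.right r) * (f ⊗ₜ[P] y) = f ⊗ₜ[P] (A.right r * y)
  rw [Algebra.TensorProduct.tmul_mul_tmul, one_mul]

theorem ctmul_mul {p : R} (hp : p ∈ P) (f : R) (y : A.carrier) :
    ctmul degR P A (f * p) y = ctmul degR P A f (lm K A.carrier p y) := by
  rw [lm_carrier, mul_comm]
  exact TensorProduct.smul_tmul (⟨p, hp⟩ : P) f y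

@[elab_as_elim]
theorem cons_induction {motive : (GradedBialgebra.cons degR P A).carrier → Prop}
    (tmul : ∀ f y, motive (ctmul degR P A f y))
    (add : ∀ x y, motive x → motive y → motive (x + y)) (x) : motive x := by
  refine TensorProduct.induction_on (motive := motive) x ?_ tmul add
  have := tmul 0 0
  rwa [map_zero] at this

/-- Additive maps out of `R ⊗_P A` from balanced biadditive maps. -/
def consLift {N : Type*} [AddCommGroup N] (F : R →+ A.carrier →+ N)
    (hF : ∀ p ∈ P, ∀ f y, F (f * p) y = F f (lm K A.carrier p y)) :
    (GradedBialgebra.cons degR P A).carrier →+ N :=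
  TensorProduct.liftAddHom (R := P) F fun p f y => by
    have := hF p p.2 f y
    rw [lm_carrier, mul_comm] at this
    exact this

variable {P' : Subalgebra K R} {A' : GradedBialgebra.{u, w} K R}

/-- The map `φ ⊗ h : R ⊗_P A → R ⊗_{P'} A'`. -/
def consMap (φ : R →+* R) (h : A.carrier →+ A'.carrier)
    (hφ : ∀ p ∈ P, φ p ∈ P')
    (hh : ∀ p ∈ P, ∀ y, h (lm K A.carrier p y) = lm K A'.carrier (φ p) (h y)) :
    (GradedBialgebra.cons degR P A).carrier →+ (GradedBialgebra.cons degR P' A').carrier :=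
  consLift (AddMonoidHom.mk' (fun f => (ctmul degR P' A' (φ f)).comp h) fun f g => by
    ext y; simp) fun p hp f y => by
      change ctmul degR P' A' (φ (f * p)) (h y) = ctmul degR P' A' (φ f) (h _)
      rw [map_mul, ctmul_mul (hφ p hp), hh p hp]

@[simp] theorem consMap_ctmul (φ : R →+* R) (h : A.carrier →+ A'.carrier)
    (hφ : ∀ p ∈ P, φ p ∈ P')
    (hh : ∀ p ∈ P, ∀ y, h (lm K A.carrier p y) = lm K A'.carrier (φ p) (h y))
    (f : R) (y : A.carrier) :
    consMap (degR := degR) φ h hφ hh (ctmul degR P A f y) = ctmul degR P' A' (φ f) (h y) := rfl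

theorem consMap_lm (φ : R →+* R) (h : A.carrier →+ A'.carrier)
    (hφ : ∀ p ∈ P, φ p ∈ P')
    (hh : ∀ p ∈ P, ∀ y, h (lm K A.carrier p y) = lm K A'.carrier (φ p) (h y))
    (r : R) (x : (GradedBialgebra.cons degR P A).carrier) :
    consMap φ h hφ hh (lm K _ r x) = lm K _ (φ r) (consMap φ h hφ hh x) := by
  induction x using cons_induction with
  | tmul f y => simp [lm_ctmul]
  | add x y hx hy => simp [hx, hy]

theorem consMap_rm (φ : R →+* R) (h : A.carrier →+ A'.carrier)
    (hφ : ∀ p ∈ P, φ p ∈ P')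
    (hh : ∀ p ∈ P, ∀ y, h (lm K A.carrier p y) = lm K A'.carrier (φ p) (h y)) (ψ : R → R)
    (hr : ∀ r y, h (rm K A.carrier r y) = rm K A'.carrier (ψ r) (h y))
    (r : R) (x : (GradedBialgebra.cons degR P A).carrier) :
    consMap φ h hφ hh (rm K _ r x) = rm K _ (ψ r) (consMap φ h hφ hh x) := by
  induction x using cons_induction with
  | tmul f y => simp [rm_ctmul, hr]
  | add x y hx hy => simp [hx, hy]

/-- The isomorphism `φ ⊗ h : R ⊗_P A ≃ R ⊗_{P'} A'`. -/
def consEquiv (φ : R ≃+* R) (h : A.carrier ≃+ A'.carrier)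
    (hφ : ∀ p, p ∈ P ↔ φ p ∈ P')
    (hh : ∀ (p : R) y, h (lm K A.carrier p y) = lm K A'.carrier (φ p) (h y)) :
    (GradedBialgebra.cons degR P A).carrier ≃+ (GradedBialgebra.cons degR P' A').carrier :=
  let f := consMap (degR := degR) (φ : R →+* R) h.toAddMonoidHom (fun p hp => (hφ p).1 hp)
    fun p _ y => hh p y
  let g := consMap (degR := degR) (φ.symm : R →+* R) h.symm.toAddMonoidHom
    (fun p hp => (hφ _).2 (by simpa using hp))
    fun p _ y => (AddEquiv.symm_apply_eq h).2 ((hh _ _).trans (by simp)).symm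
  AddEquiv.mk' ⟨f, g, fun x => by
    induction x using cons_induction with
    | tmul r y =>
      change ctmul degR P A (φ.symm (φ r)) (h.symm (h y)) = _
      rw [RingEquiv.symm_apply_apply, AddEquiv.symm_apply_apply]
    | add x y hx hy => simp only [map_add, hx, hy], fun x => by
    induction x using cons_induction with
    | tmul r y =>
      change ctmul degR P' A' (φ (φ.symm r)) (h (h.symm y)) = _
      rw [RingEquiv.apply_symm_apply, AddEquiv.apply_symm_apply]
    | add x y hx hy => simp only [map_add, hx, hy]⟩ (map_add f)

section consEquiv

variable (φ : R ≃+* R) (h : A.carrier ≃+ A'.carrier) (hφ : ∀ p, p ∈ P ↔ φ p ∈ P')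
    (hh : ∀ (p : R) y, h (lm K A.carrier p y) = lm K A'.carrier (φ p) (h y))

theorem consEquiv_lm (r : R) (x : (GradedBialgebra.cons degR P A).carrier) :
    consEquiv φ h hφ hh (lm K _ r x) = lm K _ (φ r) (consEquiv φ h hφ hh x) :=
  consMap_lm (φ : R →+* R) h.toAddMonoidHom (fun p hp => (hφ p).1 hp) (fun p _ y => hh p y) r x

theorem consEquiv_rm (ψ : R → R)
    (hr : ∀ (r : R) y, h (rm K A.carrier r y) = rm K A'.carrier (ψ r) (h y))
    (r : R) (x : (GradedBialgebra.cons degR P A).carrier) :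
    consEquiv φ h hφ hh (rm K _ r x) = rm K _ (ψ r) (consEquiv φ h hφ hh x) :=
  consMap_rm (φ : R →+* R) h.toAddMonoidHom (fun p hp => (hφ p).1 hp) (fun p _ y => hh p y) ψ hr r x

end consEquiv

theorem ctmul_mem_rsub {𝔞 : Ideal R} (f : R) {y : A.carrier} (hy : y ∈ rsub K A.carrier 𝔞) :
    ctmul degR P A f y ∈ rsub K (GradedBialgebra.cons degR P A).carrier 𝔞 :=
  map_mem_rsub_of (ctmul degR P A f)
    (fun r hr m => by rw [← rm_ctmul]; exact rm_mem_rsub hr _) hy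

end Cons

/-! ### The action of the group on regular functions -/

section Action

variable {K : Type u} {V : Type v} [Field K] [AddCommGroup V] [Module K V]
variable {W : Type*} [Group W] (ρ : Representation K W V)

/-- The action of `W` on regular functions, `(w f)(x) = f(w⁻¹ x)`. -/
def act (w : W) : Reg K V →ₐ[K] Reg K V := pull (ρ w⁻¹).toAffineMap

@[simp] theorem evalAt_act (w : W) (f : Reg K V) (x : V) :
    evalAt K x (act ρ w f) = evalAt K (ρ w⁻¹ x) f := rfl

theorem act_mul (w w' : W) (f : Reg K V) : act ρ (w * w') f = act ρ w (act ρ w' f) :=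
  Reg.ext fun x => by simp

@[simp] theorem act_one (f : Reg K V) : act ρ 1 f = f :=
  Reg.ext fun x => by simp

@[simp] theorem act_inv_act (w : W) (f : Reg K V) : act ρ w⁻¹ (act ρ w f) = f := by
  rw [← act_mul]; simp

@[simp] theorem act_act_inv (w : W) (f : Reg K V) : act ρ w (act ρ w⁻¹ f) = f := by
  rw [← act_mul]; simp

/-- The action of a group element, as an automorphism of the algebra of regular functions. -/
def actEquiv (w : W) : Reg K V ≃ₐ[K] Reg K V :=
  AlgEquiv.ofAlgHom (act ρ w) (act ρ w⁻¹) (AlgHom.ext (act_act_inv ρ w))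
    (AlgHom.ext (act_inv_act ρ w))

theorem bottSamelson_nil : bottSamelson ρ [] = GradedBialgebra.unit (regDeg K V) := rfl

theorem bottSamelson_cons (s : W) (l : List W) :
    bottSamelson ρ (s :: l) =
      GradedBialgebra.cons (regDeg K V) (invariants (ρ s)) (bottSamelson ρ l) := rfl

variable {ρ}

theorem act_act_self {s : W} (hs : s * s = 1) (f : Reg K V) : act ρ s (act ρ s f) = f := by
  rw [← act_mul, hs, act_one]

theorem mem_invariants_iff_act {s : W} {f : Reg K V} :
    f ∈ invariants (ρ s) ↔ act ρ s f = f := by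
  rw [mem_invariants]
  constructor
  · intro h
    refine Reg.ext fun x => ?_
    rw [evalAt_act, ← h (ρ s⁻¹ x)]; simp
  · intro h x
    conv_lhs => rw [← h]
    simp

theorem act_mem_invariants {w s s' : W} (hs : w * s = s' * w) {f : Reg K V}
    (hf : f ∈ invariants (ρ s)) : act ρ w f ∈ invariants (ρ s') := by
  rw [mem_invariants_iff_act] at hf ⊢
  rw [← act_mul, ← hs, act_mul, hf]

theorem add_act_mem_invariants {s : W} (hs : s * s = 1) (f : Reg K V) :
    f + act ρ s f ∈ invariants (ρ s) := by
  rw [mem_invariants_iff_act, map_add, act_act_self hs, add_comm]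

theorem mul_act_mem_invariants {s : W} (hs : s * s = 1) (f : Reg K V) :
    f * act ρ s f ∈ invariants (ρ s) := by
  rw [mem_invariants_iff_act, map_mul, act_act_self hs, mul_comm]

theorem act_mem_pointIdeal {w : W} {p : V} {f : Reg K V} (hf : f ∈ pointIdeal K p) :
    act ρ w f ∈ pointIdeal K (ρ w p) := by
  rw [mem_pointIdeal] at hf ⊢
  simpa using hf

variable (ρ) in
/-- `s` acts on `V` as the reflection in the hyperplane `ker α`. -/
structure IsReflectionAlong (s : W) (α : Module.Dual K V) : Prop where
  mul_self : s * s = 1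
  exists_eq : ∃ v, α v = 2 ∧ ∀ x, ρ s x = x - α x • v

namespace IsReflectionAlong

variable {s : W} {α : Module.Dual K V} (h : IsReflectionAlong ρ s α)
include h

theorem inv_eq : s⁻¹ = s := inv_eq_of_mul_eq_one_left h.mul_self

theorem apply (x : V) : α (ρ s x) = - α x := by
  obtain ⟨v, hv, hx⟩ := h.exists_eq
  rw [hx, map_sub, map_smul, hv, smul_eq_mul]; ring

theorem act_linForm : act ρ s (linForm α) = - linForm α :=
  Reg.ext fun x => by simp [h.inv_eq, h.apply]

theorem linForm_sq_mem : linForm α * linForm α ∈ invariants (ρ s) := by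
  rw [mem_invariants_iff_act, map_mul, h.act_linForm, neg_mul_neg]

variable [NeZero (2 : K)]

/-- The difference `f - s f` is divisible by `α`, with an invariant quotient. -/
theorem exists_sub_act_eq (f : Reg K V) :
    ∃ p ∈ invariants (ρ s), f - act ρ s f = linForm α * p := by
  obtain ⟨q, hq⟩ : ∃ q, f - act ρ s f = linForm α * q := by
    obtain ⟨v, hv, hx⟩ := h.exists_eq
    induction f using Reg.induction with
    | lin φ =>
      refine ⟨algebraMap K _ (φ v), Reg.ext fun x => ?_⟩
      simp only [map_sub, map_mul, AlgHom.commutes, evalAt_act, h.inv_eq, evalAt_linForm, hx,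
        map_smul, smul_eq_mul]
      simp
    | const c => exact ⟨0, by rw [AlgHom.commutes]; simp⟩
    | add f g hf hg =>
      obtain ⟨a, ha⟩ := hf
      obtain ⟨b, hb⟩ := hg
      exact ⟨a + b, by rw [map_add, mul_add, ← ha, ← hb]; ring⟩
    | mul f g hf hg =>
      obtain ⟨a, ha⟩ := hf
      obtain ⟨b, hb⟩ := hg
      refine ⟨a * g + act ρ s f * b, ?_⟩
      rw [map_mul]
      linear_combination g * ha + act ρ s f * hb
  have h2 : (algebraMap K (Reg K V) 2⁻¹) * 2 = 1 := by
    rw [← map_ofNat (algebraMap K (Reg K V)) 2, ← map_mul, inv_mul_cancel₀ two_ne_zero, map_one]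
  -- averaging the quotient over `{1, s}` makes it invariant
  refine ⟨algebraMap K _ 2⁻¹ * (q + act ρ s q),
    mul_mem (Subalgebra.algebraMap_mem _ _) (add_act_mem_invariants h.mul_self q), ?_⟩
  have h3 : f - act ρ s f = linForm α * act ρ s q := by
    have := congrArg (act ρ s) hq
    rw [map_sub, act_act_self h.mul_self, map_mul, h.act_linForm] at this
    linear_combination -this
  linear_combination (algebraMap K (Reg K V) 2⁻¹) * hq + (algebraMap K (Reg K V) 2⁻¹) * h3
    + (act ρ s f - f) * h2

/-- Every regular function is of the form `p + α p'` with invariants `p` and `p'`. -/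
theorem exists_eq_add_mul (f : Reg K V) :
    ∃ p ∈ invariants (ρ s), ∃ p' ∈ invariants (ρ s), f = p + linForm α * p' := by
  obtain ⟨q, hq, hfq⟩ := h.exists_sub_act_eq f
  have h2 : (algebraMap K (Reg K V) 2⁻¹) * 2 = 1 := by
    rw [← map_ofNat (algebraMap K (Reg K V)) 2, ← map_mul, inv_mul_cancel₀ two_ne_zero, map_one]
  refine ⟨algebraMap K _ 2⁻¹ * (f + act ρ s f),
    mul_mem (Subalgebra.algebraMap_mem _ _) (add_act_mem_invariants h.mul_self f),
    algebraMap K _ 2⁻¹ * q, mul_mem (Subalgebra.algebraMap_mem _ _) hq, ?_⟩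
  linear_combination (algebraMap K (Reg K V) 2⁻¹) * hfq - f * h2

end IsReflectionAlong

/-! ### Splitting `R ⊗_{R^s} A` away from the reflecting hyperplane -/

/-- Over the complement of the reflecting hyperplane of `s`, where `α` is invertible, the bimodule
`R ⊗_{R^s} A` is the direct sum of `A` (through `i` and `m`) and of the twist of `A` by `s` (through
`j` and `n`). -/
theorem exists_splitting [NeZero (2 : K)] {s : W} {α : Module.Dual K V}
    (h : IsReflectionAlong ρ s α)
    (degR : ℤ → AddSubgroup (Reg K V)) (A : GradedBialgebra.{u, max u v} K (Reg K V)) :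
    ∃ (i j : A.carrier →+ (GradedBialgebra.cons degR (invariants (ρ s)) A).carrier)
      (m n : (GradedBialgebra.cons degR (invariants (ρ s)) A).carrier →+ A.carrier),
      (∀ (r : Reg K V) x, i (lm K _ r x) = lm K _ r (i x)) ∧
      (∀ (r : Reg K V) x, j (lm K _ r x) = lm K _ (act ρ s r) (j x)) ∧
      (∀ (r : Reg K V) x, m (lm K _ r x) = lm K _ r (m x)) ∧
      (∀ (r : Reg K V) x, n (lm K _ r x) = lm K _ (act ρ s r) (n x)) ∧
      (∀ (r : Reg K V) x, i (rm K _ r x) = rm K _ r (i x)) ∧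
      (∀ (r : Reg K V) x, j (rm K _ r x) = rm K _ r (j x)) ∧
      (∀ (r : Reg K V) x, m (rm K _ r x) = rm K _ r (m x)) ∧
      (∀ (r : Reg K V) x, n (rm K _ r x) = rm K _ r (n x)) ∧
      (∀ x, m (i x) = lm K _ (2 * linForm α) x) ∧ (∀ x, n (j x) = - lm K _ (2 * linForm α) x) ∧
      (∀ x, m (j x) = 0) ∧ (∀ x, n (i x) = 0) ∧
      ∀ x, i (m x) + j (n x) = lm K _ (2 * linForm α) x := by
  set P := invariants (ρ s)
  have hα2 : linForm α * linForm α ∈ P := h.linForm_sq_mem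
  -- `i = a + b` and `j = a - b`, where `a x = α ⊗ x` and `b x = 1 ⊗ α x`, while `m (f ⊗ y) = f y`
  -- and `n (f ⊗ y) = (s f) y`; both `a` and `b` are linear over `R^s`, and `α` exchanges them
  let a : A.carrier →+ (GradedBialgebra.cons degR P A).carrier := ctmul degR P A (linForm α)
  let b : A.carrier →+ (GradedBialgebra.cons degR P A).carrier :=
    (ctmul degR P A 1).comp (lm K A.carrier (linForm α)).toAddMonoidHom
  have ha : ∀ x, a x = ctmul degR P A (linForm α) x := fun _ => rfl
  have hb : ∀ x, b x = ctmul degR P A 1 (lm K _ (linForm α) x) := fun _ => rfl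
  let m : (GradedBialgebra.cons degR P A).carrier →+ A.carrier :=
    consLift (AddMonoidHom.mk' (fun f => (lm K A.carrier f).toAddMonoidHom) fun f g => by
      ext y; simp) fun p hp f y => lm_mul_apply f p y
  let n : (GradedBialgebra.cons degR P A).carrier →+ A.carrier :=
    consLift (AddMonoidHom.mk' (fun f => (lm K A.carrier (act ρ s f)).toAddMonoidHom) fun f g => by
      ext y; simp) fun p hp f y => by
        change lm K _ (act ρ s (f * p)) y = lm K _ (act ρ s f) (lm K _ p y)
        rw [map_mul, mem_invariants_iff_act.1 hp, lm_mul_apply]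
  have hm : ∀ f y, m (ctmul degR P A f y) = lm K _ f y := fun _ _ => rfl
  have hn : ∀ f y, n (ctmul degR P A f y) = lm K _ (act ρ s f) y := fun _ _ => rfl
  have hp1 : ∀ p ∈ P, ∀ x, a (lm K _ p x) = lm K _ p (a x) := fun p hp x => by
    rw [ha, ha, ← ctmul_mul hp, lm_ctmul, mul_comm]
  have hp2 : ∀ p ∈ P, ∀ x, b (lm K _ p x) = lm K _ p (b x) := fun p hp x => by
    rw [hb, hb, lm_lm_comm, ← ctmul_mul hp, lm_ctmul, mul_comm]
  have hab : ∀ x, a (lm K _ (linForm α) x) = lm K _ (linForm α) (b x) := fun x => by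
    rw [ha, hb, lm_ctmul, mul_one]
  have hba : ∀ x, b (lm K _ (linForm α) x) = lm K _ (linForm α) (a x) := fun x => by
    rw [ha, hb, lm_ctmul, ← lm_mul_apply, ← ctmul_mul hα2, one_mul]
  refine ⟨a + b, a - b, m, n, fun r x => ?_, fun r x => ?_, fun r x => ?_, fun r x => ?_,
    fun r x => ?_, fun r x => ?_, fun r x => ?_, fun r x => ?_, fun x => ?_, fun x => ?_,
    fun x => ?_, fun x => ?_, fun x => ?_⟩
  · obtain ⟨p, hp, p', hp', rfl⟩ := h.exists_eq_add_mul r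
    simp only [map_add, LinearMap.add_apply, lm_mul_apply, AddMonoidHom.add_apply, hp1 _ hp,
      hp2 _ hp, hab, hba, hp1 _ hp', hp2 _ hp', lm_lm_comm (linForm α)]
    abel
  · obtain ⟨p, hp, p', hp', rfl⟩ := h.exists_eq_add_mul r
    simp only [map_add, map_mul, h.act_linForm, mem_invariants_iff_act.1 hp,
      mem_invariants_iff_act.1 hp', LinearMap.add_apply, Module.End.mul_apply,
      AddMonoidHom.sub_apply, hp1 _ hp, map_neg, LinearMap.neg_apply, map_sub,
      hp2 _ hp, hab, hba, hp1 _ hp', hp2 _ hp', lm_lm_comm (linForm α)]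
    abel
  · induction x using cons_induction with
    | tmul f y => rw [lm_ctmul, hm, hm, lm_mul_apply]
    | add x y hx hy => simp only [map_add, hx, hy]
  · induction x using cons_induction with
    | tmul f y => rw [lm_ctmul, hn, hn, map_mul, lm_mul_apply]
    | add x y hx hy => simp only [map_add, hx, hy]
  · simp only [AddMonoidHom.add_apply, ha, hb, lm_rm_comm, ← rm_ctmul, map_add]
  · simp only [AddMonoidHom.sub_apply, ha, hb, lm_rm_comm, ← rm_ctmul, map_sub]
  · induction x using cons_induction with
    | tmul f y => rw [rm_ctmul, hm, hm, lm_rm_comm]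
    | add x y hx hy => simp only [map_add, hx, hy]
  · induction x using cons_induction with
    | tmul f y => rw [rm_ctmul, hn, hn, lm_rm_comm]
    | add x y hx hy => simp only [map_add, hx, hy]
  · rw [AddMonoidHom.add_apply, map_add, ha, hb, hm, hm, map_one, two_mul, map_add]; rfl
  · rw [AddMonoidHom.sub_apply, map_sub, ha, hb, hn, hn, map_one, map_one, two_mul, map_add,
      h.act_linForm, map_neg]
    simp only [LinearMap.neg_apply, Module.End.one_apply, LinearMap.add_apply]; abel
  · rw [AddMonoidHom.sub_apply, map_sub, ha, hb, hm, hm, map_one]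
    exact sub_self _
  · rw [AddMonoidHom.add_apply, map_add, ha, hb, hn, hn, map_one, map_one, h.act_linForm, map_neg]
    simp
  · induction x using cons_induction with
    | tmul f y =>
      have hs : f + act ρ s f ∈ P := add_act_mem_invariants h.mul_self f
      have hd : linForm α * (f - act ρ s f) ∈ P := by
        rw [mem_invariants_iff_act, map_mul, map_sub, act_act_self h.mul_self, h.act_linForm]; ring
      have h1 : (a + b) (m (ctmul degR P A f y)) + (a - b) (n (ctmul degR P A f y)) =
          ctmul degR P A (linForm α) (lm K _ (f + act ρ s f) y) +
          ctmul degR P A 1 (lm K _ (linForm α * (f - act ρ s f)) y) := by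
        simp only [hm, hn, AddMonoidHom.add_apply, AddMonoidHom.sub_apply, ha, hb, map_add,
          LinearMap.add_apply, map_mul, map_sub, Module.End.mul_apply, LinearMap.sub_apply]
        abel
      rw [h1, ← ctmul_mul hs, ← ctmul_mul hd, lm_ctmul, ← AddMonoidHom.add_apply, ← map_add]
      congr 2
      ring
    | add x y hx hy =>
      simp only [map_add] at hx hy ⊢
      rw [← hx, ← hy]; abel

/-! ### The support of a specialised Bott–Samelson bimodule -/

/-- If left multiplication by an ideal `𝔠` stable under `s` sends `A` into `A 𝔞`, then that by `𝔠²`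
sends `B = R ⊗_{R^s} A` into `B 𝔞`. -/
theorem sq_lm_mem_rsub_cons [NeZero (2 : K)] {s : W} (hs : s * s = 1)
    {degR : ℤ → AddSubgroup (Reg K V)} {A : GradedBialgebra.{u, max u v} K (Reg K V)}
    {𝔞 𝔠 : Ideal (Reg K V)} (h𝔠 : ∀ f ∈ 𝔠, act ρ s f ∈ 𝔠)
    (hA : ∀ f ∈ 𝔠, ∀ x, lm K A.carrier f x ∈ rsub K A.carrier 𝔞) :
    ∀ f ∈ 𝔠 * 𝔠, ∀ x, lm K (GradedBialgebra.cons degR (invariants (ρ s)) A).carrier f x ∈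
      rsub K (GradedBialgebra.cons degR (invariants (ρ s)) A).carrier 𝔞 := by
  -- `g² = (g + s g) g - g s g`, where `g + s g` and `g s g` are invariants lying in `𝔠`
  have key : ∀ g ∈ 𝔠, ∀ x, lm K (GradedBialgebra.cons degR (invariants (ρ s)) A).carrier (g * g) x ∈
      rsub K (GradedBialgebra.cons degR (invariants (ρ s)) A).carrier 𝔞 := by
    intro g hg x
    induction x using cons_induction with
    | tmul f y =>
      have : g * g * f = (f * g) * (g + act ρ s g) - f * (g * act ρ s g) := by ring
      rw [lm_ctmul, this, map_sub, AddMonoidHom.sub_apply,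
        ctmul_mul (add_act_mem_invariants hs g), ctmul_mul (mul_act_mem_invariants hs g)]
      exact sub_mem (ctmul_mem_rsub _ (hA _ (add_mem hg (h𝔠 g hg)) _))
        (ctmul_mem_rsub _ (hA _ (Ideal.mul_mem_right _ _ hg) _))
    | add x y hx hy => rw [map_add]; exact add_mem hx hy
  intro f hf x
  have h2 : (algebraMap K (Reg K V) 2⁻¹) * 2 = 1 := by
    rw [← map_ofNat (algebraMap K (Reg K V)) 2, ← map_mul, inv_mul_cancel₀ two_ne_zero, map_one]
  induction hf using Submodule.mul_induction_on' with
  | mem_mul_mem g hg g' hg' =>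
    have : g * g' = algebraMap K (Reg K V) 2⁻¹ * ((g + g') * (g + g') - g * g - g' * g') := by
      linear_combination (-g * g') * h2
    rw [this, lm_mul_apply, map_sub, map_sub]
    exact lm_mem_rsub _ (sub_mem (sub_mem (key _ (add_mem hg hg') x) (key _ hg x)) (key _ hg' x))
  | add f _ g _ hf hg => rw [map_add]; exact add_mem hf hg

theorem act_mem_prod_pointIdeal [DecidableEq V] {s : W} {F : Finset V}
    (hF : F.image (ρ s) = F) (N : ℕ) {f : Reg K V} (hf : f ∈ (∏ p ∈ F, pointIdeal K p) ^ N) :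
    act ρ s f ∈ (∏ p ∈ F, pointIdeal K p) ^ N := by
  have h1 : Ideal.map (act ρ s) (∏ p ∈ F, pointIdeal K p) ≤ ∏ p ∈ F, pointIdeal K p := by
    rw [show Ideal.map (act ρ s) (∏ p ∈ F, pointIdeal K p) =
        ∏ p ∈ F, Ideal.map (act ρ s) (pointIdeal K p)
      from map_prod (Ideal.mapHom (act ρ s)) _ _]
    conv_rhs => rw [← hF, Finset.prod_image (fun x _ y _ e => by
      have := congrArg (ρ s⁻¹) e; simpa using this)]
    exact Finset.prod_le_prod' fun p _ => Ideal.map_le_iff_le_comap.2 fun g hg =>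
      act_mem_pointIdeal hg
  have h2 := Ideal.pow_right_mono h1 N
  rw [← Ideal.map_pow] at h2
  exact h2 (Ideal.mem_map_of_mem _ hf)

/-- The specialisation at `a` of a Bott–Samelson bimodule is supported at finitely many points of
any set which contains `a` and is stable under the letters of the word. -/
theorem exists_finset_support [NeZero (2 : K)] (l : List W) (hl : ∀ s ∈ l, s * s = 1) (a : V)
    (O : Set V) (ha : a ∈ O) (hO : ∀ s ∈ l, ∀ p ∈ O, ρ s p ∈ O) :
    ∃ F : Finset V, ↑F ⊆ O ∧ ∃ N : ℕ, ∀ f ∈ (∏ p ∈ F, pointIdeal K p) ^ N,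
      ∀ x, lm K (bottSamelson ρ l).carrier f x ∈
        rsub K (bottSamelson ρ l).carrier (pointIdeal K a) := by
  classical
  induction l with
  | nil =>
    rw [bottSamelson_nil]
    refine ⟨{a}, by simpa using ha, 1, fun f hf x => ?_⟩
    rw [Finset.prod_singleton, pow_one] at hf
    rw [lm_unit_eq_rm]
    exact rm_mem_rsub hf x
  | cons s l ih =>
    obtain ⟨F, hFO, N, hN⟩ := ih (fun t ht => hl t (by simp [ht]))
      (fun t ht => hO t (by simp [ht]))
    have hs : s * s = 1 := hl s (by simp)
    refine ⟨F ∪ F.image (ρ s), ?_, N + N, ?_⟩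
    · intro p hp
      rcases Finset.mem_union.1 hp with hp | hp
      · exact hFO hp
      · obtain ⟨p, hp', rfl⟩ := Finset.mem_image.1 hp
        exact hO s (by simp) p (hFO hp')
    · have hss : ∀ p, ρ s (ρ s p) = p := fun p => by
        rw [← Module.End.mul_apply, ← map_mul, hs]; simp
      have hF : (F ∪ F.image (ρ s)).image (ρ s) = F ∪ F.image (ρ s) := by
        rw [Finset.image_union, Finset.image_image, Finset.union_comm]
        rw [show ρ s ∘ ρ s = id from funext hss, Finset.image_id]
      have hle : (∏ p ∈ F ∪ F.image (ρ s), pointIdeal K p) ≤ ∏ p ∈ F, pointIdeal K p := by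
        rw [← Finset.prod_sdiff (Finset.subset_union_left (s₁ := F) (s₂ := F.image (ρ s)))]
        exact Ideal.mul_le_right
      rw [pow_add]
      rw [bottSamelson_cons]
      exact sq_lm_mem_rsub_cons hs (fun f hf => act_mem_prod_pointIdeal hF N hf)
        fun f hf => hN f (Ideal.pow_right_mono hle N hf)

end Action

section LocalSplitting

variable {K : Type u} {V : Type v} [Field K] [AddCommGroup V] [Module K V]
variable {W : Type*} [Group W] (ρ : Representation K W V)

/-! ### Twisting Bott–Samelson bimodules by group elements -/

/-- The action of `w` on regular functions identifies the Bott–Samelson bimodule of a word with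
that of the conjugated word, up to twisting both actions by `w`. -/
theorem exists_conj_equiv (w : W) (l : List W) :
    ∃ c : (bottSamelson ρ l).carrier ≃+ (bottSamelson ρ (l.map fun s => w * s * w⁻¹)).carrier,
      (∀ (r : Reg K V) x, c (lm K _ r x) = lm K _ (act ρ w r) (c x)) ∧
      (∀ (r : Reg K V) x, c (rm K _ r x) = rm K _ (act ρ w r) (c x)) := by
  induction l with
  | nil =>
    rw [List.map_nil, bottSamelson_nil]
    have hl : ∀ (r : Reg K V) (x : (GradedBialgebra.unit (K := K) (regDeg K V)).carrier),
        lm K _ r x = (show Reg K V from r * (show Reg K V from x)) := fun r x => lm_carrier _ r x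
    have he : ∀ r x : Reg K V, actEquiv ρ w (r * x) = act ρ w r * actEquiv ρ w x :=
      fun r x => map_mul (act ρ w) r x
    refine ⟨(actEquiv ρ w).toAddEquiv, fun r x => ?_, fun r x => ?_⟩
    · rw [hl, hl]; exact he r x
    · rw [← lm_unit_eq_rm, ← lm_unit_eq_rm, hl, hl]; exact he r x
  | cons s l ih =>
    obtain ⟨c, hcl, hcr⟩ := ih
    rw [List.map_cons, bottSamelson_cons, bottSamelson_cons]
    have h1 : ∀ p, p ∈ invariants (ρ s) ↔ actEquiv ρ w p ∈ invariants (ρ (w * s * w⁻¹)) := by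
      refine fun p => ⟨fun hp => act_mem_invariants (by group) hp, fun hp => ?_⟩
      rw [← act_inv_act ρ w p]
      exact act_mem_invariants (show w⁻¹ * (w * s * w⁻¹) = s * w⁻¹ by group) hp
    exact ⟨consEquiv (actEquiv ρ w).toRingEquiv c h1 hcl,
      consEquiv_lm (actEquiv ρ w).toRingEquiv c h1 hcl,
      consEquiv_rm (actEquiv ρ w).toRingEquiv c h1 hcl (act ρ w) hcr⟩

/-! ### Splitting a Bott–Samelson bimodule near a point of the orbit -/

/-- A splitting of the bimodule `A` near the point `(t a, a)`: bimodule maps `incl k` and `proj k`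
between `A` and Bott–Samelson bimodules of words in `S'`, the right action on the latter being
twisted by `t`, which become mutually inverse once `σ` is inverted on the left and `A` is
specialised at `a` and localised at `t a`; the factor `τ` kills the part of the specialisation
which is supported away from `t a`. -/
structure LocalSplitting (S' : Set W) (t : W) (a : V)
    (A : GradedBialgebra.{u, max u v} K (Reg K V)) where
  ι : Type
  [fintype : Fintype ι]
  obj : ι → GradedBialgebra.{u, max u v} K (Reg K V)
  incl : ∀ k, (obj k).carrier →+ A.carrier
  proj : ∀ k, A.carrier →+ (obj k).carrier
  σ : Reg K V
  τ : Reg K V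
  exists_word : ∀ k, ∃ l : List W, (∀ s ∈ l, s ∈ S') ∧ obj k = bottSamelson ρ l
  evalAt_σ : evalAt K (ρ t a) σ ≠ 0
  evalAt_τ : evalAt K (ρ t a) τ ≠ 0
  incl_lm : ∀ k (r : Reg K V) x, incl k (lm K _ r x) = lm K _ r (incl k x)
  incl_rm : ∀ k (r : Reg K V) x, incl k (rm K _ r x) = rm K _ (act ρ t⁻¹ r) (incl k x)
  proj_lm : ∀ k (r : Reg K V) x, proj k (lm K _ r x) = lm K _ r (proj k x)
  proj_rm : ∀ k (r : Reg K V) x, proj k (rm K _ r x) = rm K _ (act ρ t r) (proj k x)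
  proj_incl : ∀ k x, proj k (incl k x) = lm K _ σ x
  proj_incl_of_ne : ∀ k j, k ≠ j → ∀ x, proj k (incl j x) = 0
  sum_incl_proj : ∀ x, lm K _ τ (∑ k, incl k (proj k x) - lm K _ σ x) ∈
    rsub K A.carrier (pointIdeal K a)

attribute [instance] LocalSplitting.fintype

namespace LocalSplitting

variable {ρ} {S' : Set W} {a : V}

/-- The regular bimodule at a point of the diagonal. -/
def one : LocalSplitting ρ S' 1 a (bottSamelson ρ []) where
  ι := Unit
  obj _ := bottSamelson ρ []
  incl _ := AddMonoidHom.id _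
  proj _ := AddMonoidHom.id _
  σ := 1
  τ := 1
  exists_word _ := ⟨[], by simp, rfl⟩
  evalAt_σ := by simp
  evalAt_τ := by simp
  incl_lm _ _ _ := rfl
  incl_rm _ r x := by simp
  proj_lm _ _ _ := rfl
  proj_rm _ r x := by simp
  proj_incl _ x := by simp
  proj_incl_of_ne k j h := (h rfl).elim
  sum_incl_proj x := by simp

/-- The regular bimodule at a point off the diagonal. -/
def empty {t : W} (ht : ρ t a ≠ a) : LocalSplitting ρ S' t a (bottSamelson ρ []) where
  ι := Empty
  obj k := k.elim
  incl k := k.elim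
  proj k := k.elim
  σ := 1
  τ := (exists_evalAt_eq_zero_ne (K := K) ht.symm).choose
  exists_word k := k.elim
  evalAt_σ := by simp
  evalAt_τ := (exists_evalAt_eq_zero_ne (K := K) ht.symm).choose_spec.2
  incl_lm k := k.elim
  incl_rm k := k.elim
  proj_lm k := k.elim
  proj_rm k := k.elim
  proj_incl k := k.elim
  proj_incl_of_ne k := k.elim
  sum_incl_proj x := by
    have := lm_unit_eq_rm (K := K) (regDeg K V)
    rw [← bottSamelson_nil ρ] at this
    rw [this]
    exact rm_mem_rsub (exists_evalAt_eq_zero_ne (K := K) ht.symm).choose_spec.1 _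

variable {t s : W} {A : GradedBialgebra.{u, max u v} K (Reg K V)}

/-- If `s` fixes the point `t a`, a splitting is induced up along `R^s ⊆ R`; the functions `σ` and
`τ` are made invariant under `s`. -/
theorem nonempty_cons_of_fixed (X : LocalSplitting ρ S' t a A) (hs : s * s = 1)
    (hfix : ρ s (ρ t a) = ρ t a) (hsS : s ∈ S') :
    Nonempty (LocalSplitting ρ S' t a
      (GradedBialgebra.cons (regDeg K V) (invariants (ρ s)) A)) := by
  -- `σ (s σ)` is invariant, so that it can be moved across the tensor product; to make
  -- `proj ∘ incl` equal to it, the inclusions are multiplied by `s σ`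
  set P := invariants (ρ s)
  let X' := fun k => GradedBialgebra.cons (regDeg K V) P (X.obj k)
  have h1 : ∀ p ∈ P, ∀ k y, ((X.incl k).comp (lm K _ (act ρ s X.σ)).toAddMonoidHom) (lm K _ p y) =
      lm K _ p (((X.incl k).comp (lm K _ (act ρ s X.σ)).toAddMonoidHom) y) := fun p _ k y => by
    change X.incl k (lm K _ _ (lm K _ _ y)) = lm K _ _ (X.incl k (lm K _ _ y))
    rw [← X.incl_lm, lm_lm_comm]
  let incl : ∀ k, (X' k).carrier →+ (GradedBialgebra.cons (regDeg K V) P A).carrier := fun k =>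
    consMap (RingHom.id _) ((X.incl k).comp (lm K _ (act ρ s X.σ)).toAddMonoidHom)
      (fun _ h => h) fun p hp y => h1 p hp k y
  let proj : ∀ k, (GradedBialgebra.cons (regDeg K V) P A).carrier →+ (X' k).carrier := fun k =>
    consMap (RingHom.id _) (X.proj k) (fun _ h => h) fun p _ y => X.proj_lm k p y
  have hincl : ∀ k f y, incl k (ctmul _ _ _ f y) =
      ctmul _ _ _ f (lm K _ (act ρ s X.σ) (X.incl k y)) := fun k f y => by
    rw [← X.incl_lm]; rfl
  have hproj : ∀ k f y, proj k (ctmul _ _ _ f y) = ctmul _ _ _ f (X.proj k y) := fun k f y => rfl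
  have hσ := mul_act_mem_invariants (ρ := ρ) hs X.σ
  have hτ := mul_act_mem_invariants (ρ := ρ) hs X.τ
  refine ⟨⟨X.ι, X', incl, proj, X.σ * act ρ s X.σ, X.τ * act ρ s X.τ, fun k => ?_, ?_, ?_,
    fun k r x => ?_, fun k r x => ?_, fun k r x => ?_, fun k r x => ?_, fun k x => ?_,
    fun k j hkj x => ?_, fun x => ?_⟩⟩
  · obtain ⟨l, hl, hX⟩ := X.exists_word k
    refine ⟨s :: l, fun r hr => ?_, by rw [bottSamelson_cons, ← hX]⟩
    rcases List.mem_cons.1 hr with rfl | hr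
    · exact hsS
    · exact hl r hr
  · rw [map_mul, evalAt_act, inv_eq_of_mul_eq_one_left hs, hfix]
    exact mul_ne_zero X.evalAt_σ X.evalAt_σ
  · rw [map_mul, evalAt_act, inv_eq_of_mul_eq_one_left hs, hfix]
    exact mul_ne_zero X.evalAt_τ X.evalAt_τ
  · induction x using cons_induction with
    | tmul f y => rw [lm_ctmul, hincl, hincl, lm_ctmul]
    | add x y hx hy => simp only [map_add, hx, hy]
  · induction x using cons_induction with
    | tmul f y => rw [rm_ctmul, hincl, hincl, rm_ctmul, X.incl_rm, lm_rm_comm]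
    | add x y hx hy => simp only [map_add, hx, hy]
  · induction x using cons_induction with
    | tmul f y => rw [lm_ctmul, hproj, hproj, lm_ctmul]
    | add x y hx hy => simp only [map_add, hx, hy]
  · induction x using cons_induction with
    | tmul f y => rw [rm_ctmul, hproj, hproj, rm_ctmul, X.proj_rm]
    | add x y hx hy => simp only [map_add, hx, hy]
  · induction x using cons_induction with
    | tmul f y =>
      rw [hincl, hproj, lm_ctmul, mul_comm _ f, ctmul_mul hσ, mul_comm X.σ, lm_mul_apply, X.proj_lm,
        X.proj_incl]
    | add x y hx hy => simp only [map_add, hx, hy]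
  · induction x using cons_induction with
    | tmul f y => rw [hincl, hproj, X.proj_lm, X.proj_incl_of_ne k j hkj, map_zero, map_zero]
    | add x y hx hy => simp only [map_add, hx, hy, add_zero]
  · induction x using cons_induction with
    | tmul f y =>
      simp only [hproj, hincl]
      rw [← map_sum, ← map_sum, lm_ctmul, mul_comm _ f, ctmul_mul hσ,
        ← map_sub, lm_ctmul, mul_comm _ f, ctmul_mul hτ]
      refine ctmul_mem_rsub _ ?_
      rw [mul_comm X.σ, lm_mul_apply _ X.σ, ← map_sub, mul_comm X.τ, lm_mul_apply, lm_lm_comm X.τ]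
      exact lm_mem_rsub _ (lm_mem_rsub _ (X.sum_incl_proj y))
    | add x y hx hy =>
      have e : ∀ a b c d : (GradedBialgebra.cons (regDeg K V) P A).carrier,
        a + b - (c + d) = (a - c) + (b - d) := fun a b c d => by abel
      simp only [map_add, Finset.sum_add_distrib, e]
      exact add_mem hx hy

/-- If the reflection `s` moves the point `t a`, then the part of `R ⊗_{R^s} A` near `t a` is the
sum of the part of `A` near `t a` and of the twist by `s` of the part of `A` near `s t a`. -/
theorem nonempty_cons_of_moved [NeZero (2 : K)] {α : Module.Dual K V}
    (X : LocalSplitting ρ S' t a A)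
    {S'' : Set W} (Y : LocalSplitting ρ S'' (s * t) a A) (hs : IsReflectionAlong ρ s α)
    (hmove : ρ s (ρ t a) ≠ ρ t a) (hS : ∀ r ∈ S'', s * r * s⁻¹ ∈ S') :
    Nonempty (LocalSplitting ρ S' t a
      (GradedBialgebra.cons (regDeg K V) (invariants (ρ s)) A)) := by
  have h := exists_splitting hs (regDeg K V) A
  generalize GradedBialgebra.cons (regDeg K V) (invariants (ρ s)) A = B at h ⊢
  obtain ⟨i, j, m, n, hil, hjl, hml, hnl, hir, hjr, hmr, hnr, hmi, hnj, hmj, hni, hsum⟩ := h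
  have hss := hs.mul_self
  have hsi := hs.inv_eq
  have hex : ∀ k, ∃ (Z : GradedBialgebra.{u, max u v} K (Reg K V))
      (c : (Y.obj k).carrier ≃+ Z.carrier),
      (∃ l : List W, (∀ r ∈ l, r ∈ S') ∧ Z = bottSamelson ρ l) ∧
      (∀ (r : Reg K V) x, c (lm K _ r x) = lm K _ (act ρ s r) (c x)) ∧
      (∀ (r : Reg K V) x, c (rm K _ r x) = rm K _ (act ρ s r) (c x)) := fun k => by
    obtain ⟨l, hl, hY⟩ := Y.exists_word k
    rw [hY]
    obtain ⟨c, hc⟩ := exists_conj_equiv ρ s l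
    refine ⟨_, c, ⟨_, fun r hr => ?_, rfl⟩, hc⟩
    obtain ⟨r, hr', rfl⟩ := List.mem_map.1 hr
    exact hS r (hl r hr')
  choose Z c hZ hcl hcr using hex
  have hcl' : ∀ k (r : Reg K V) x, (c k).symm (lm K _ r x) = lm K _ (act ρ s r) ((c k).symm x) :=
    fun k r x => by
      rw [AddEquiv.symm_apply_eq, hcl, act_act_self hss, AddEquiv.apply_symm_apply]
  have hcr' : ∀ k (r : Reg K V) x, (c k).symm (rm K _ r x) = rm K _ (act ρ s r) ((c k).symm x) :=
    fun k r x => by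
      rw [AddEquiv.symm_apply_eq, hcr, act_act_self hss, AddEquiv.apply_symm_apply]
  have hα : α (ρ t a) ≠ 0 := by
    obtain ⟨v, hv, hx⟩ := hs.exists_eq
    intro h0
    exact hmove (by rw [hx, h0, zero_smul, sub_zero])
  -- the terms coming from `Y` are twisted by `s`; multiplying the inclusions of `X` by `s σ_Y` and
  -- those of `Y` by `s σ_X` gives both kinds of terms the same `σ`
  let σ := 2 * linForm α * (X.σ * act ρ s Y.σ)
  let i1 : ∀ k, (X.obj k).carrier →+ B.carrier := fun k =>
    i.comp ((lm K _ (act ρ s Y.σ)).toAddMonoidHom.comp (X.incl k))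
  let i2 : ∀ k, (Z k).carrier →+ B.carrier := fun k =>
    j.comp ((lm K _ (act ρ s X.σ)).toAddMonoidHom.comp
        ((Y.incl k).comp (c k).symm.toAddMonoidHom))
  let p1 : ∀ k, B.carrier →+ (X.obj k).carrier := fun k => (X.proj k).comp m
  let p2 : ∀ k, B.carrier →+ (Z k).carrier := fun k => (c k).toAddMonoidHom.comp ((Y.proj k).comp n)
  have hi1 : ∀ k x, i1 k x = i (lm K _ (act ρ s Y.σ) (X.incl k x)) := fun _ _ => rfl
  have hi2 : ∀ k x, i2 k x = j (lm K _ (act ρ s X.σ) (Y.incl k ((c k).symm x))) :=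
    fun _ _ => rfl
  have hp1 : ∀ k x, p1 k x = X.proj k (m x) := fun _ _ => rfl
  have hp2 : ∀ k x, p2 k x = c k (Y.proj k (n x)) := fun _ _ => rfl
  have i1l : ∀ k (r : Reg K V) x, i1 k (lm K _ r x) = lm K _ r (i1 k x) := fun k r x => by
    rw [hi1, hi1, ← hil, X.incl_lm, lm_lm_comm]
  have i2l : ∀ k (r : Reg K V) x, i2 k (lm K _ r x) = lm K _ r (i2 k x) := fun k r x => by
    rw [hi2, hi2, hcl', Y.incl_lm, lm_lm_comm, hjl, act_act_self hss]
  have i1r : ∀ k (r : Reg K V) x, i1 k (rm K _ r x) = rm K _ (act ρ t⁻¹ r) (i1 k x) :=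
    fun k r x => by rw [hi1, hi1, X.incl_rm, lm_rm_comm, hir]
  have i2r : ∀ k (r : Reg K V) x, i2 k (rm K _ r x) = rm K _ (act ρ t⁻¹ r) (i2 k x) :=
    fun k r x => by
      rw [hi2, hi2, hcr', Y.incl_rm, lm_rm_comm, hjr, ← act_mul, mul_inv_rev, inv_mul_cancel_right]
  have p1l : ∀ k (r : Reg K V) x, p1 k (lm K _ r x) = lm K _ r (p1 k x) := fun k r x => by
    rw [hp1, hp1, hml, X.proj_lm]
  have p2l : ∀ k (r : Reg K V) x, p2 k (lm K _ r x) = lm K _ r (p2 k x) := fun k r x => by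
    rw [hp2, hp2, hnl, Y.proj_lm, hcl, act_act_self hss]
  have p1r : ∀ k (r : Reg K V) x, p1 k (rm K _ r x) = rm K _ (act ρ t r) (p1 k x) :=
    fun k r x => by rw [hp1, hp1, hmr, X.proj_rm]
  have p2r : ∀ k (r : Reg K V) x, p2 k (rm K _ r x) = rm K _ (act ρ t r) (p2 k x) :=
    fun k r x => by
      rw [hp2, hp2, hnr, Y.proj_rm, hcr, ← act_mul, ← mul_assoc, hss, one_mul]
  have pi1 : ∀ k x, p1 k (i1 k x) = lm K _ σ x := fun k x => by
    rw [hi1, hp1, hmi, ← lm_mul_apply, X.proj_lm, X.proj_incl, ← lm_mul_apply]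
    congr 2
    change _ = 2 * linForm α * (X.σ * act ρ s Y.σ)
    ring
  have pi2 : ∀ k x, p2 k (i2 k x) = lm K _ σ x := fun k x => by
    rw [hi2, hp2, hnj, ← lm_mul_apply, map_neg, Y.proj_lm, Y.proj_incl, map_neg, hcl, hcl,
      AddEquiv.apply_symm_apply, ← lm_mul_apply, ← LinearMap.neg_apply, ← map_neg, map_mul,
      map_mul, act_act_self hss, hs.act_linForm, map_ofNat]
    congr 2
    change _ = 2 * linForm α * (X.σ * act ρ s Y.σ)
    ring
  have pi11 : ∀ k k', k ≠ k' → ∀ x, p1 k (i1 k' x) = 0 := fun k k' hk x => by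
    rw [hi1, hp1, hmi, ← lm_mul_apply, X.proj_lm, X.proj_incl_of_ne k k' hk, map_zero]
  have pi22 : ∀ k k', k ≠ k' → ∀ x, p2 k (i2 k' x) = 0 := fun k k' hk x => by
    rw [hi2, hp2, hnj, ← lm_mul_apply, map_neg, Y.proj_lm, Y.proj_incl_of_ne k k' hk, map_zero,
      neg_zero, map_zero]
  have pi12 : ∀ k k' x, p1 k (i2 k' x) = 0 := fun k k' x => by
    rw [hi2, hp1, hmj, map_zero]
  have pi21 : ∀ k k' x, p2 k (i1 k' x) = 0 := fun k k' x => by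
    rw [hi1, hp2, hni, map_zero, map_zero]
  have hfin : ∀ x, lm K _ (X.τ * act ρ s Y.τ)
      (∑ k, i1 k (p1 k x) + ∑ k, i2 k (p2 k x) - lm K _ σ x) ∈
      rsub K B.carrier (pointIdeal K a) := fun x => by
    simp only [hi1, hi2, hp1, hp2, AddEquiv.symm_apply_apply]
    have h1 : i (lm K _ (X.τ * act ρ s Y.τ) (lm K _ (act ρ s Y.σ)
        (∑ k, X.incl k (X.proj k (m x)) - lm K _ X.σ (m x)))) ∈
        rsub K B.carrier (pointIdeal K a) := by
      refine map_mem_rsub_of_twist i id hir (fun _ h => h) ?_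
      rw [mul_comm, lm_mul_apply, lm_lm_comm X.τ]
      exact lm_mem_rsub _ (lm_mem_rsub _ (X.sum_incl_proj _))
    have h2 : j (lm K _ (Y.τ * act ρ s X.τ) (lm K _ (act ρ s X.σ)
        (∑ k, Y.incl k (Y.proj k (n x)) - lm K _ Y.σ (n x)))) ∈
        rsub K B.carrier (pointIdeal K a) := by
      refine map_mem_rsub_of_twist j id hjr (fun _ h => h) ?_
      rw [mul_comm, lm_mul_apply, lm_lm_comm Y.τ]
      exact lm_mem_rsub _ (lm_mem_rsub _ (Y.sum_incl_proj _))
    have h3 := add_mem h1 h2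
    rw [hil, hjl, map_mul (act ρ s), act_act_self hss, mul_comm (act ρ s Y.τ), ← map_add] at h3
    have h4 : j (lm K _ (act ρ s X.σ) (lm K _ Y.σ (n x))) =
        lm K _ (act ρ s Y.σ) (lm K _ X.σ (j (n x))) := by
      rw [hjl, hjl, act_act_self hss, lm_lm_comm]
    have h5 : i (lm K _ (act ρ s Y.σ) (lm K _ X.σ (m x))) =
        lm K _ (act ρ s Y.σ) (lm K _ X.σ (i (m x))) := by
      rw [hil, hil]
    have h6 : lm K _ σ x = lm K _ (act ρ s Y.σ) (lm K _ X.σ (i (m x))) +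
        lm K _ (act ρ s Y.σ) (lm K _ X.σ (j (n x))) := by
      rw [← map_add, ← map_add, hsum, ← lm_mul_apply, ← lm_mul_apply]
      congr 2
      change 2 * linForm α * (X.σ * act ρ s Y.σ) = _
      ring
    convert h3 using 2
    rw [map_sub, map_sub, map_sub, map_sub, h4, h5, map_sum, map_sum, map_sum, map_sum, h6]
    abel
  refine ⟨⟨X.ι ⊕ Y.ι, Sum.elim X.obj Z,
    fun k => Sum.rec (motive := fun k => (Sum.elim X.obj Z k).carrier →+ B.carrier) i1 i2 k,
    fun k => Sum.rec (motive := fun k => B.carrier →+ (Sum.elim X.obj Z k).carrier) p1 p2 k,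
    σ, X.τ * act ρ s Y.τ, ?_, ?_, ?_, ?_, ?_, ?_, ?_, ?_, ?_, ?_⟩⟩
  · rintro (k | k)
    · exact X.exists_word k
    · exact hZ k
  · have h1 := Y.evalAt_σ
    change evalAt K _ (2 * linForm α * (X.σ * act ρ s Y.σ)) ≠ 0
    rw [map_mul, map_mul, map_mul, map_ofNat, evalAt_linForm, evalAt_act, hsi]
    rw [map_mul] at h1
    exact mul_ne_zero (mul_ne_zero two_ne_zero hα) (mul_ne_zero X.evalAt_σ h1)
  · have h1 := Y.evalAt_τ
    rw [map_mul, evalAt_act, hsi]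
    rw [map_mul] at h1
    exact mul_ne_zero X.evalAt_τ h1
  · rintro (k | k)
    · exact i1l k
    · exact i2l k
  · rintro (k | k)
    · exact i1r k
    · exact i2r k
  · rintro (k | k)
    · exact p1l k
    · exact p2l k
  · rintro (k | k)
    · exact p1r k
    · exact p2r k
  · rintro (k | k)
    · exact pi1 k
    · exact pi2 k
  · rintro (k | k) (k' | k') hk
    · exact pi11 k k' fun e => hk (by rw [e])
    · exact pi12 k k'
    · exact pi21 k k'
    · exact pi22 k k' fun e => hk (by rw [e])
  · intro x
    rw [Fintype.sum_sum_type]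
    exact hfin x

end LocalSplitting

/-- Let `T` be a set of elements of `W` and let the letters of the word be reflections for which
the two alternatives hold: `s` fixes `t a` and then belongs to `S' t`, or `s` moves `t a` and
then `s t ∈ T`, with `S' (s t) = s (S' t) s⁻¹`. Then the Bott–Samelson bimodule of the word splits
near all points `t a` with `t ∈ T`. -/
theorem nonempty_localSplitting [NeZero (2 : K)] {a : V} {T : Set W} {S' : W → Set W}
    (hT : ∀ t ∈ T, ρ t a = a → t = 1) (l : List W)
    (hrefl : ∀ s ∈ l, ∃ α, IsReflectionAlong ρ s α)
    (hfix : ∀ s ∈ l, ∀ t ∈ T, ρ s (ρ t a) = ρ t a → s ∈ S' t)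
    (hmove : ∀ s ∈ l, ∀ t ∈ T, ρ s (ρ t a) ≠ ρ t a →
      s * t ∈ T ∧ ∀ r ∈ S' (s * t), s * r * s⁻¹ ∈ S' t) :
    ∀ t ∈ T, Nonempty (LocalSplitting ρ (S' t) t a (bottSamelson ρ l)) := by
  induction l with
  | nil =>
    intro t ht
    by_cases h : ρ t a = a
    · obtain rfl := hT t ht h
      exact ⟨LocalSplitting.one⟩
    · exact ⟨LocalSplitting.empty h⟩
  | cons s l ih =>
    have ih := ih (fun s hs => hrefl s (by simp [hs])) (fun s hs => hfix s (by simp [hs]))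
      (fun s hs => hmove s (by simp [hs]))
    obtain ⟨α, hα⟩ := hrefl s (by simp)
    intro t ht
    rw [bottSamelson_cons]
    obtain ⟨X⟩ := ih t ht
    by_cases h : ρ s (ρ t a) = ρ t a
    · exact X.nonempty_cons_of_fixed hα.mul_self h (hfix s (by simp) t ht h)
    · obtain ⟨h1, h2⟩ := hmove s (by simp) t ht h
      obtain ⟨Y⟩ := ih _ h1
      exact X.nonempty_cons_of_moved Y hα h h2

end LocalSplitting

/-! ### Idempotents of graded finite-dimensional algebras -/

section GradedIdempotents

/-- Two idempotents `e` and `f` are equivalent: the right ideals `e A` and `f A` are isomorphic. -/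
def IdemEquiv {A : Type*} [Ring A] (e f : A) : Prop :=
  ∃ P Q, Q * P = e ∧ P * Q = f ∧ f * P = P ∧ P * e = P ∧ e * Q = Q ∧ Q * f = Q

namespace IdemEquiv

variable {A : Type*} [Ring A] {e f g e' f' : A}

theorem refl (h : e * e = e) : IdemEquiv e e := ⟨e, e, h, h, h, h, h, h⟩

theorem trans (h : IdemEquiv e f) (h' : IdemEquiv f g) : IdemEquiv e g := by
  obtain ⟨P, Q, h1, h2, h3, h4, h5, h6⟩ := h
  obtain ⟨P', Q', h1', h2', h3', h4', h5', h6'⟩ := h'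
  refine ⟨P' * P, Q * Q', ?_, ?_, ?_, ?_, ?_, ?_⟩
  · rw [mul_assoc, ← mul_assoc Q', h1', h3, h1]
  · rw [mul_assoc, ← mul_assoc P, h2, h5', h2']
  · rw [← mul_assoc, h3']
  · rw [mul_assoc, h4]
  · rw [← mul_assoc, h5]
  · rw [mul_assoc, h6']

/-- Orthogonal sums of equivalent idempotents are equivalent. -/
theorem add (h : IdemEquiv e f) (h' : IdemEquiv e' f') (he : e * e' = 0) (he' : e' * e = 0)
    (hf : f * f' = 0) (hf' : f' * f = 0) : IdemEquiv (e + e') (f + f') := by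
  obtain ⟨P, Q, h1, h2, h3, h4, h5, h6⟩ := h
  obtain ⟨P', Q', h1', h2', h3', h4', h5', h6'⟩ := h'
  have a1 : Q * P' = 0 := by rw [← h6, ← h3', mul_assoc, ← mul_assoc f, hf, zero_mul, mul_zero]
  have a2 : Q' * P = 0 := by rw [← h6', ← h3, mul_assoc, ← mul_assoc f', hf', zero_mul, mul_zero]
  have a3 : P * Q' = 0 := by rw [← h4, ← h5', mul_assoc, ← mul_assoc e, he, zero_mul, mul_zero]
  have a4 : P' * Q = 0 := by rw [← h4', ← h5, mul_assoc, ← mul_assoc e', he', zero_mul, mul_zero]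
  have a5 : f * P' = 0 := by rw [← h3', ← mul_assoc, hf, zero_mul]
  have a6 : f' * P = 0 := by rw [← h3, ← mul_assoc, hf', zero_mul]
  have a7 : P * e' = 0 := by rw [← h4, mul_assoc, he, mul_zero]
  have a8 : P' * e = 0 := by rw [← h4', mul_assoc, he', mul_zero]
  have a9 : e * Q' = 0 := by rw [← h5', ← mul_assoc, he, zero_mul]
  have a10 : e' * Q = 0 := by rw [← h5, ← mul_assoc, he', zero_mul]
  have a11 : Q * f' = 0 := by rw [← h6, mul_assoc, hf, mul_zero]
  have a12 : Q' * f = 0 := by rw [← h6', mul_assoc, hf', mul_zero]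
  refine ⟨P + P', Q + Q', ?_, ?_, ?_, ?_, ?_, ?_⟩ <;>
    simp only [add_mul, mul_add, *, add_zero, zero_add]

end IdemEquiv

variable {K : Type*} [Field K] {A : Type*} [Ring A] [Algebra K A]

variable (K) in
/-- Fitting's lemma: the idempotent projecting onto the part where `x` is invertible is a
polynomial in `x`. -/
theorem exists_fitting_idempotent [FiniteDimensional K A] (x : A) :
    ∃ n, ∃ y ∈ Algebra.adjoin K {x},
    (x ^ (n + 1) * y) * (x ^ (n + 1) * y) = x ^ (n + 1) * y ∧
      x ^ (n + 1) * (x ^ (n + 1) * y) = x ^ (n + 1) := by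
  let N : ℕ →o (Submodule K A)ᵒᵈ :=
    ⟨fun n => OrderDual.toDual ((Subalgebra.toSubmodule (Algebra.adjoin K {x})).map
      (LinearMap.mulLeft K (x ^ n))), fun m n hmn => by
      change Submodule.map _ _ ≤ Submodule.map _ _
      rintro _ ⟨y, hy, rfl⟩
      obtain ⟨k, rfl⟩ := Nat.exists_eq_add_of_le hmn
      refine ⟨x ^ k * y, Subalgebra.mul_mem _
        (Subalgebra.pow_mem _ (Algebra.self_mem_adjoin_singleton K x) k) hy, ?_⟩
      simp [pow_add]⟩
  obtain ⟨n, hn⟩ := IsArtinian.monotone_stabilizes N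
  have h1 : x ^ (n + 1) ∈ OrderDual.ofDual (N (n + 1)) :=
    ⟨1, one_mem (Algebra.adjoin K {x}), mul_one _⟩
  have h2 : N (n + 1) = N (n + 1 + (n + 1)) :=
    (hn _ (by omega)).symm.trans (hn _ (by omega))
  rw [h2] at h1
  obtain ⟨y, hy, hxy⟩ := h1
  have hc : Commute (x ^ (n + 1)) y := (Algebra.commute_of_mem_adjoin_self hy).pow_left _
  have hxy' : x ^ (n + 1) * (x ^ (n + 1) * y) = x ^ (n + 1) := by
    rw [← mul_assoc, ← pow_add]; exact hxy
  refine ⟨n, y, hy, ?_, hxy'⟩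
  calc (x ^ (n + 1) * y) * (x ^ (n + 1) * y) = x ^ (n + 1) * (x ^ (n + 1) * y) * y := by
        rw [mul_assoc, ← mul_assoc y, hc.symm.eq]; simp only [mul_assoc]
    _ = _ := by rw [hxy']

/-- The trace of the left regular representation. -/
def regTrace (K : Type*) [Field K] {A : Type*} [Ring A] [Algebra K A] : A →ₗ[K] K :=
  LinearMap.trace K A ∘ₗ (LinearMap.mul K A)

theorem regTrace_mul_comm (x y : A) : regTrace K (x * y) = regTrace K (y * x) := by
  change LinearMap.trace K A (LinearMap.mulLeft K (x * y)) =
    LinearMap.trace K A (LinearMap.mulLeft K (y * x))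
  rw [LinearMap.mulLeft_mul, LinearMap.mulLeft_mul]
  exact LinearMap.trace_mul_comm K _ _

theorem regTrace_of_isNilpotent {x : A} (hx : IsNilpotent x) : regTrace K x = 0 := by
  refine (LinearMap.isNilpotent_trace_of_isNilpotent (R := K) (M := A)
    (f := LinearMap.mulLeft K x) ?_).eq_zero
  obtain ⟨n, hn⟩ := hx
  exact ⟨n, by rw [LinearMap.pow_mulLeft, hn, LinearMap.mulLeft_zero_eq_zero]⟩

/-- In characteristic zero, the regular trace of an idempotent `e` is the dimension of `e A`. -/
theorem eq_zero_of_regTrace [FiniteDimensional K A] [CharZero K] {e : A} (he : e * e = e)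
    (h : regTrace K e = 0) : e = 0 := by
  have h1 : IsIdempotentElem (LinearMap.mulLeft K e) := by
    rw [IsIdempotentElem, Module.End.mul_eq_comp, ← LinearMap.mulLeft_mul, he]
  have h2 := (LinearMap.IsIdempotentElem.trace_eq_zero_iff h1).1 h
  simpa using LinearMap.congr_fun h2 1

/-- The elements of the radical of the trace form are nilpotent, since their Fitting idempotents
have trace zero. -/
theorem isNilpotent_of_regTrace [FiniteDimensional K A] [CharZero K] {x : A}
    (hx : ∀ y, regTrace K (x * y) = 0) : IsNilpotent x := by
  obtain ⟨n, y, hy, he, hxe⟩ := exists_fitting_idempotent K x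
  refine ⟨n + 1, ?_⟩
  rw [← hxe, eq_zero_of_regTrace (K := K) he (by rw [pow_succ', mul_assoc]; exact hx _), mul_zero]

theorem range_mulLeft_sub_lt {g h : A} (hg : g * g = g) (hgh : g * h = h) (hhg : h * g = h)
    (hhh : h * h = h) (hh : h ≠ 0) :
    LinearMap.range (LinearMap.mulLeft K (g - h)) < LinearMap.range (LinearMap.mulLeft K g) := by
  refine lt_of_le_of_ne ?_ fun e => ?_
  · rintro _ ⟨y, rfl⟩
    exact ⟨(g - h) * y, by simp [← mul_assoc, mul_sub, hg, hgh]⟩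
  · have h1 : g ∈ LinearMap.range (LinearMap.mulLeft K g) := ⟨1, by simp⟩
    rw [← e] at h1
    obtain ⟨y, hy⟩ := h1
    have hy : (g - h) * y = g := hy
    exact hh (by rw [← hhg, ← hy, ← mul_assoc, mul_sub, hhg, hhh, sub_self, zero_mul])

variable {𝒜 : ℤ → Submodule K A}

variable (𝒜) in
/-- `h` is a primitive idempotent of the subalgebra of elements of degree zero. -/
structure IsPrimitiveHomogeneous (h : A) : Prop where
  mem : h ∈ 𝒜 0
  mul_self : h * h = h
  ne_zero : h ≠ 0
  eq_of_le : ∀ e ∈ 𝒜 0, e * e = e → h * e = e → e * h = e → e = 0 ∨ e = h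

/-- Below every nonzero homogeneous idempotent `g` there is a primitive one, by induction on the
dimension of `g A`. -/
theorem exists_isPrimitiveHomogeneous [FiniteDimensional K A] {g : A} (hg : g ∈ 𝒜 0)
    (hgg : g * g = g) (hg0 : g ≠ 0) :
    ∃ h, IsPrimitiveHomogeneous 𝒜 h ∧ g * h = h ∧ h * g = h := by
  induction hn : Module.finrank K (LinearMap.range (LinearMap.mulLeft K g)) using
    Nat.strong_induction_on generalizing g with
  | _ n ih =>
    by_cases hp : IsPrimitiveHomogeneous 𝒜 g
    · exact ⟨g, hp, hgg, hgg⟩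
    · obtain ⟨e, he, hee, hge, heg, he0, hne⟩ : ∃ e ∈ 𝒜 0, e * e = e ∧ g * e = e ∧ e * g = e ∧
          e ≠ 0 ∧ e ≠ g := by
        by_contra! hc
        exact hp ⟨hg, hgg, hg0, fun e he h1 h2 h3 =>
          or_iff_not_imp_left.2 fun h4 => hc e he h1 h2 h3 h4⟩
      have hlt := range_mulLeft_sub_lt (K := K) (g := g) (h := g - e) hgg
        (by rw [mul_sub, hgg, hge]) (by rw [sub_mul, hgg, heg])
        (by rw [mul_sub, sub_mul, sub_mul, hgg, hge, heg, hee]; abel) (sub_ne_zero.2 hne.symm)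
      rw [sub_sub_cancel] at hlt
      obtain ⟨h, hh, h1, h2⟩ := ih _ (hn ▸ Submodule.finrank_lt_finrank_of_lt hlt) he hee he0 rfl
      refine ⟨h, hh, ?_, ?_⟩
      · rw [← h1, ← mul_assoc, hge]
      · rw [← h2, mul_assoc, heg]

variable [SetLike.GradedMonoid 𝒜]

theorem mul_mem_zero {x y : A} (hx : x ∈ 𝒜 0) (hy : y ∈ 𝒜 0) : x * y ∈ 𝒜 0 := by
  have := SetLike.GradedMonoid.toGradedMul.mul_mem hx hy
  rwa [add_zero] at this

theorem adjoin_le_zero {x y : A} (hx : x ∈ 𝒜 0) (hy : y ∈ Algebra.adjoin K {x}) : y ∈ 𝒜 0 := by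
  induction hy using Algebra.adjoin_induction with
  | mem y hy => rw [Set.mem_singleton_iff.1 hy]; exact hx
  | algebraMap r =>
    rw [Algebra.algebraMap_eq_smul_one]
    exact Submodule.smul_mem _ _ SetLike.GradedOne.one_mem
  | add y z _ _ hy hz => exact add_mem hy hz
  | mul y z _ _ hy hz => exact mul_mem_zero hy hz

theorem pow_mem_zero {x : A} (hx : x ∈ 𝒜 0) (n : ℕ) : x ^ n ∈ 𝒜 0 :=
  adjoin_le_zero hx (pow_mem (Algebra.self_mem_adjoin_singleton K x) n)

variable [FiniteDimensional K A]

namespace IsPrimitiveHomogeneous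

variable {h : A} (hh : IsPrimitiveHomogeneous 𝒜 h)
include hh

/-- Fitting dichotomy: the degree-zero part of the corner `h A h` is local. -/
theorem isNilpotent_or_invertible {x : A} (hx : x ∈ 𝒜 0) (hl : h * x = x) (hr : x * h = x) :
    IsNilpotent x ∨ ∃ z, h * z = z ∧ z * h = z ∧ x * z = h ∧ z * x = h := by
  obtain ⟨n, y, hy, he, hxe⟩ := exists_fitting_idempotent K x
  have hxy : Commute (x ^ (n + 1)) y := (Algebra.commute_of_mem_adjoin_self hy).pow_left _
  have h1 : x ^ (n + 1) * y ∈ 𝒜 0 := mul_mem_zero (pow_mem_zero hx _) (adjoin_le_zero hx hy)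
  rcases hh.eq_of_le _ h1 he (by rw [pow_succ', ← mul_assoc, ← mul_assoc, hl])
    (by rw [hxy.eq, mul_assoc, pow_succ, mul_assoc, hr]) with h0 | h0
  · left
    exact ⟨n + 1, by rw [← hxe, h0, mul_zero]⟩
  · right
    refine ⟨h * (x ^ n * y) * h, ?_, ?_, ?_, ?_⟩
    · simp only [← mul_assoc, hh.mul_self]
    · simp only [mul_assoc, hh.mul_self]
    · rw [← mul_assoc, ← mul_assoc, hr, ← mul_assoc, ← pow_succ', h0, hh.mul_self]
    · have h2 : Commute (x ^ n * y) x :=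
        ((Commute.refl x).pow_left n).mul_left (Algebra.commute_of_mem_adjoin_self hy).symm
      rw [mul_assoc, hl, mul_assoc, h2.eq, ← mul_assoc x, ← pow_succ', h0, hh.mul_self]

variable (htop : ⨆ n, 𝒜 n = ⊤) (hnil : ∀ n ≠ 0, ∀ x ∈ 𝒜 n, IsNilpotent x)
include htop hnil

/-- Nilpotent homogeneous elements of the corner `h A h` lie in the radical of the trace form. -/
theorem regTrace_mul_eq_zero {n : ℤ} {x : A} (hx : x ∈ 𝒜 n) (hl : h * x = x) (hr : x * h = x)
    (hxn : IsNilpotent x) (y : A) : regTrace K (x * y) = 0 := by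
  have hy : y ∈ ⨆ n, 𝒜 n := htop ▸ Submodule.mem_top
  induction hy using Submodule.iSup_induction' with
  | zero => simp
  | add y z _ _ hy hz => rw [mul_add, map_add, hy, hz, add_zero]
  | mem m y hy =>
    have e1 : regTrace K (x * y) = regTrace K (x * (h * y * h)) := by
      rw [← mul_assoc, regTrace_mul_comm _ h, ← mul_assoc, ← mul_assoc, hl, hr]
    have hz : h * y * h ∈ 𝒜 m := by
      have h1 := SetLike.GradedMonoid.toGradedMul.mul_mem
        (SetLike.GradedMonoid.toGradedMul.mul_mem hh.mem hy) hh.mem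
      rwa [zero_add, add_zero] at h1
    rw [e1]
    generalize hz' : h * y * h = z at hz
    have hzl : h * z = z := by rw [← hz']; simp only [← mul_assoc, hh.mul_self]
    have hzr : z * h = z := by rw [← hz']; simp only [mul_assoc, hh.mul_self]
    have hxz := SetLike.GradedMonoid.toGradedMul.mul_mem hx hz
    by_cases hnm : n + m = 0
    · rw [hnm] at hxz
      rcases hh.isNilpotent_or_invertible hxz (by rw [← mul_assoc, hl])
        (by rw [mul_assoc, hzr]) with h0 | ⟨w, hw1, hw2, hw3, hw4⟩
      · exact regTrace_of_isNilpotent h0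
      · -- a nilpotent `x` cannot have the right inverse `z w` in the corner
        exfalso
        obtain ⟨k, hk⟩ := hxn
        have key : ∀ j, x ^ j * h = 0 → h = 0 := by
          intro j
          induction j with
          | zero => intro e; simpa using e
          | succ j ih =>
            intro e
            apply ih
            calc x ^ j * h = x ^ j * x * (z * w) := by
                  rw [← hw3]; simp only [mul_assoc]
              _ = x ^ (j + 1) * h * (z * w) := by
                  rw [pow_succ, mul_assoc _ h, ← mul_assoc h, hzl]
              _ = 0 := by rw [e, zero_mul]
        exact hh.ne_zero (key k (by rw [hk, zero_mul]))
    · exact regTrace_of_isNilpotent (hnil _ hnm _ hxz)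

/-- The corner of a primitive homogeneous idempotent is a local ring. -/
theorem invertible_or_sub_invertible [CharZero K] {x : A} (hl : h * x = x) (hr : x * h = x) :
    (∃ z, h * z = z ∧ z * h = z ∧ x * z = h ∧ z * x = h) ∨
      ∃ z, h * z = z ∧ z * h = z ∧ (h - x) * z = h ∧ z * (h - x) = h := by
  -- up to the radical of the trace form, an element of the corner is its component of degree zero
  have hdec : ∀ y : A, ∃ y0 ∈ 𝒜 0, ∀ w, regTrace K (h * (y - y0) * h * w) = 0 := by
    intro y
    have hy : y ∈ ⨆ n, 𝒜 n := htop ▸ Submodule.mem_top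
    induction hy using Submodule.iSup_induction' with
    | zero => exact ⟨0, zero_mem _, by simp⟩
    | add y z _ _ hy hz =>
      obtain ⟨y0, hy0, hy⟩ := hy
      obtain ⟨z0, hz0, hz⟩ := hz
      refine ⟨y0 + z0, add_mem hy0 hz0, fun w => ?_⟩
      rw [add_sub_add_comm, mul_add, add_mul, add_mul, map_add, hy, hz, add_zero]
    | mem m y hy =>
      by_cases hm : m = 0
      · subst hm
        exact ⟨y, hy, by simp⟩
      · refine ⟨0, zero_mem _, fun w => ?_⟩
        have h1 := SetLike.GradedMonoid.toGradedMul.mul_mem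
          (SetLike.GradedMonoid.toGradedMul.mul_mem hh.mem hy) hh.mem
        rw [zero_add, add_zero] at h1
        rw [sub_zero]
        exact hh.regTrace_mul_eq_zero htop hnil h1 (by simp only [← mul_assoc, hh.mul_self])
          (by simp only [mul_assoc, hh.mul_self]) (hnil m hm _ h1) w
  obtain ⟨y0, hy0, hrad⟩ := hdec x
  have hx0 : h * y0 * h ∈ 𝒜 0 := mul_mem_zero (mul_mem_zero hh.mem hy0) hh.mem
  have hi : h * (x - y0) * h = x - h * y0 * h := by rw [mul_sub, sub_mul, hl, hr]
  rw [hi] at hrad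
  have hl0 : h * (h * y0 * h) = h * y0 * h := by simp only [← mul_assoc, hh.mul_self]
  have hr0 : h * y0 * h * h = h * y0 * h := by simp only [mul_assoc, hh.mul_self]
  generalize h * y0 * h = x0 at *
  have hhx : ∀ a b : A, h * a = a → h * (a * b) = a * b := fun a b e => by rw [← mul_assoc, e]
  rcases hh.isNilpotent_or_invertible hx0 hl0 hr0 with h0 | ⟨z, hz1, hz2, hz3, hz4⟩
  · right
    have hx : ∀ y, regTrace K (x * y) = 0 := fun y => by
      have := hh.regTrace_mul_eq_zero htop hnil hx0 hl0 hr0 h0 y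
      rw [← sub_add_cancel x x0, add_mul, map_add, hrad, this, add_zero]
    obtain ⟨u, hu⟩ := (isNilpotent_of_regTrace hx).isUnit_one_sub
    have h1 : (h - x) = h * u := by rw [hu, mul_sub, hl, mul_one]
    have h2 : (h - x) = u * h := by rw [hu, sub_mul, hr, one_mul]
    refine ⟨h * ↑u⁻¹ * h, ?_, ?_, ?_, ?_⟩
    · simp only [← mul_assoc, hh.mul_self]
    · simp only [mul_assoc, hh.mul_self]
    · rw [← mul_assoc, ← mul_assoc, h2, mul_assoc (u : A), hh.mul_self, ← h2, h1, mul_assoc h,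
        Units.mul_inv, mul_one, hh.mul_self]
    · rw [mul_assoc, h1, ← mul_assoc h h, hh.mul_self, ← h1, h2, mul_assoc, ← mul_assoc _ (u : A),
        Units.inv_mul, one_mul, hh.mul_self]
  · left
    have hzi : ∀ y, regTrace K (z * (x - x0) * y) = 0 := fun y => by
      rw [mul_assoc, regTrace_mul_comm, mul_assoc]; exact hrad _
    obtain ⟨u, hu⟩ := (isNilpotent_of_regTrace hzi).isUnit_one_add
    have hu' : (u : A) = 1 + (z * x - h) := by rw [hu, mul_sub, hz4]
    have hzx : z * x = h * u := by
      rw [hu', mul_add, mul_sub, mul_one, hh.mul_self, ← mul_assoc, hz1]; abel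
    have hzx' : z * x = u * h := by
      rw [hu', add_mul, sub_mul, one_mul, hh.mul_self, mul_assoc, hr]; abel
    have hx : x = x0 * (z * x) := by rw [← mul_assoc, hz3, hl]
    refine ⟨h * ↑u⁻¹ * z, ?_, ?_, ?_, ?_⟩
    · simp only [← mul_assoc, hh.mul_self]
    · simp only [mul_assoc, hz2]
    · have h3 : z * x * (h * ↑u⁻¹ * z) = z := by
        rw [← mul_assoc, ← mul_assoc, mul_assoc z x h, hr, hzx, mul_assoc h, Units.mul_inv,
          mul_one, hz1]
      rw [hx, mul_assoc, h3, hz3]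
    · rw [mul_assoc, hzx', mul_assoc, ← mul_assoc _ (u : A), Units.inv_mul, one_mul, hh.mul_self]

end IsPrimitiveHomogeneous

/-- In a finite-dimensional graded algebra whose homogeneous elements of nonzero degree are
nilpotent, every idempotent is equivalent to a homogeneous one. This is the exchange argument
behind the Krull–Schmidt theorem: a primitive homogeneous idempotent `h` has a local corner, so
that either `h e h` or `h - h e h` is invertible there; in the first case `h` can be split off from
`e`, in the second case `e` is equivalent to an idempotent orthogonal to `h`. -/
theorem exists_homogeneous_idemEquiv [CharZero K] (htop : ⨆ n, 𝒜 n = ⊤)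
    (hnil : ∀ n ≠ 0, ∀ x ∈ 𝒜 n, IsNilpotent x) {g : A} (hg : g ∈ 𝒜 0) (hgg : g * g = g)
    {e : A} (he : e * e = e) (hge : g * e = e) (heg : e * g = e) :
    ∃ f ∈ 𝒜 0, f * f = f ∧ g * f = f ∧ f * g = f ∧ IdemEquiv e f := by
  induction hn : Module.finrank K (LinearMap.range (LinearMap.mulLeft K g)) using
    Nat.strong_induction_on generalizing g e with
  | _ n ih =>
    by_cases hg0 : g = 0
    · subst hg0
      rw [zero_mul] at hge
      subst hge
      exact ⟨0, zero_mem _, by simp, by simp, by simp, IdemEquiv.refl (by simp)⟩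
    obtain ⟨h, hh, hgh, hhg⟩ := exists_isPrimitiveHomogeneous hg hgg hg0
    have hhh := hh.mul_self
    have hg' : g - h ∈ 𝒜 0 := sub_mem hg hh.mem
    have hgg' : (g - h) * (g - h) = g - h := by
      rw [mul_sub, sub_mul, sub_mul, hgg, hhg, hgh, hhh]; abel
    have ih' := fun e he hge heg => ih _ (hn ▸ Submodule.finrank_lt_finrank_of_lt
      (range_mulLeft_sub_lt (K := K) hgg hgh hhg hhh hh.ne_zero)) hg' hgg' (e := e) he hge heg rfl
    have hgf : ∀ f, (g - h) * f = f → g * f = f := fun f hf => by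
      rw [← hf, ← mul_assoc, mul_sub, hgg, hgh]
    have hfg : ∀ f, f * (g - h) = f → f * g = f := fun f hf => by
      rw [← hf, mul_assoc, sub_mul, hgg, hhg]
    have hhf : ∀ f, (g - h) * f = f → h * f = 0 := fun f hf => by
      rw [← hf, ← mul_assoc, mul_sub, hhg, hhh, sub_self, zero_mul]
    have hfh : ∀ f, f * (g - h) = f → f * h = 0 := fun f hf => by
      rw [← hf, mul_assoc, sub_mul, hgh, hhh, sub_self, mul_zero]
    rcases hh.invertible_or_sub_invertible htop hnil (x := h * e * h)
      (by simp only [← mul_assoc, hhh]) (by simp only [mul_assoc, hhh]) with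
      ⟨z, hz1, hz2, hz3, hz4⟩ | ⟨z, hz1, hz2, hz3, hz4⟩
    · -- the idempotent `e z e` is equivalent to `h`, and `e - e z e` is orthogonal to `h`
      have a1 : h * e * z = h := by rwa [mul_assoc (h * e), hz1] at hz3
      have a2 : z * e * h = h := by rwa [← mul_assoc, ← mul_assoc, hz2] at hz4
      have b1 : z * e * z = z := by
        calc z * e * z = z * (h * e * z) := by simp only [← mul_assoc, hz2]
          _ = z := by rw [a1, hz2]
      set e1 := e * z * e with he1
      have c1 : e * e1 = e1 := by rw [he1]; simp only [← mul_assoc, he]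
      have c2 : e1 * e = e1 := by rw [he1]; simp only [mul_assoc, he]
      have c3 : e1 * e1 = e1 := by
        calc e1 * e1 = e * (z * (e * e) * z) * e := by rw [he1]; simp only [mul_assoc]
          _ = e1 := by rw [he, b1]
      have heq : IdemEquiv e1 h := by
        refine ⟨h * e, e * z, ?_, ?_, ?_, ?_, ?_, ?_⟩
        · rw [mul_assoc, ← mul_assoc z, hz2, ← mul_assoc]
        · rw [mul_assoc, ← mul_assoc e, he, ← mul_assoc, a1]
        · rw [← mul_assoc, hhh]
        · rw [mul_assoc, c1, he1, ← mul_assoc, ← mul_assoc, a1]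
        · rw [← mul_assoc, c2, he1, mul_assoc e, mul_assoc e, b1]
        · rw [mul_assoc, hz2]
      have d1 : h * (e - e1) = 0 := by
        rw [mul_sub, he1, ← mul_assoc, ← mul_assoc, a1, sub_self]
      have d2 : (e - e1) * h = 0 := by
        rw [sub_mul, he1, mul_assoc, mul_assoc, ← mul_assoc z, a2, sub_self]
      have d3 : g * (e - e1) = e - e1 := by
        rw [mul_sub, hge, ← c1, ← mul_assoc, hge]
      have d4 : (e - e1) * g = e - e1 := by
        rw [sub_mul, heg, ← c2, mul_assoc, heg]
      obtain ⟨f, hf, hff, hgf', hfg', hef⟩ := ih' (e - e1)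
        (by rw [mul_sub, sub_mul, sub_mul, he, c1, c2, c3]; abel)
        (by rw [sub_mul, d3, d1, sub_zero]) (by rw [mul_sub, d4, d2, sub_zero])
      refine ⟨h + f, add_mem hh.mem hf, ?_, ?_, ?_, ?_⟩
      · rw [mul_add, add_mul, add_mul, hhh, hff, hhf f hgf', hfh f hfg']; abel
      · rw [mul_add, hgh, hgf f hgf']
      · rw [add_mul, hhg, hfg f hfg']
      · have := heq.add hef (by rw [mul_sub, c2, c3, sub_self]) (by rw [sub_mul, c1, c3, sub_self])
          (hhf f hgf') (hfh f hfg')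
        rwa [add_sub_cancel] at this
    · -- `e (g - h) e` is invertible in the corner of `e`, with inverse `e + e z e`
      have key : (e + e * z * e) * ((g - h) * e) = e := by
        have a2 : z * e * h = z - h := by
          rw [mul_sub, hz2, ← mul_assoc, ← mul_assoc, hz2] at hz4
          rw [eq_sub_iff_add_eq, add_comm]
          exact (sub_eq_iff_eq_add.1 hz4).symm
        calc (e + e * z * e) * ((g - h) * e) = e * g * e - e * h * e + e * z * (e * g) * e
              - e * (z * e * h) * e := by noncomm_ring
          _ = e := by rw [heg, he, a2, mul_assoc _ e e, he]; noncomm_ring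
      have h1 : e * ((e + e * z * e) * (g - h)) = (e + e * z * e) * (g - h) := by
        rw [← mul_assoc, mul_add, he, ← mul_assoc, ← mul_assoc, he]
      have h2 : (g - h) * e * e = (g - h) * e := by rw [mul_assoc, he]
      have h3 : (e + e * z * e) * (g - h) * ((g - h) * e) = e := by
        rw [mul_assoc, ← mul_assoc (g - h), hgg', key]
      have h4 : (g - h) * ((g - h) * e) = (g - h) * e := by rw [← mul_assoc, hgg']
      have h5 : (e + e * z * e) * (g - h) * (g - h) = (e + e * z * e) * (g - h) := by
        rw [mul_assoc, hgg']
      generalize (e + e * z * e) * (g - h) = Q at *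
      generalize (g - h) * e = P at *
      obtain ⟨f, hf, hff, hgf', hfg', hef⟩ := ih' (P * Q)
        (by rw [mul_assoc, ← mul_assoc Q, h3, h1]) (by rw [← mul_assoc, h4])
        (by rw [mul_assoc, h5])
      refine ⟨f, hf, hff, hgf f hgf', hfg f hfg',
        IdemEquiv.trans ⟨P, Q, h3, rfl, ?_, h2, h1, ?_⟩ hef⟩
      · rw [mul_assoc, h3, h2]
      · rw [← mul_assoc, h3, h1]

end GradedIdempotents

/-! ### Lifting idempotents -/

section LiftIdempotents

variable {K : Type*} [Field K] [CharZero K]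

theorem two_zpow_injective : Function.Injective fun n : ℤ => (2 : K) ^ n := by
  intro m n h
  have h2 : ((2 : ℚ) ^ m : ℚ) = 2 ^ n := by
    have : (((2 : ℚ) ^ m : ℚ) : K) = ((2 ^ n : ℚ) : K) := by push_cast; exact h
    exact_mod_cast this
  exact zpow_right_injective₀ (by norm_num) (by norm_num) h2

/-- Let `Φ` be a homomorphism from an algebra `E`, graded by the eigenvalues `2 ^ n` of an
endomorphism `ad`, to a finite-dimensional algebra. If the kernel of `Φ` is nil in degree zero,
then every element which is idempotent modulo the kernel is equivalent, modulo the kernel, to a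
genuine idempotent of degree zero. -/
theorem exists_graded_idempotent {E B : Type*} [Ring E] [Algebra K E] [Ring B] [Algebra K B]
    [FiniteDimensional K B] (Φ : E →ₐ[K] B) (ad : E →ₐ[K] E) (adB : B →ₗ[K] B)
    (hΦ : ∀ x, Φ (ad x) = adB (Φ x))
    (htop : ⨆ n : ℤ, Module.End.eigenspace ad.toLinearMap ((2 : K) ^ n) = ⊤)
    (hnil : ∀ x, ad x = x → Φ x = 0 → IsNilpotent x) (x : E) (hx : Φ (x * x) = Φ x) :
    ∃ F P Q : E, F * F = F ∧ ad F = F ∧ Φ (Q * P) = Φ x ∧ Φ (P * Q) = Φ F := by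
  let 𝒜 : ℤ → Submodule K Φ.range := fun n =>
    (Module.End.eigenspace ad.toLinearMap ((2 : K) ^ n)).map Φ.rangeRestrict.toLinearMap
  have hsurj : Function.Surjective Φ.rangeRestrict := Φ.rangeRestrict_surjective
  have hmem : ∀ n y, y ∈ 𝒜 n ↔ ∃ z, ad z = (2 : K) ^ n • z ∧ Φ.rangeRestrict z = y := by
    intro n y
    simp only [𝒜, Submodule.mem_map, Module.End.mem_eigenspace_iff]
    rfl
  have : SetLike.GradedMonoid 𝒜 :=
    { one_mem := (hmem _ _).2 ⟨1, by simp, map_one _⟩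
      mul_mem := by
        intro m n a b ha hb
        obtain ⟨a, ha', rfl⟩ := (hmem _ _).1 ha
        obtain ⟨b, hb', rfl⟩ := (hmem _ _).1 hb
        refine (hmem _ _).2 ⟨a * b, ?_, map_mul _ _ _⟩
        rw [map_mul, ha', hb', smul_mul_smul_comm, zpow_add₀ two_ne_zero] }
  have htopA : ⨆ n, 𝒜 n = ⊤ := by
    rw [← Submodule.map_iSup, htop, Submodule.map_top]
    exact LinearMap.range_eq_top.2 hsurj
  have hnilA : ∀ n ≠ 0, ∀ y ∈ 𝒜 n, IsNilpotent y := by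
    intro n hn y hy
    obtain ⟨z, hz, rfl⟩ := (hmem _ _).1 hy
    -- otherwise the powers of `y` give eigenvectors of `adB` for infinitely many values `2 ^ (n k)`
    by_contra hc
    have hne : ∀ k : ℕ, Φ z ^ k ≠ 0 := fun k hk => hc ⟨k, Subtype.ext (by simpa using hk)⟩
    have hev : ∀ k : ℕ, Module.End.HasEigenvalue adB ((2 : K) ^ (n * k)) := fun k => by
      refine Module.End.hasEigenvalue_of_hasEigenvector (x := Φ z ^ k)
        ⟨Module.End.mem_eigenspace_iff.2 ?_, hne k⟩
      rw [← map_pow, ← hΦ, map_pow, hz, smul_pow, map_smul, zpow_mul, zpow_natCast]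
    refine Set.infinite_of_injective_forall_mem (f := fun k : ℕ => (2 : K) ^ (n * k)) ?_ hev
      (Module.End.finite_hasEigenvalue (f := adB))
    intro k l hkl
    exact_mod_cast mul_left_cancel₀ hn (two_zpow_injective hkl)
  have he : Φ.rangeRestrict x * Φ.rangeRestrict x = Φ.rangeRestrict x := by
    rw [← map_mul]; exact Subtype.ext hx
  obtain ⟨f, hf, hff, -, -, P, Q, h1, h2, -⟩ := exists_homogeneous_idemEquiv (𝒜 := 𝒜) htopA hnilA
    (g := 1) SetLike.GradedOne.one_mem (one_mul 1) he (one_mul _) (mul_one _)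
  obtain ⟨f, hf0, rfl⟩ := (hmem _ _).1 hf
  obtain ⟨P, rfl⟩ := hsurj P
  obtain ⟨Q, rfl⟩ := hsurj Q
  rw [zpow_zero, one_smul] at hf0
  let E₀ := AlgHom.equalizer ad (AlgHom.id K E)
  obtain ⟨F, hF1, hF2⟩ := exists_isIdempotentElem_eq_of_ker_isNilpotent
    (Φ.toRingHom.comp E₀.val.toRingHom)
    (fun y hy => by
      obtain ⟨n, hn⟩ := hnil y y.2 hy
      exact ⟨n, Subtype.ext (by simpa using hn)⟩) (Φ f) ⟨⟨f, hf0⟩, rfl⟩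
    (by rw [IsIdempotentElem, ← map_mul]
        have := congrArg Subtype.val hff
        simpa using this)
  refine ⟨F, P, Q, congrArg Subtype.val hF1, F.2, ?_, ?_⟩
  · rw [← map_mul] at h1; exact congrArg Subtype.val h1
  · rw [← map_mul] at h2
    exact (congrArg Subtype.val h2).trans hF2.symm

end LiftIdempotents

/-! ### Gradings by eigenvalues -/

section EigenGrading

/-- The sum of the pieces `p e` with `e ∈ Z`. -/
def pieces {M : Type*} [AddCommGroup M] (p : ℕ → AddSubgroup M) (Z : Set ℕ) : AddSubgroup M :=
  ⨆ e ∈ Z, p e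

variable {M N : Type*} [AddCommGroup M] [AddCommGroup N] {p : ℕ → AddSubgroup M}

theorem mem_pieces {Z : Set ℕ} {e : ℕ} (he : e ∈ Z) {x : M} (hx : x ∈ p e) : x ∈ pieces p Z :=
  (le_biSup (f := p) he) hx

theorem pieces_mono {Z Z' : Set ℕ} (h : Z ⊆ Z') : pieces p Z ≤ pieces p Z' :=
  biSup_mono h

theorem map_mem_of_mem_pieces {Z : Set ℕ} (f : M →+ N) {H : AddSubgroup N}
    (h : ∀ e ∈ Z, ∀ x ∈ p e, f x ∈ H) {x : M} (hx : x ∈ pieces p Z) : f x ∈ H := by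
  have : pieces p Z ≤ H.comap f := iSup₂_le fun e he x hx => h e he x hx
  exact this hx

theorem mem_pieces_univ (hp : ⨆ d, p d = ⊤) (x : M) : x ∈ pieces p Set.univ := by
  rw [pieces, iSup_univ, hp]; trivial

theorem exists_mem_pieces_Iio (hp : ⨆ d, p d = ⊤) (x : M) : ∃ n, x ∈ pieces p (Set.Iio n) := by
  have hx : x ∈ ⨆ d, p d := hp ▸ AddSubgroup.mem_top x
  induction hx using AddSubgroup.iSup_induction' with
  | hp i x hx => exact ⟨i + 1, mem_pieces (by simp) hx⟩
  | h1 => exact ⟨0, zero_mem _⟩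
  | hadd x y _ _ hx hy =>
    obtain ⟨m, hx⟩ := hx
    obtain ⟨n, hy⟩ := hy
    exact ⟨max m n, add_mem (pieces_mono (Set.Iio_subset_Iio (le_max_left _ _)) hx)
      (pieces_mono (Set.Iio_subset_Iio (le_max_right _ _)) hy)⟩

variable {K : Type*} [Field K] [CharZero K] [Module K M] {G : Module.End K M}

/-- An eigenvector for the eigenvalue `2 ^ d` has no components in the pieces of degree `≠ d`. -/
theorem eq_zero_of_mem_pieces (hG : ∀ d, ∀ x ∈ p d, G x = (2 : K) ^ d • x) {d : ℕ} {x : M}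
    (hx : G x = (2 : K) ^ d • x) {Z : Set ℕ} (hZ : d ∉ Z) (hxZ : x ∈ pieces p Z) : x = 0 := by
  have hinj : Function.Injective fun n : ℕ => (2 : K) ^ n := fun m n h => by
    have := two_zpow_injective (K := K) (a₁ := (m : ℤ)) (a₂ := n) (by simpa using h)
    exact_mod_cast this
  have hind := (Module.End.eigenspaces_iSupIndep G).comp hinj
  have h1 : x ∈ ⨆ j, ⨆ (_ : j ≠ d), Module.End.eigenspace G ((2 : K) ^ j) := by
    refine map_mem_of_mem_pieces (p := p) (AddMonoidHom.id M)
      (H := (⨆ j, ⨆ (_ : j ≠ d), Module.End.eigenspace G ((2 : K) ^ j)).toAddSubgroup) ?_ hxZ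
    intro e he y hy
    exact (le_iSup₂ (f := fun j (_ : j ≠ d) => Module.End.eigenspace G ((2 : K) ^ j)) e
      (by rintro rfl; exact hZ he)) (Module.End.mem_eigenspace_iff.2 (hG e y hy))
  exact Submodule.disjoint_def.1 (hind d) x (Module.End.mem_eigenspace_iff.2 hx) h1

/-- The pieces of a grading on which `G` acts by `2 ^ d` are the full eigenspaces of `G`. -/
theorem mem_of_eigen (hG : ∀ d, ∀ x ∈ p d, G x = (2 : K) ^ d • x) (hp : ⨆ d, p d = ⊤) {d : ℕ}
    {x : M} (hx : G x = (2 : K) ^ d • x) : x ∈ p d := by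
  have h1 : x ∈ p d ⊔ pieces p {d}ᶜ := by
    have h2 : pieces p Set.univ ≤ p d ⊔ pieces p {d}ᶜ := iSup₂_le fun e _ => by
      by_cases h : e = d
      · rw [h]; exact le_sup_left
      · exact le_sup_of_le_right (le_biSup (f := p) h)
    exact h2 (mem_pieces_univ hp x)
  obtain ⟨y, hy, z, hz, rfl⟩ := AddSubgroup.mem_sup.1 h1
  have h3 : G z = (2 : K) ^ d • z := by
    rw [map_add, hG d y hy, smul_add] at hx
    exact add_left_cancel hx
  rw [eq_zero_of_mem_pieces hG h3 (by simp) hz, add_zero]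
  exact hy

end EigenGrading

/-! ### The grading of regular functions: dilations and translations -/

section RegGrading

variable (K : Type u) (V : Type v) [Field K] [AddCommGroup V] [Module K V]

/-- The pieces of the grading of `R`, indexed by the polynomial degree. -/
abbrev homDeg (d : ℕ) : AddSubgroup (Reg K V) := regDeg K V (2 * d)

variable {V}

/-- The translation `f ↦ f (· + q)`. -/
def translate (q : V) : Reg K V ≃ₐ[K] Reg K V :=
  AlgEquiv.ofAlgHom (pull (AffineMap.id K V + AffineMap.const K V q))
    (pull (AffineMap.id K V - AffineMap.const K V q))
    (AlgHom.ext (pull_pull_of_comp fun x => by simp))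
    (AlgHom.ext (pull_pull_of_comp fun x => by simp))

@[simp] theorem evalAt_translate (q x : V) (f : Reg K V) :
    evalAt K x (translate K q f) = evalAt K (x + q) f := rfl

variable (V)

/-- The dilation `f ↦ f (2 ·)`. -/
def dilate [NeZero (2 : K)] : Reg K V ≃ₐ[K] Reg K V :=
  AlgEquiv.ofAlgHom (pull ((2 : K) • LinearMap.id : V →ₗ[K] V).toAffineMap)
    (pull ((2 : K)⁻¹ • LinearMap.id : V →ₗ[K] V).toAffineMap)
    (AlgHom.ext (pull_pull_of_comp fun x => by simp [smul_smul, two_ne_zero]))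
    (AlgHom.ext (pull_pull_of_comp fun x => by simp [smul_smul, two_ne_zero]))

variable {V}

@[simp] theorem evalAt_dilate [NeZero (2 : K)] (x : V) (f : Reg K V) :
    evalAt K x (dilate K V f) = evalAt K ((2 : K) • x) f := rfl

variable {K}

theorem mem_homDeg {d : ℕ} {f : Reg K V}
    (h : ∀ (c : K) (x : V), evalAt K (c • x) f = c ^ d * evalAt K x f) : f ∈ homDeg K V d :=
  AddSubgroup.subset_closure ⟨d, rfl, h⟩

theorem evalAt_smul_of_mem_homDeg {d : ℕ} {f : Reg K V} (hf : f ∈ homDeg K V d) (c : K) (x : V) :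
    evalAt K (c • x) f = c ^ d * evalAt K x f := by
  induction hf using AddSubgroup.closure_induction with
  | mem f hf =>
    obtain ⟨d', hd, hf⟩ := hf
    have : d = d' := by omega
    rw [this]
    exact hf c x
  | zero => simp
  | add f g _ _ hf hg => rw [map_add, map_add, hf, hg, mul_add]
  | neg f _ hf => rw [map_neg, map_neg, hf, mul_neg]

theorem regDeg_eq_bot {n : ℤ} (hn : ∀ d : ℕ, n ≠ 2 * d) : regDeg K V n = ⊥ := by
  rw [regDeg, AddSubgroup.closure_eq_bot_iff]
  rintro f ⟨d, hd, -⟩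
  exact (hn d hd).elim

theorem linForm_mem_homDeg (φ : Module.Dual K V) : linForm φ ∈ homDeg K V 1 :=
  mem_homDeg fun c x => by simp

theorem algebraMap_mem_homDeg (c : K) : algebraMap K (Reg K V) c ∈ homDeg K V 0 :=
  mem_homDeg fun e x => by rw [AlgHom.commutes, AlgHom.commutes]; simp

theorem mul_mem_homDeg {m n : ℕ} {f g : Reg K V} (hf : f ∈ homDeg K V m) (hg : g ∈ homDeg K V n) :
    f * g ∈ homDeg K V (m + n) :=
  mem_homDeg fun c x => by
    rw [map_mul, map_mul, evalAt_smul_of_mem_homDeg hf, evalAt_smul_of_mem_homDeg hg]; ring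

theorem mul_mem_pieces_homDeg {Y Z X : Set ℕ} (hX : ∀ y ∈ Y, ∀ z ∈ Z, y + z ∈ X) {f g : Reg K V}
    (hf : f ∈ pieces (homDeg K V) Y) (hg : g ∈ pieces (homDeg K V) Z) :
    f * g ∈ pieces (homDeg K V) X :=
  map_mem_of_mem_pieces (AddMonoidHom.mulRight g)
    (fun y hy f hf => map_mem_of_mem_pieces (AddMonoidHom.mulLeft f)
      (fun z hz _ hg => mem_pieces (hX y hy z hz) (mul_mem_homDeg hf hg)) hg) hf

theorem iSup_eq_top_of_mul_mem {p : ℕ → AddSubgroup (Reg K V)} (h0 : ∀ c, algebraMap K _ c ∈ p 0)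
    (h1 : ∀ φ, linForm φ ∈ p 1) (hmul : ∀ m n f g, f ∈ p m → g ∈ p n → f * g ∈ p (m + n)) :
    ⨆ d, p d = ⊤ := by
  have key : ∀ f, f ∈ pieces p Set.univ := fun f => by
    induction f using Reg.induction with
    | lin φ => exact mem_pieces (Set.mem_univ _) (h1 φ)
    | const c => exact mem_pieces (Set.mem_univ _) (h0 c)
    | add f g hf hg => exact add_mem hf hg
    | mul f g hf hg =>
      exact map_mem_of_mem_pieces (AddMonoidHom.mulRight g)
        (fun y _ f hf => map_mem_of_mem_pieces (AddMonoidHom.mulLeft f)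
          (fun z _ g hg => mem_pieces (Set.mem_univ _) (hmul y z f g hf hg)) hg) hf
  exact eq_top_iff.2 fun f _ => by simpa only [pieces, iSup_univ] using key f

theorem iSup_homDeg : ⨆ d, homDeg K V d = ⊤ :=
  iSup_eq_top_of_mul_mem algebraMap_mem_homDeg linForm_mem_homDeg fun _ _ _ _ => mul_mem_homDeg

theorem mem_pieces_homDeg_univ (f : Reg K V) : f ∈ pieces (homDeg K V) Set.univ :=
  mem_pieces_univ iSup_homDeg f

theorem dilate_of_mem_homDeg [NeZero (2 : K)] {d : ℕ} {f : Reg K V} (hf : f ∈ homDeg K V d) :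
    dilate K V f = (2 : K) ^ d • f :=
  Reg.ext fun x => by
    rw [evalAt_dilate, evalAt_smul_of_mem_homDeg hf, map_smul, smul_eq_mul]

/-- The regular functions vanishing to order `k` at the origin have no components of degree less
than `k`. -/
theorem mem_pieces_of_mem_pow {k : ℕ} {f : Reg K V} (hf : f ∈ pointIdeal K (0 : V) ^ k) :
    f ∈ pieces (homDeg K V) (Set.Ici k) := by
  induction k generalizing f with
  | zero => exact pieces_mono (fun _ _ => Nat.zero_le _) (mem_pieces_homDeg_univ f)
  | succ k ih =>
    rw [pow_succ'] at hf
    induction hf using Submodule.mul_induction_on' with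
    | mem_mul_mem g hg _ hh =>
      refine mul_mem_pieces_homDeg (Y := Set.Ici 1) (Z := Set.Ici k) ?_ ?_ (ih hh)
      · intro y hy z hz
        simp only [Set.mem_Ici] at *
        omega
      · have h1 : ∀ f : Reg K V, f - algebraMap K _ (evalAt K 0 f) ∈
            pieces (homDeg K V) (Set.Ici 1) := by
          intro f
          induction f using Reg.induction with
          | lin φ =>
            rw [evalAt_linForm, map_zero, map_zero, sub_zero]
            exact mem_pieces (by simp) (linForm_mem_homDeg φ)
          | const c => rw [AlgHom.commutes]; simp
          | add f g hf hg =>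
            rw [map_add, map_add, add_sub_add_comm]; exact add_mem hf hg
          | mul f g hf hg =>
            have : f * g - algebraMap K _ (evalAt K 0 (f * g)) =
              (f - algebraMap K _ (evalAt K 0 f)) * g + algebraMap K _ (evalAt K 0 f) *
                (g - algebraMap K _ (evalAt K 0 g)) := by
              rw [map_mul, map_mul]; ring
            rw [this]
            exact add_mem (mul_mem_pieces_homDeg (fun y hy z _ => by
                simp only [Set.mem_Ici] at *; omega) hf (mem_pieces_homDeg_univ g))
              (mul_mem_pieces_homDeg (Y := {0}) (fun y hy z hz => by
                simp only [Set.mem_Ici, Set.mem_singleton_iff] at *; omega)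
                (mem_pieces (Set.mem_singleton _) (algebraMap_mem_homDeg _)) hg)
        have h2 := h1 g
        rwa [mem_pointIdeal.1 hg, map_zero, sub_zero] at h2
    | add f _ g _ hf hg => exact add_mem hf hg

/-- The linear forms are a subspace of `R`. -/
theorem exists_submodule_linForm :
    ∃ L : Submodule K (Reg K V), ∀ f, f ∈ L ↔ ∃ φ, linForm φ = f :=
  ⟨LinearMap.range ({ toFun := linForm, map_add' := fun _ _ => rfl, map_smul' := fun _ _ => rfl } :
      Module.Dual K V →ₗ[K] Reg K V), fun _ => Iff.rfl⟩

/-- Translations respect the leading term of a regular function. -/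
theorem translate_sub_mem [CharZero K] (q : V) {d : ℕ} {f : Reg K V} (hf : f ∈ homDeg K V d) :
    translate K q f - f ∈ pieces (homDeg K V) (Set.Iio d) := by
  -- for products of `n` linear forms this is an induction; they span the functions of degree `n`
  obtain ⟨L, hLmem⟩ := exists_submodule_linForm (K := K) (V := V)
  have hL : ∀ n, ∀ f ∈ L ^ n, f ∈ homDeg K V n ∧
      translate K q f - f ∈ pieces (homDeg K V) (Set.Iio n) := by
    intro n f hf
    induction hf using Submodule.pow_induction_on_left' with
    | algebraMap c =>
      refine ⟨algebraMap_mem_homDeg c, ?_⟩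
      rw [AlgEquiv.commutes, sub_self]; exact zero_mem _
    | add f g i _ _ hf hg =>
      refine ⟨add_mem hf.1 hg.1, ?_⟩
      rw [map_add, add_sub_add_comm]; exact add_mem hf.2 hg.2
    | mem_mul l hl i f _ hf =>
      obtain ⟨φ, rfl⟩ := (hLmem l).1 hl
      refine ⟨by
        rw [Nat.succ_eq_add_one, add_comm]
        exact mul_mem_homDeg (linForm_mem_homDeg φ) hf.1, ?_⟩
      have h1 : translate K q (linForm φ) = linForm φ + algebraMap K _ (φ q) :=
        Reg.ext fun x => by rw [map_add, AlgHom.commutes]; simp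
      have h2 : translate K q (linForm φ * f) - linForm φ * f =
          linForm φ * (translate K q f - f) + algebraMap K _ (φ q) * (translate K q f - f) +
            algebraMap K _ (φ q) * f := by
        rw [map_mul, h1]; ring
      rw [h2]
      refine add_mem (add_mem (mul_mem_pieces_homDeg (Y := {1}) (fun y hy z hz => ?_)
        (mem_pieces (Set.mem_singleton _) (linForm_mem_homDeg φ)) hf.2)
        (mul_mem_pieces_homDeg (Y := {0}) (fun y hy z hz => ?_)
        (mem_pieces (Set.mem_singleton _) (algebraMap_mem_homDeg _)) hf.2))
        (mem_pieces (e := 0 + i) (by simp) (mul_mem_homDeg (algebraMap_mem_homDeg _) hf.1))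
      all_goals simp only [Set.mem_Iio, Set.mem_singleton_iff] at *; omega
  have htop : ⨆ n, (L ^ n).toAddSubgroup = ⊤ := by
    refine iSup_eq_top_of_mul_mem (fun c => ?_) (fun φ => ?_) fun m n f g hf hg => ?_
    · change _ ∈ L ^ 0
      rw [pow_zero]; exact Submodule.algebraMap_mem c
    · change _ ∈ L ^ 1
      rw [pow_one]; exact (hLmem _).2 ⟨φ, rfl⟩
    · change _ ∈ L ^ (m + n)
      rw [pow_add]; exact Submodule.mul_mem_mul hf hg
  refine (hL d f ?_).2
  exact mem_of_eigen (p := fun n => (L ^ n).toAddSubgroup)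
    (G := (dilate K V).toLinearMap) (fun n g hg => dilate_of_mem_homDeg (hL n g hg).1) htop
    (dilate_of_mem_homDeg hf)

theorem dilate_mem_invariants_iff [NeZero (2 : K)] (g : V →ₗ[K] V) (f : Reg K V) :
    f ∈ invariants g ↔ dilate K V f ∈ invariants g := by
  simp only [mem_invariants, evalAt_dilate]
  refine ⟨fun h x => by rw [← map_smul, h], fun h x => ?_⟩
  have := h ((2 : K)⁻¹ • x)
  rwa [← map_smul, smul_smul, mul_inv_cancel₀ two_ne_zero, one_smul] at this

theorem translate_mem_invariants_iff {g : V →ₗ[K] V} {q : V} (hq : g q = q) (f : Reg K V) :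
    f ∈ invariants g ↔ translate K q f ∈ invariants g := by
  simp only [mem_invariants, evalAt_translate]
  refine ⟨fun h x => ?_, fun h x => ?_⟩
  · conv_lhs => rw [← hq, ← map_add, h]
  · have := h (x - q)
    rwa [map_sub, hq, sub_add_cancel, sub_add_cancel] at this

end RegGrading

/-! ### Bimodules with a grading and a compatible translation -/

section GradingDatum

variable {K : Type u} {V : Type v} [Field K] [AddCommGroup V] [Module K V]

variable (K) in
/-- A grading, in non-negative degrees, of a bimodule which is finitely generated from the right,
together with an automorphism `τ` covering the translation by `q` on both sides, which is unipotent
for the grading. The grading is the eigenspace decomposition of the automorphism `G` covering the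
dilation. -/
structure GradingDatum [NeZero (2 : K)] (q : V) (M : Type*) [AddCommGroup M]
    [Module (Reg K V ⊗[K] Reg K V) M] where
  piece : ℕ → AddSubgroup M
  G : M ≃+ M
  τ : M ≃+ M
  gens : Finset M
  G_lm (r : Reg K V) (x : M) : G (lm K M r x) = lm K M (dilate K V r) (G x)
  G_rm (r : Reg K V) (x : M) : G (rm K M r x) = rm K M (dilate K V r) (G x)
  τ_lm (r : Reg K V) (x : M) : τ (lm K M r x) = lm K M (translate K q r) (τ x)
  τ_rm (r : Reg K V) (x : M) : τ (rm K M r x) = rm K M (translate K q r) (τ x)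
  G_piece (d : ℕ) (x : M) : x ∈ piece d → G x = (2 ^ d : ℕ) • x
  iSup_piece : ⨆ d, piece d = ⊤
  τ_piece (d : ℕ) (x : M) : x ∈ piece d → τ x - x ∈ pieces piece (Set.Iio d)
  gens_mem (s : M) : s ∈ gens → ∃ d, s ∈ piece d
  gens_closure : AddSubgroup.closure {x | ∃ r : Reg K V, ∃ s ∈ gens, x = rm K M r s} = ⊤

variable {A : GradedBialgebra.{u, max u v} K (Reg K V)} {P : Subalgebra K (Reg K V)}

theorem ctmul_mem_deg {a b : ℕ} {f : Reg K V} (hf : f ∈ homDeg K V a) {y : A.carrier}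
    (hy : y ∈ A.deg (2 * b)) :
    ctmul (regDeg K V) P A f y ∈
      (GradedBialgebra.cons (regDeg K V) P A).deg (2 * ((a + b : ℕ) : ℤ)) :=
  AddSubgroup.subset_closure ⟨2 * a, 2 * b, by push_cast; ring, f, hf, y, hy, rfl⟩

/-- As only even non-negative degrees occur, the piece of degree `n` of `R ⊗_P A` is spanned by the
tensors of homogeneous elements of degrees `2 a` and `2 b` with `2 (a + b) = n`. -/
theorem cons_deg_le (hA : ∀ n : ℤ, (∀ d : ℕ, n ≠ 2 * d) → A.deg n = ⊥) {n : ℤ}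
    {H : AddSubgroup (GradedBialgebra.cons (regDeg K V) P A).carrier}
    (h : ∀ a b : ℕ, 2 * ((a + b : ℕ) : ℤ) = n → ∀ f ∈ homDeg K V a, ∀ y ∈ A.deg (2 * b),
      ctmul (regDeg K V) P A f y ∈ H) :
    (GradedBialgebra.cons (regDeg K V) P A).deg n ≤ H := by
  refine (AddSubgroup.closure_le H).2 ?_
  rintro _ ⟨i, j, hij, f, hf, y, hy, rfl⟩
  change ctmul (regDeg K V) P A f y ∈ H
  by_cases hi : ∃ a : ℕ, i = 2 * a
  · by_cases hj : ∃ b : ℕ, j = 2 * b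
    · obtain ⟨a, rfl⟩ := hi
      obtain ⟨b, rfl⟩ := hj
      exact h a b (by push_cast; linarith) f hf y hy
    · rw [hA j (by simpa using hj), AddSubgroup.mem_bot] at hy
      rw [hy, map_zero]
      exact zero_mem _
  · rw [regDeg_eq_bot (by simpa using hi), AddSubgroup.mem_bot] at hf
    rw [hf, map_zero]
    exact zero_mem _

theorem cons_deg_eq_bot (hA : ∀ n : ℤ, (∀ d : ℕ, n ≠ 2 * d) → A.deg n = ⊥) (n : ℤ)
    (hn : ∀ d : ℕ, n ≠ 2 * d) : (GradedBialgebra.cons (regDeg K V) P A).deg n = ⊥ :=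
  eq_bot_iff.2 (cons_deg_le hA fun a b hab => (hn (a + b) hab.symm).elim)

theorem bottSamelson_deg_eq_bot {W : Type*} [Group W] (ρ : Representation K W V) (l : List W)
    (n : ℤ) (hn : ∀ d : ℕ, n ≠ 2 * d) : (bottSamelson ρ l).deg n = ⊥ := by
  induction l generalizing n with
  | nil => exact regDeg_eq_bot hn
  | cons s l ih =>
    rw [bottSamelson_cons]
    exact cons_deg_eq_bot ih n hn

variable [CharZero K]

namespace GradingDatum

/-- The regular bimodule. -/
def unit (q : V) : GradingDatum K q (GradedBialgebra.unit (K := K) (regDeg K V)).carrier where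
  piece d := (GradedBialgebra.unit (K := K) (regDeg K V)).deg (2 * d)
  G := (dilate K V).toAddEquiv
  τ := (translate K q).toAddEquiv
  gens := {(1 : Reg K V)}
  G_lm r x := by rw [lm_carrier, lm_carrier]; exact map_mul (dilate K V) r x
  G_rm r x := by rw [rm_carrier, rm_carrier]; exact map_mul (dilate K V) r x
  τ_lm r x := by rw [lm_carrier, lm_carrier]; exact map_mul (translate K q) r x
  τ_rm r x := by rw [rm_carrier, rm_carrier]; exact map_mul (translate K q) r x
  G_piece d x hx := (dilate_of_mem_homDeg hx).trans <| by
    change (2 : K) ^ d • (show Reg K V from x) = (2 ^ d : ℕ) • (show Reg K V from x)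
    rw [← Nat.cast_smul_eq_nsmul K]; simp
  iSup_piece := iSup_homDeg
  τ_piece d x hx := translate_sub_mem q hx
  gens_mem s hs := ⟨0, by
    rw [Finset.mem_singleton.1 hs]
    have := algebraMap_mem_homDeg (V := V) (1 : K)
    rwa [map_one] at this⟩
  gens_closure := eq_top_iff.2 fun x _ => AddSubgroup.subset_closure
    ⟨(show Reg K V from x), (1 : Reg K V), Finset.mem_singleton_self _,
      ((rm_carrier (GradedBialgebra.unit (K := K) (regDeg K V)) (show Reg K V from x)
        (1 : Reg K V)).trans (mul_one (show Reg K V from x))).symm⟩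

variable {q : V}

/-- The dilation and the translation by a point fixed by `s` preserve `R^s`, so that they act on
`R ⊗_{R^s} A`; generators are the elements `1 ⊗ g` and `α ⊗ g` for the generators `g` of `A`. -/
theorem exists_cons {W : Type*} [Group W] {ρ : Representation K W V} {s : W} {α : Module.Dual K V}
    (hs : IsReflectionAlong ρ s α) (hq : ρ s q = q)
    (hA : ∀ n : ℤ, (∀ d : ℕ, n ≠ 2 * d) → A.deg n = ⊥)
    (D : GradingDatum K q A.carrier) (hD : ∀ d, D.piece d = A.deg (2 * d)) :
    ∃ D' : GradingDatum K q (GradedBialgebra.cons (regDeg K V) (invariants (ρ s)) A).carrier,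
      ∀ d, D'.piece d = (GradedBialgebra.cons (regDeg K V) (invariants (ρ s)) A).deg (2 * d) := by
  classical
  set P := invariants (ρ s)
  let p : ℕ → AddSubgroup (GradedBialgebra.cons (regDeg K V) P A).carrier :=
    fun d => (GradedBialgebra.cons (regDeg K V) P A).deg (2 * d)
  let t := ctmul (regDeg K V) P A
  have hp : ∀ {Y Z X : Set ℕ}, (∀ y ∈ Y, ∀ z ∈ Z, y + z ∈ X) → ∀ {f : Reg K V} {x : A.carrier},
      f ∈ pieces (homDeg K V) Y → x ∈ pieces D.piece Z → t f x ∈ pieces p X := by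
    intro Y Z X hX f x hf hx
    refine map_mem_of_mem_pieces (t.flip x) (fun y hy f hf => ?_) hf
    refine map_mem_of_mem_pieces (t f) (fun z hz x hx => ?_) hx
    rw [hD] at hx
    exact mem_pieces (hX y hy z hz) (ctmul_mem_deg hf hx)
  have hple : ∀ {d : ℕ} {H : AddSubgroup (GradedBialgebra.cons (regDeg K V) P A).carrier},
      (∀ a b : ℕ, a + b = d → ∀ f ∈ homDeg K V a, ∀ y ∈ D.piece b, t f y ∈ H) → p d ≤ H := by
    intro d H h
    refine cons_deg_le hA fun a b hab f hf y hy =>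
      h a b (by exact_mod_cast mul_left_cancel₀ two_ne_zero hab) f hf y ?_
    rw [hD]; exact hy
  let G := consEquiv (degR := regDeg K V) (dilate K V).toRingEquiv D.G
    (dilate_mem_invariants_iff (ρ s)) D.G_lm
  let τ := consEquiv (degR := regDeg K V) (translate K q).toRingEquiv D.τ
    (translate_mem_invariants_iff hq) D.τ_lm
  have hG : ∀ f y, G (t f y) = t (dilate K V f) (D.G y) := fun _ _ => rfl
  have hτ : ∀ f y, τ (t f y) = t (translate K q f) (D.τ y) := fun _ _ => rfl
  refine ⟨⟨p, G, τ, D.gens.image (t 1) ∪ D.gens.image (t (linForm α)),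
    consEquiv_lm (dilate K V).toRingEquiv D.G (dilate_mem_invariants_iff (ρ s)) D.G_lm,
    consEquiv_rm (dilate K V).toRingEquiv D.G (dilate_mem_invariants_iff (ρ s)) D.G_lm _ D.G_rm,
    consEquiv_lm (translate K q).toRingEquiv D.τ (translate_mem_invariants_iff hq) D.τ_lm,
    consEquiv_rm (translate K q).toRingEquiv D.τ (translate_mem_invariants_iff hq) D.τ_lm _ D.τ_rm,
    fun d x hx => ?_, ?_, fun d x hx => ?_, fun x hx => ?_, ?_⟩, fun d => rfl⟩
  · refine hple (H := (G.toAddMonoidHom - AddMonoidHom.mk' (fun x => (2 ^ d : ℕ) • x)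
      (fun x y => smul_add _ x y)).ker) ?_ hx |> fun h => sub_eq_zero.1 h
    intro a b hab f hf y hy
    refine sub_eq_zero.2 ?_
    change G (t f y) = (2 ^ d : ℕ) • t f y
    rw [hG, D.G_piece b y hy, dilate_of_mem_homDeg hf, ← hab, pow_add]
    have : (2 : K) ^ a • f = (2 ^ a : ℕ) • f := by rw [← Nat.cast_smul_eq_nsmul K]; simp
    rw [this, map_nsmul, map_nsmul, AddMonoidHom.nsmul_apply, ← mul_smul, mul_comm]
  · refine eq_top_iff.2 fun x _ => ?_
    have : x ∈ pieces p Set.univ := by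
      induction x using cons_induction with
      | tmul f y =>
        exact hp (fun _ _ _ _ => Set.mem_univ _) (mem_pieces_homDeg_univ f)
          (mem_pieces_univ D.iSup_piece y)
      | add x y hx hy =>
        exact add_mem (hx (AddSubgroup.mem_top x)) (hy (AddSubgroup.mem_top y))
    simpa only [pieces, iSup_univ] using this
  · refine hple (H := (pieces p (Set.Iio d)).comap (τ.toAddMonoidHom - AddMonoidHom.id _)) ?_ hx
    intro a b hab f hf y hy
    change τ (t f y) - t f y ∈ pieces p (Set.Iio d)
    have : τ (t f y) - t f y = t (translate K q f - f) (D.τ y - y) + t (translate K q f - f) y +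
        t f (D.τ y - y) := by
      rw [hτ]
      simp only [map_sub, AddMonoidHom.sub_apply]
      abel
    rw [this]
    refine add_mem (add_mem (hp ?_ (translate_sub_mem q hf) (D.τ_piece b y hy))
      (hp ?_ (translate_sub_mem q hf) (mem_pieces (Set.mem_singleton b) hy)))
      (hp ?_ (mem_pieces (Set.mem_singleton a) hf) (D.τ_piece b y hy))
    all_goals
      intro y hy z hz
      simp only [Set.mem_Iio, Set.mem_singleton_iff] at *
      omega
  · rcases Finset.mem_union.1 hx with hx | hx
    · obtain ⟨y, hy, rfl⟩ := Finset.mem_image.1 hx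
      obtain ⟨d, hd⟩ := D.gens_mem y hy
      have h0 := algebraMap_mem_homDeg (V := V) (1 : K)
      rw [map_one] at h0
      rw [hD] at hd
      exact ⟨0 + d, ctmul_mem_deg h0 hd⟩
    · obtain ⟨y, hy, rfl⟩ := Finset.mem_image.1 hx
      obtain ⟨d, hd⟩ := D.gens_mem y hy
      rw [hD] at hd
      exact ⟨1 + d, ctmul_mem_deg (linForm_mem_homDeg α) hd⟩
  · refine eq_top_iff.2 fun x _ => ?_
    set H := AddSubgroup.closure {x | ∃ r : Reg K V, ∃ s ∈ D.gens.image (t 1) ∪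
      D.gens.image (t (linForm α)), x = rm K (GradedBialgebra.cons (regDeg K V) P A).carrier r s}
    have key : ∀ g : Reg K V, (∀ s ∈ D.gens, t g s ∈ D.gens.image (t 1) ∪
        D.gens.image (t (linForm α))) → ∀ y, t g y ∈ H := by
      intro g hg y
      have hy : y ∈ AddSubgroup.closure {x | ∃ r : Reg K V, ∃ s ∈ D.gens, x = rm K A.carrier r s} :=
        D.gens_closure ▸ AddSubgroup.mem_top y
      induction hy using AddSubgroup.closure_induction with
      | mem y hy =>
        obtain ⟨r, s, hs, rfl⟩ := hy
        exact AddSubgroup.subset_closure ⟨r, t g s, hg s hs, (rm_ctmul r g s).symm⟩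
      | zero => rw [map_zero]; exact zero_mem _
      | add x y _ _ hx hy => rw [map_add]; exact add_mem hx hy
      | neg x _ hx => rw [map_neg]; exact neg_mem hx
    have k1 := key 1 fun s hs => Finset.mem_union_left _ (Finset.mem_image_of_mem _ hs)
    have k2 := key (linForm α) fun s hs => Finset.mem_union_right _ (Finset.mem_image_of_mem _ hs)
    induction x using cons_induction with
    | tmul f y =>
      obtain ⟨g, hg, g', hg', rfl⟩ := hs.exists_eq_add_mul f
      rw [map_add, AddMonoidHom.add_apply, ← one_mul g, ctmul_mul hg, ctmul_mul hg']
      exact add_mem (k1 _) (k2 _)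
    | add x y hx hy => exact add_mem (hx (AddSubgroup.mem_top x)) (hy (AddSubgroup.mem_top y))

/-- Finite direct sums of graded bimodules. -/
theorem exists_pi {ι : Type*} [Fintype ι] {M : ι → Type*} [∀ i, AddCommGroup (M i)]
    [∀ i, Module (Reg K V ⊗[K] Reg K V) (M i)] (D : ∀ i, GradingDatum K q (M i)) :
    ∃ D' : GradingDatum K q (∀ i, M i), ∀ d x, x ∈ D'.piece d ↔ ∀ i, x i ∈ (D i).piece d := by
  classical
  let p : ℕ → AddSubgroup (∀ i, M i) := fun d => AddSubgroup.pi Set.univ fun i => (D i).piece d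
  have hp : ∀ d x, x ∈ p d ↔ ∀ i, x i ∈ (D i).piece d := fun d x => by
    simp [p, AddSubgroup.mem_pi]
  have hps : ∀ d i (x : M i), x ∈ (D i).piece d → Pi.single i x ∈ p d := fun d i x hx => by
    refine (hp _ _).2 fun j => ?_
    by_cases h : j = i
    · subst h; simpa using hx
    · rw [Pi.single_eq_of_ne h]; exact zero_mem _
  have hpp : ∀ Z i (x : M i), x ∈ pieces (D i).piece Z → Pi.single i x ∈ pieces p Z :=
    fun Z i x hx => map_mem_of_mem_pieces (AddMonoidHom.single M i)
      (fun e he x hx => mem_pieces he (hps e i x hx)) hx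
  have hsum : ∀ x : ∀ i, M i, x = ∑ i, Pi.single i (x i) := fun x => (Finset.univ_sum_single x).symm
  have hl : ∀ (r : Reg K V) (x : ∀ i, M i) i, lm K (∀ i, M i) r x i = lm K (M i) r (x i) :=
    fun _ _ _ => rfl
  have hr : ∀ (r : Reg K V) (x : ∀ i, M i) i, rm K (∀ i, M i) r x i = rm K (M i) r (x i) :=
    fun _ _ _ => rfl
  refine ⟨⟨p, AddEquiv.piCongrRight fun i => (D i).G, AddEquiv.piCongrRight fun i => (D i).τ,
    Finset.univ.biUnion fun i => (D i).gens.image (Pi.single i),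
    fun r x => funext fun i => ?_, fun r x => funext fun i => ?_, fun r x => funext fun i => ?_,
    fun r x => funext fun i => ?_,
    fun d x hx => funext fun i => (D i).G_piece d _ ((hp d x).1 hx i),
    ?_, fun d x hx => ?_, fun x hx => ?_, ?_⟩, hp⟩
  · exact (D i).G_lm r (x i)
  · exact (D i).G_rm r (x i)
  · exact (D i).τ_lm r (x i)
  · exact (D i).τ_rm r (x i)
  · refine eq_top_iff.2 fun x _ => ?_
    have : x ∈ pieces p Set.univ := by
      rw [hsum x]
      exact sum_mem fun i _ => hpp _ _ _ (mem_pieces_univ (D i).iSup_piece (x i))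
    simpa only [pieces, iSup_univ] using this
  · rw [hsum (_ - x)]
    exact sum_mem fun i _ => hpp _ _ _ ((D i).τ_piece d _ ((hp d x).1 hx i))
  · obtain ⟨i, -, hx⟩ := Finset.mem_biUnion.1 hx
    obtain ⟨y, hy, rfl⟩ := Finset.mem_image.1 hx
    obtain ⟨d, hd⟩ := (D i).gens_mem y hy
    exact ⟨d, hps _ _ _ hd⟩
  · refine eq_top_iff.2 fun x _ => ?_
    rw [hsum x]
    refine sum_mem fun i _ => ?_
    generalize x i = y
    have hy : y ∈ AddSubgroup.closure {x | ∃ r : Reg K V, ∃ s ∈ (D i).gens, x = rm K (M i) r s} :=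
      (D i).gens_closure ▸ AddSubgroup.mem_top y
    induction hy using AddSubgroup.closure_induction with
    | mem y hy =>
      obtain ⟨r, s, hs, rfl⟩ := hy
      refine AddSubgroup.subset_closure ⟨r, Pi.single i s, Finset.mem_biUnion.2
        ⟨i, Finset.mem_univ i, Finset.mem_image_of_mem _ hs⟩, ?_⟩
      exact map_rm (LinearMap.single (Reg K V ⊗[K] Reg K V) M i) r s
    | zero => rw [Pi.single_zero]; exact zero_mem _
    | add x y _ _ hx hy => rw [Pi.single_add]; exact add_mem hx hy
    | neg x _ hx => rw [Pi.single_neg]; exact neg_mem hx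

end GradingDatum

section

variable {W : Type*} [Group W] (ρ : Representation K W V)

/-- The Bott–Samelson bimodule of a word in reflections which fix `q` has a grading datum at `q`,
with its standard grading. -/
theorem exists_gradingDatum_bottSamelson {q : V} (l : List W)
    (hl : ∀ s ∈ l, (∃ α, IsReflectionAlong ρ s α) ∧ ρ s q = q) :
    ∃ D : GradingDatum K q (bottSamelson ρ l).carrier,
      ∀ d, D.piece d = (bottSamelson ρ l).deg (2 * d) := by
  induction l with
  | nil =>
    rw [bottSamelson_nil]
    exact ⟨GradingDatum.unit q, fun _ => rfl⟩
  | cons s l ih =>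
    obtain ⟨D, hD⟩ := ih fun t ht => hl t (by simp [ht])
    obtain ⟨⟨α, hα⟩, hq⟩ := hl s (by simp)
    have h0 := bottSamelson_deg_eq_bot ρ l
    rw [bottSamelson_cons]
    exact GradingDatum.exists_cons hα hq h0 D hD

end

end GradingDatum

/-! ### Homogeneous representatives of idempotents of a specialisation -/

section TwistConj

variable {K : Type u} {R : Type w} [CommRing K] [CommRing R] [Algebra K R]
variable {M : Type*} [AddCommGroup M] [Module (R ⊗[K] R) M]

theorem twist_symm_lm {θ : M ≃+ M} {φ : R ≃ₐ[K] R}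
    (hl : ∀ (r : R) x, θ (lm K M r x) = lm K M (φ r) (θ x)) (r : R) (x : M) :
    θ.symm (lm K M r x) = lm K M (φ.symm r) (θ.symm x) := by
  rw [AddEquiv.symm_apply_eq, hl, AlgEquiv.apply_symm_apply, AddEquiv.apply_symm_apply]

theorem twist_symm_rm {θ : M ≃+ M} {φ : R ≃ₐ[K] R}
    (hr : ∀ (r : R) x, θ (rm K M r x) = rm K M (φ r) (θ x)) (r : R) (x : M) :
    θ.symm (rm K M r x) = rm K M (φ.symm r) (θ.symm x) := by
  rw [AddEquiv.symm_apply_eq, hr, AlgEquiv.apply_symm_apply, AddEquiv.apply_symm_apply]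

/-- The conjugate `θ Y θ⁻¹` of a bimodule endomorphism `Y` by an automorphism `θ` which is twisted
on both sides by the same automorphism `φ` of `R`. -/
def twistConj (θ : M ≃+ M) (φ : R ≃ₐ[K] R)
    (hl : ∀ (r : R) x, θ (lm K M r x) = lm K M (φ r) (θ x))
    (hr : ∀ (r : R) x, θ (rm K M r x) = rm K M (φ r) (θ x)) :
    Module.End (R ⊗[K] R) M →+* Module.End (R ⊗[K] R) M where
  toFun Y := ofLmRm (θ.toAddMonoidHom.comp (Y.toAddMonoidHom.comp θ.symm.toAddMonoidHom))
    (fun r x => by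
      change θ (Y (θ.symm (lm K M r x))) = lm K M r (θ (Y (θ.symm x)))
      rw [twist_symm_lm hl, map_lm, hl, AlgEquiv.apply_symm_apply])
    (fun r x => by
      change θ (Y (θ.symm (rm K M r x))) = rm K M r (θ (Y (θ.symm x)))
      rw [twist_symm_rm hr, map_rm, hr, AlgEquiv.apply_symm_apply])
  map_one' := LinearMap.ext fun x => θ.apply_symm_apply x
  map_mul' Y Z := LinearMap.ext fun x => by
    change θ (Y (Z (θ.symm x))) = θ (Y (θ.symm (θ (Z (θ.symm x)))))
    rw [AddEquiv.symm_apply_apply]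
  map_zero' := LinearMap.ext fun x => map_zero θ
  map_add' Y Z := LinearMap.ext fun x => map_add θ _ _

@[simp] theorem twistConj_apply (θ : M ≃+ M) (φ : R ≃ₐ[K] R)
    (hl : ∀ (r : R) x, θ (lm K M r x) = lm K M (φ r) (θ x))
    (hr : ∀ (r : R) x, θ (rm K M r x) = rm K M (φ r) (θ x)) (Y : Module.End (R ⊗[K] R) M) (x : M) :
    twistConj θ φ hl hr Y x = θ (Y (θ.symm x)) := rfl

/-- An endomorphism with values in `M 𝔞` sends `M 𝔟` into `M 𝔟 𝔞`. -/
theorem rsub_mul_le (𝔞 𝔟 : Ideal R) (Y : Module.End (R ⊗[K] R) M)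
    (hY : ∀ x, Y x ∈ rsub K M 𝔞) {x : M} (hx : x ∈ rsub K M 𝔟) : Y x ∈ rsub K M (𝔟 * 𝔞) := by
  refine map_mem_rsub_of Y.toAddMonoidHom (fun r hr m => ?_) hx
  change Y (rm K M r m) ∈ _
  rw [map_rm]
  exact map_mem_rsub_of (rm K M r).toAddMonoidHom (fun r' hr' m => by
    change rm K M r (rm K M r' m) ∈ _
    rw [← rm_mul_apply]
    exact rm_mem_rsub (Ideal.mul_mem_mul hr hr') m) (hY m)

end TwistConj

section Linear

variable {K : Type u} {R : Type w} [CommRing K] [CommRing R] [Algebra K R]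
variable {M : Type*} [AddCommGroup M] [Module (R ⊗[K] R) M] [Module K M]
  [IsScalarTower K (R ⊗[K] R) M]

variable (R) in
theorem lm_algebraMap (c : K) (x : M) : lm K M (algebraMap K R c) x = c • x := by
  rw [lm_apply, ← algebraMap_smul (R ⊗[K] R) c x]; rfl

variable (R) in
theorem rm_algebraMap (c : K) (x : M) : rm K M (algebraMap K R c) x = c • x := by
  rw [rm_apply, ← algebraMap_smul (R ⊗[K] R) c x]
  congr 1
  rw [Algebra.algebraMap_eq_smul_one, Algebra.algebraMap_eq_smul_one, TensorProduct.tmul_smul]; rfl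

/-- A twisted automorphism is `K`-linear. -/
def twistLinear (θ : M ≃+ M) (φ : R ≃ₐ[K] R)
    (hl : ∀ (r : R) x, θ (lm K M r x) = lm K M (φ r) (θ x)) : M ≃ₗ[K] M :=
  { θ with
    map_smul' := fun c x => by
      change θ (c • x) = c • θ x
      rw [← lm_algebraMap R, hl, AlgEquiv.commutes, lm_algebraMap] }

/-- The action of bimodule endomorphisms on the specialisation. -/
def specEnd (𝔞 : Ideal R) : Module.End (R ⊗[K] R) M →ₐ[K]
    Module.End K (M ⧸ (rsub K M 𝔞).restrictScalars K) where
  toFun Y := Submodule.mapQ _ _ (Y.restrictScalars K) fun _ hx => map_mem_rsub Y hx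
  map_one' := Submodule.linearMap_qext _ rfl
  map_mul' _ _ := Submodule.linearMap_qext _ rfl
  map_zero' := Submodule.linearMap_qext _ rfl
  map_add' _ _ := Submodule.linearMap_qext _ rfl
  commutes' _ := Submodule.linearMap_qext _ rfl

theorem specEnd_mk (𝔞 : Ideal R) (Y : Module.End (R ⊗[K] R) M) (x : M) :
    specEnd 𝔞 Y (Submodule.Quotient.mk x) = Submodule.Quotient.mk (Y x) := rfl

theorem specEnd_eq_iff {𝔞 : Ideal R} {Y Z : Module.End (R ⊗[K] R) M} :
    specEnd 𝔞 Y = specEnd 𝔞 Z ↔ ∀ x, Y x - Z x ∈ rsub K M 𝔞 := by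
  constructor
  · intro h x
    have := LinearMap.congr_fun h (Submodule.Quotient.mk x)
    rw [specEnd_mk, specEnd_mk] at this
    exact (Submodule.Quotient.eq _).1 this
  · intro h
    exact Submodule.linearMap_qext _ (LinearMap.ext fun x => (Submodule.Quotient.eq _).2 (h x))

end Linear

section Eigen

open Polynomial

variable {K : Type*} [Field K] {E : Type*} [AddCommGroup E] [Module K E]

/-- A vector killed by a product of distinct linear factors in `f` is a sum of eigenvectors, even if
the space is infinite-dimensional. -/
theorem mem_iSup_eigenspace_of_aeval (f : Module.End K E) (Z : Finset K) (Y : E)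
    (h : aeval f (∏ c ∈ Z, (X - C c)) Y = 0) : Y ∈ ⨆ c ∈ Z, Module.End.eigenspace f c := by
  classical
  induction Z using Finset.induction_on generalizing Y with
  | empty => simpa using h
  | insert c Z hc ih =>
    rw [Finset.prod_insert hc] at h
    have hcop : IsCoprime (X - C c) (∏ c ∈ Z, (X - C c)) :=
      IsCoprime.prod_right fun d hd => isCoprime_X_sub_C_of_isUnit_sub
        (sub_ne_zero.2 (by rintro rfl; exact hc hd)).isUnit
    have h1 : Y ∈ LinearMap.ker (aeval f ((X - C c) * ∏ c ∈ Z, (X - C c))) := h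
    rw [← Polynomial.sup_ker_aeval_eq_ker_aeval_mul_of_coprime f hcop] at h1
    obtain ⟨y, hy, z, hz, rfl⟩ := Submodule.mem_sup.1 h1
    rw [Finset.iSup_insert]
    refine Submodule.add_mem_sup ?_ (ih z hz)
    rw [Module.End.mem_eigenspace_iff]
    simpa [sub_eq_zero] using hy

theorem aeval_apply_of_intertwine {N : Type*} [AddCommGroup N] [Module K N] (f : Module.End K E)
    (g : Module.End K N) (e : E →ₗ[K] N) (h : ∀ y, e (f y) = g (e y)) (p : K[X]) (y : E) :
    e (aeval f p y) = aeval g p (e y) := by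
  induction p using Polynomial.induction_on' generalizing y with
  | add p q hp hq => simp [hp, hq]
  | monomial n c =>
    have : ∀ n y, e ((f ^ n) y) = (g ^ n) (e y) := by
      intro n
      induction n with
      | zero => intro y; simp
      | succ n ih => intro y; rw [pow_succ', pow_succ', Module.End.mul_apply, h, ih]; rfl
    simp [aeval_monomial, Module.algebraMap_end_apply, this]

theorem aeval_apply_of_eigen (f : Module.End K E) {c : K} {y : E} (h : f y = c • y) (p : K[X]) :
    aeval f p y = p.eval c • y := by
  by_cases hy : y = 0
  · simp [hy]
  · exact Module.End.aeval_apply_of_hasEigenvector ⟨Module.End.mem_eigenspace_iff.2 h, hy⟩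

end Eigen

namespace GradingDatum

variable {K : Type u} {V : Type v} [Field K] [CharZero K] [AddCommGroup V] [Module K V]
variable {q : V} {M : Type*} [AddCommGroup M] [Module (Reg K V ⊗[K] Reg K V) M]
variable (D : GradingDatum K q M)

theorem ext_gens {Y Z : Module.End (Reg K V ⊗[K] Reg K V) M} (h : ∀ s ∈ D.gens, Y s = Z s) :
    Y = Z := by
  refine LinearMap.ext fun x => ?_
  have hx : x ∈ AddSubgroup.closure {x | ∃ r : Reg K V, ∃ s ∈ D.gens, x = rm K M r s} :=
    D.gens_closure ▸ AddSubgroup.mem_top x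
  induction hx using AddSubgroup.closure_induction with
  | mem y hy => obtain ⟨r, s, hs, rfl⟩ := hy; rw [map_rm, map_rm, h s hs]
  | zero => simp
  | add x y _ _ hx hy => rw [map_add, map_add, hx, hy]
  | neg x _ hx => rw [map_neg, map_neg, hx]

/-- An endomorphism which lowers the degrees is nilpotent. -/
theorem isNilpotent_of_lower (Y : Module.End (Reg K V ⊗[K] Reg K V) M)
    (h : ∀ d, ∀ x ∈ D.piece d, Y x ∈ pieces D.piece (Set.Iio d)) : IsNilpotent Y := by
  have h1 : ∀ k d, ∀ x ∈ pieces D.piece (Set.Iio d), d ≤ k → (Y ^ k) x = 0 := by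
    intro k
    induction k with
    | zero =>
      intro d x hx hd
      obtain rfl : d = 0 := by omega
      simpa [pieces] using hx
    | succ k ih =>
      intro d x hx hd
      rw [pow_succ, Module.End.mul_apply]
      refine ih k _ (map_mem_of_mem_pieces Y.toAddMonoidHom (fun e he x hx => ?_) hx) le_rfl
      refine pieces_mono (Set.Iio_subset_Iio ?_) (h e x hx)
      have : e < d := he
      omega
  choose! n hn using fun s => D.gens_mem s
  refine ⟨D.gens.sup n + 1, D.ext_gens fun s hs => ?_⟩
  exact h1 _ (n s + 1) s (mem_pieces (by simp) (hn s hs)) (by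
    have := Finset.le_sup (f := n) hs
    omega)

section Key

variable [Module K M] [IsScalarTower K (Reg K V ⊗[K] Reg K V) M]

include D in
/-- The specialisation is spanned by the classes of the generators from the right. -/
theorem finiteDimensional_specialisation (a : V) :
    FiniteDimensional K (M ⧸ (rsub K M (pointIdeal K a)).restrictScalars K) := by
  classical
  let J := (rsub K M (pointIdeal K a)).restrictScalars K
  refine ⟨⟨D.gens.image J.mkQ, eq_top_iff.2 fun u _ => ?_⟩⟩
  obtain ⟨x, rfl⟩ := J.mkQ_surjective u
  have hx : x ∈ AddSubgroup.closure {x | ∃ r : Reg K V, ∃ s ∈ D.gens, x = rm K M r s} :=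
    D.gens_closure ▸ AddSubgroup.mem_top x
  induction hx using AddSubgroup.closure_induction with
  | mem y hy =>
    obtain ⟨r, s, hs, rfl⟩ := hy
    have h1 : J.mkQ (rm K M r s) = evalAt K a r • J.mkQ s := by
      rw [← map_smul, ← rm_algebraMap (Reg K V), Submodule.mkQ_apply, Submodule.mkQ_apply,
        Submodule.Quotient.eq, ← LinearMap.sub_apply, ← map_sub]
      exact rm_mem_rsub (by rw [mem_pointIdeal, map_sub, AlgHom.commutes]; exact sub_self _) s
    rw [h1]
    exact Submodule.smul_mem _ _ (Submodule.subset_span (by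
      rw [Finset.coe_image]; exact Set.mem_image_of_mem _ hs))
  | zero => rw [map_zero]; exact zero_mem _
  | add x y _ _ hx hy => rw [map_add]; exact add_mem (hx trivial) (hy trivial)
  | neg x _ hx => rw [map_neg]; exact neg_mem (hx trivial)

/-- Conjugation by the grading automorphism, as an algebra endomorphism. -/
def adG : Module.End (Reg K V ⊗[K] Reg K V) M →ₐ[K] Module.End (Reg K V ⊗[K] Reg K V) M :=
  { twistConj D.G (dilate K V) D.G_lm D.G_rm with
    commutes' := fun c => LinearMap.ext fun x => by
      change D.G (c • D.G.symm x) = c • x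
      exact ((twistLinear D.G (dilate K V) D.G_lm).map_smul c _).trans
        (congrArg (c • ·) (D.G.apply_symm_apply x)) }

theorem adG_apply (Y : Module.End (Reg K V ⊗[K] Reg K V) M) (x : M) :
    D.adG Y x = D.G (Y (D.G.symm x)) := rfl

/-- The grading automorphism, as a linear map. -/
def Glin : Module.End K M := (twistLinear D.G (dilate K V) D.G_lm).toLinearMap

theorem Glin_apply (x : M) : D.Glin x = D.G x := rfl

theorem Glin_piece (d : ℕ) (x : M) (hx : x ∈ D.piece d) : D.Glin x = (2 : K) ^ d • x := by
  rw [Glin_apply, D.G_piece d x hx, ← Nat.cast_smul_eq_nsmul K]; simp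

theorem G_symm_piece {d : ℕ} {x : M} (hx : x ∈ D.piece d) :
    D.G.symm x = ((2 : K) ^ d)⁻¹ • x := by
  have h2 : (2 : K) ^ d ≠ 0 := pow_ne_zero _ two_ne_zero
  rw [AddEquiv.symm_apply_eq, ← Glin_apply, map_smul, D.Glin_piece d x hx, smul_smul,
    inv_mul_cancel₀ h2, one_smul]

/-- An endomorphism which commutes with the grading automorphism preserves the grading. -/
theorem apply_mem_piece {Y : Module.End (Reg K V ⊗[K] Reg K V) M} (hY : D.adG Y = Y) {d : ℕ} {x : M}
    (hx : x ∈ D.piece d) : Y x ∈ D.piece d := by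
  refine mem_of_eigen (G := D.Glin) D.Glin_piece D.iSup_piece ?_
  have h1 : D.G (Y x) = Y (D.G x) := by
    conv_rhs => rw [← hY, adG_apply, AddEquiv.symm_apply_apply]
  rw [Glin_apply, h1, ← Glin_apply, D.Glin_piece d x hx, ← lm_algebraMap (Reg K V), map_lm,
    lm_algebraMap]

/-- Every endomorphism is a finite sum of homogeneous ones. -/
theorem iSup_eigenspace_adG :
    ⨆ n : ℤ, Module.End.eigenspace D.adG.toLinearMap ((2 : K) ^ n) = ⊤ := by
  classical
  refine eq_top_iff.2 fun Y _ => ?_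
  choose! d hd using fun s => D.gens_mem s
  choose n hn using fun s => exists_mem_pieces_Iio D.iSup_piece (Y s)
  let Z : Finset K := D.gens.biUnion fun s => (Finset.range (n s)).image fun e : ℕ =>
    (2 : K) ^ ((e : ℤ) - (d s : ℤ))
  -- the values of `Y` at the generators have finitely many components, so that `Y` is killed by
  -- finitely many factors `adG - 2 ^ (e - d)`
  have h1 : Polynomial.aeval D.adG.toLinearMap
      (∏ c ∈ Z, (Polynomial.X - Polynomial.C c)) Y = 0 := by
    refine D.ext_gens fun s hs => ?_
    let ev : Module.End (Reg K V ⊗[K] Reg K V) M →ₗ[K] M :=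
      { toFun := fun Y => Y s, map_add' := fun _ _ => rfl, map_smul' := fun _ _ => rfl }
    have h2 := aeval_apply_of_intertwine D.adG.toLinearMap (((2 : K) ^ d s)⁻¹ • D.Glin) ev
      (fun y => by
        change D.G (y (D.G.symm s)) = ((2 : K) ^ d s)⁻¹ • D.Glin (y s)
        rw [D.G_symm_piece (hd s hs), ← lm_algebraMap (Reg K V), map_lm, lm_algebraMap,
          ← Glin_apply, map_smul]) (∏ c ∈ Z, (Polynomial.X - Polynomial.C c)) Y
    change ev _ = _
    rw [h2]
    refine map_mem_of_mem_pieces (H := ⊥) (Polynomial.aeval (((2 : K) ^ d s)⁻¹ • D.Glin)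
      (∏ c ∈ Z, (Polynomial.X - Polynomial.C c))).toAddMonoidHom (fun e he x hx => ?_) (hn s)
    change Polynomial.aeval (((2 : K) ^ d s)⁻¹ • D.Glin) _ x = 0
    rw [aeval_apply_of_eigen (c := (2 : K) ^ ((e : ℤ) - d s)) _ ?_]
    · rw [Polynomial.eval_prod, Finset.prod_eq_zero (i := (2 : K) ^ ((e : ℤ) - d s)), zero_smul]
      · exact Finset.mem_biUnion.2 ⟨s, hs, Finset.mem_image_of_mem _ (Finset.mem_range.2 he)⟩
      · simp
    · rw [LinearMap.smul_apply, D.Glin_piece e x hx, smul_smul, zpow_sub₀ two_ne_zero,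
        zpow_natCast, zpow_natCast, div_eq_inv_mul]
  have h3 := mem_iSup_eigenspace_of_aeval _ _ _ h1
  have hle : ⨆ c ∈ Z, Module.End.eigenspace D.adG.toLinearMap c ≤
      ⨆ n : ℤ, Module.End.eigenspace D.adG.toLinearMap ((2 : K) ^ n) := iSup₂_le fun c hc => by
    obtain ⟨s, -, hc⟩ := Finset.mem_biUnion.1 hc
    obtain ⟨e, -, rfl⟩ := Finset.mem_image.1 hc
    exact le_iSup (fun n : ℤ => Module.End.eigenspace D.adG.toLinearMap ((2 : K) ^ n)) _
  exact hle h3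

/-- A homogeneous endomorphism of degree zero which vanishes on the specialisation at the origin is
nilpotent: its powers raise the degrees of their values above those of the generators. -/
theorem isNilpotent_of_adG {Y : Module.End (Reg K V ⊗[K] Reg K V) M} (hY : D.adG Y = Y)
    (h0 : ∀ x, Y x ∈ rsub K M (pointIdeal K (0 : V))) : IsNilpotent Y := by
  have h1 : ∀ k x, (Y ^ k) x ∈ rsub K M (pointIdeal K (0 : V) ^ k) := by
    intro k
    induction k with
    | zero => intro x; rw [pow_zero, Ideal.one_eq_top]; simpa using rm_mem_rsub (K := K)
                (𝔞 := (⊤ : Ideal (Reg K V))) (r := 1) trivial x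
    | succ k ih =>
      intro x
      rw [pow_succ' Y, Module.End.mul_apply, pow_succ]
      exact rsub_mul_le _ _ Y h0 (ih x)
  have h2 : ∀ k, ∀ x ∈ rsub K M (pointIdeal K (0 : V) ^ k), x ∈ pieces D.piece (Set.Ici k) := by
    intro k x hx
    change x ∈ AddSubgroup.closure _ at hx
    induction hx using AddSubgroup.closure_induction with
    | mem x hx =>
      obtain ⟨r, hr, m, rfl⟩ := hx
      refine map_mem_of_mem_pieces (AddMonoidHom.mk' (fun r => rm K M r m) fun r r' => by simp)
        (fun a ha r hr => ?_) (mem_pieces_of_mem_pow hr)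
      refine map_mem_of_mem_pieces (rm K M r).toAddMonoidHom (fun b _ m hm => ?_)
        (mem_pieces_univ D.iSup_piece m)
      refine mem_pieces (e := a + b) (le_add_right ha) ?_
      refine mem_of_eigen (G := D.Glin) D.Glin_piece D.iSup_piece ?_
      change D.G (rm K M r m) = _
      rw [D.G_rm, dilate_of_mem_homDeg hr, ← Glin_apply, D.Glin_piece b m hm,
        Algebra.smul_def, rm_mul_apply, rm_algebraMap, ← rm_algebraMap (Reg K V) (2 ^ b) m,
        ← rm_mul_apply, mul_comm, rm_mul_apply, rm_algebraMap, smul_smul, pow_add]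
      rfl
    | zero => exact zero_mem _
    | add x y _ _ hx hy => exact add_mem hx hy
    | neg x _ hx => exact neg_mem hx
  choose! d hd using fun s => D.gens_mem s
  refine ⟨D.gens.sup d + 1, D.ext_gens fun s hs => ?_⟩
  have hYk : D.adG (Y ^ (D.gens.sup d + 1)) = Y ^ (D.gens.sup d + 1) := by rw [map_pow, hY]
  refine eq_zero_of_mem_pieces (G := D.Glin) D.Glin_piece (d := d s) ?_ (Z := Set.Ici _) ?_
    (h2 _ _ (h1 (D.gens.sup d + 1) s))
  · exact D.Glin_piece _ _ (D.apply_mem_piece hYk (hd s hs))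
  · have := Finset.le_sup (f := d) hs
    simp only [Set.mem_Ici]
    omega

/-- An endomorphism which is idempotent modulo `M 𝔪₀` is equivalent, modulo `M 𝔪₀`, to a
homogeneous idempotent. -/
theorem exists_idempotent_zero (X : Module.End (Reg K V ⊗[K] Reg K V) M)
    (hX : ∀ x, X (X x) - X x ∈ rsub K M (pointIdeal K (0 : V))) :
    ∃ F P Q : Module.End (Reg K V ⊗[K] Reg K V) M, F * F = F ∧ D.adG F = F ∧
      (∀ x, Q (P x) - X x ∈ rsub K M (pointIdeal K (0 : V))) ∧
      ∀ x, P (Q x) - F x ∈ rsub K M (pointIdeal K (0 : V)) := by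
  have := D.finiteDimensional_specialisation (0 : V)
  have hdil : ∀ r ∈ pointIdeal K (0 : V), dilate K V r ∈ pointIdeal K (0 : V) := fun r hr => by
    rw [mem_pointIdeal] at *; simpa using hr
  have hdil' : ∀ r ∈ pointIdeal K (0 : V), (dilate K V).symm r ∈ pointIdeal K (0 : V) :=
    fun r hr => by
      rw [mem_pointIdeal] at *
      have : evalAt K (0 : V) (dilate K V ((dilate K V).symm r)) = 0 := by
        rw [AlgEquiv.apply_symm_apply, hr]
      rwa [evalAt_dilate, smul_zero] at this
  let g : Module.End K (M ⧸ (rsub K M (pointIdeal K (0 : V))).restrictScalars K) :=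
    Submodule.mapQ _ _ D.Glin fun x hx =>
      map_mem_rsub_of_twist D.G.toAddMonoidHom _ D.G_rm hdil hx
  let g' : Module.End K (M ⧸ (rsub K M (pointIdeal K (0 : V))).restrictScalars K) :=
    Submodule.mapQ _ _ (twistLinear D.G (dilate K V) D.G_lm).symm.toLinearMap fun x hx =>
      map_mem_rsub_of_twist D.G.symm.toAddMonoidHom _ (twist_symm_rm D.G_rm) hdil' hx
  obtain ⟨F, P, Q, h1, h2, h3, h4⟩ := exists_graded_idempotent
    (specEnd (K := K) (M := M) (pointIdeal K (0 : V))) D.adG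
    (LinearMap.mulLeft K g ∘ₗ LinearMap.mulRight K g')
    (fun Y => Submodule.linearMap_qext _ rfl) D.iSup_eigenspace_adG
    (fun Y hY hY0 => D.isNilpotent_of_adG hY fun x => by
      rw [← map_zero (specEnd (K := K) (M := M) (pointIdeal K (0 : V)))] at hY0
      simpa using specEnd_eq_iff.1 hY0 x) X (specEnd_eq_iff.2 hX)
  exact ⟨F, P, Q, h1, h2, specEnd_eq_iff.1 h3, specEnd_eq_iff.1 h4⟩

end Key

end GradingDatum

/-! ### Homogeneous idempotents at an arbitrary point -/

namespace GradingDatum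

variable {K : Type u} {V : Type v} [Field K] [CharZero K] [AddCommGroup V] [Module K V]
variable {q : V} {M : Type*} [AddCommGroup M] [Module (Reg K V ⊗[K] Reg K V) M]
variable (D : GradingDatum K q M)

theorem τ_symm_pieces (d : ℕ) : ∀ x ∈ pieces D.piece (Set.Iio d),
    D.τ.symm x ∈ pieces D.piece (Set.Iio d) := by
  induction d using Nat.strong_induction_on with
  | _ d ih =>
    intro x hx
    refine map_mem_of_mem_pieces D.τ.symm.toAddMonoidHom (fun e he x hx => ?_) hx
    change D.τ.symm x ∈ _
    have h1 : D.τ.symm x = x - D.τ.symm (D.τ x - x) := by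
      rw [map_sub, AddEquiv.symm_apply_apply]; abel
    rw [h1]
    exact sub_mem (mem_pieces he hx) (pieces_mono (Set.Iio_subset_Iio (le_of_lt he))
      (ih e he _ (D.τ_piece e x hx)))

/-- Conjugation by the translation changes a homogeneous endomorphism only by terms of lower
degree. -/
theorem τ_symm_sub_mem {F : Module.End (Reg K V ⊗[K] Reg K V) M}
    (hF : ∀ d, ∀ x ∈ D.piece d, F x ∈ D.piece d) {d : ℕ} {x : M} (hx : x ∈ D.piece d) :
    D.τ.symm (F (D.τ x)) - F x ∈ pieces D.piece (Set.Iio d) := by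
  have h1 : D.τ.symm (F (D.τ x)) - F x = D.τ.symm (F (D.τ x - x) - (D.τ (F x) - F x)) := by
    simp only [map_sub, AddEquiv.symm_apply_apply]; abel
  rw [h1]
  exact D.τ_symm_pieces d _ (sub_mem (map_mem_of_mem_pieces F.toAddMonoidHom
    (fun e he x hx => mem_pieces he (hF e x hx)) (D.τ_piece d x hx)) (D.τ_piece d _ (hF d x hx)))

/-- An endomorphism which is idempotent modulo `M 𝔪_q` is equivalent, modulo `M 𝔪_q`, to an
idempotent which preserves the grading. The statement is translated to the origin; the conjugate of
the resulting idempotent by the translation differs from it by terms of lower degree, and is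
therefore conjugate to it by a unipotent endomorphism. -/
theorem exists_idempotent (X : Module.End (Reg K V ⊗[K] Reg K V) M)
    (hX : ∀ x, X (X x) - X x ∈ rsub K M (pointIdeal K q)) :
    ∃ F P Q : Module.End (Reg K V ⊗[K] Reg K V) M, (∀ x, F (F x) = F x) ∧
      (∀ d, ∀ x ∈ D.piece d, F x ∈ D.piece d) ∧
      (∀ x, Q (P x) - X x ∈ rsub K M (pointIdeal K q)) ∧
      ∀ x, P (Q x) - F x ∈ rsub K M (pointIdeal K q) := by
  let : Module K M := Module.compHom M (algebraMap K (Reg K V ⊗[K] Reg K V))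
  have : IsScalarTower K (Reg K V ⊗[K] Reg K V) M := IsScalarTower.of_algebraMap_smul fun _ _ => rfl
  have hτ : ∀ x ∈ rsub K M (pointIdeal K q), D.τ x ∈ rsub K M (pointIdeal K (0 : V)) :=
    fun x hx => map_mem_rsub_of_twist D.τ.toAddMonoidHom _ D.τ_rm (fun r hr => by
      rw [mem_pointIdeal] at *; simpa using hr) hx
  have hτ' : ∀ x ∈ rsub K M (pointIdeal K (0 : V)), D.τ.symm x ∈ rsub K M (pointIdeal K q) :=
    fun x hx => map_mem_rsub_of_twist D.τ.symm.toAddMonoidHom _ (twist_symm_rm D.τ_rm)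
      (fun r hr => by
        rw [mem_pointIdeal] at *
        have : evalAt K (0 : V) (translate K q ((translate K q).symm r)) = 0 := by
          rw [AlgEquiv.apply_symm_apply, hr]
        rwa [evalAt_translate, zero_add] at this) hx
  obtain ⟨F, P, Q, hFF, hGF, hQP, hPQ⟩ := D.exists_idempotent_zero
    (twistConj D.τ (translate K q) D.τ_lm D.τ_rm X) fun x => by
      simpa using hτ _ (hX (D.τ.symm x))
  have hF : ∀ d, ∀ x ∈ D.piece d, F x ∈ D.piece d := fun d x hx => D.apply_mem_piece hGF hx
  let c := twistConj D.τ.symm (translate K q).symm (twist_symm_lm D.τ_lm) (twist_symm_rm D.τ_rm)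
  have hc : ∀ Y x, c Y x = D.τ.symm (Y (D.τ x)) := fun _ _ => rfl
  have hF' : c F * c F = c F := by rw [← map_mul, hFF]
  have h1 : ∀ d, ∀ x ∈ D.piece d, (c F - F) x ∈ pieces D.piece (Set.Iio d) :=
    fun d x hx => D.τ_symm_sub_mem hF hx
  have h2 : ∀ d, ∀ x ∈ pieces D.piece (Set.Iio d), (c F - F) x ∈ pieces D.piece (Set.Iio d) :=
    fun d x hx => map_mem_of_mem_pieces (c F - F).toAddMonoidHom (fun e he x hx =>
      pieces_mono (Set.Iio_subset_Iio (le_of_lt he)) (h1 e x hx)) hx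
  have h3 : ∀ d, ∀ x ∈ pieces D.piece (Set.Iio d), F x ∈ pieces D.piece (Set.Iio d) :=
    fun d x hx => map_mem_of_mem_pieces F.toAddMonoidHom (fun e he x hx =>
      mem_pieces he (hF e x hx)) hx
  -- the standard conjugating element `F F' + (1 - F) (1 - F')` of two nearby idempotents
  have hnil : IsNilpotent (F * (c F - F) - (c F - F) * c F) := by
    refine D.isNilpotent_of_lower _ fun d x hx => sub_mem (h3 _ _ (h1 d x hx)) ?_
    change (c F - F) (c F x) ∈ _
    have : c F x = F x + (c F - F) x := by rw [LinearMap.sub_apply]; abel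
    rw [this, map_add]
    exact add_mem (h1 d _ (hF d x hx)) (h2 d _ (h1 d x hx))
  obtain ⟨u, hu⟩ := hnil.isUnit_one_add
  have huF : (u : Module.End (Reg K V ⊗[K] Reg K V) M) * c F = F * u := by
    rw [hu]
    simp only [add_mul, mul_add, mul_sub, sub_mul, one_mul, mul_one, mul_assoc, hF']
    simp only [← mul_assoc, hFF]
    abel
  have hui : ∀ x, (u : Module.End (Reg K V ⊗[K] Reg K V) M)
      ((↑u⁻¹ : Module.End (Reg K V ⊗[K] Reg K V) M) x) = x := fun x =>
    LinearMap.congr_fun u.mul_inv x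
  have hiu : ∀ x, (↑u⁻¹ : Module.End (Reg K V ⊗[K] Reg K V) M)
      ((u : Module.End (Reg K V ⊗[K] Reg K V) M) x) = x := fun x =>
    LinearMap.congr_fun u.inv_mul x
  refine ⟨F, u * c P, c Q * ↑u⁻¹, fun x => LinearMap.congr_fun hFF x, hF, fun x => ?_, fun x => ?_⟩
  · have := hτ' _ (hQP (D.τ x))
    simp only [map_sub, twistConj_apply, AddEquiv.symm_apply_apply] at this
    simpa only [Module.End.mul_apply, hiu, hc, AddEquiv.apply_symm_apply] using this
  · have := map_mem_rsub (u : Module.End (Reg K V ⊗[K] Reg K V) M)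
      (hτ' _ (hPQ (D.τ ((↑u⁻¹ : Module.End (Reg K V ⊗[K] Reg K V) M) x))))
    rw [map_sub, ← hc, map_sub, ← Module.End.mul_apply (u : Module.End _ M) (c F), huF,
      Module.End.mul_apply, hui] at this
    simpa only [Module.End.mul_apply, hc, AddEquiv.apply_symm_apply] using this

end GradingDatum

/-! ### Modules with zero-dimensional support -/

section Support

variable {K : Type u} {V : Type v} [Field K] [AddCommGroup V] [Module K V]

/-- A function which does not vanish at `q` is invertible modulo the powers of `𝔪_q`. -/
theorem exists_mul_sub_one_mem_pow {q : V} {f : Reg K V} (hf : evalAt K q f ≠ 0) (n : ℕ) :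
    ∃ g, f * g - 1 ∈ pointIdeal K q ^ n := by
  set h : Reg K V := 1 - algebraMap K _ (evalAt K q f)⁻¹ * f with hh
  have h1 : h ∈ pointIdeal K q := by
    rw [mem_pointIdeal, hh, map_sub, map_mul, AlgHom.commutes, map_one]
    change 1 - (evalAt K q f)⁻¹ * evalAt K q f = 0
    rw [inv_mul_cancel₀ hf, sub_self]
  refine ⟨algebraMap K _ (evalAt K q f)⁻¹ * ∑ i ∈ Finset.range n, h ^ i, ?_⟩
  have h2 : f * (algebraMap K _ (evalAt K q f)⁻¹ * ∑ i ∈ Finset.range n, h ^ i) - 1 = - h ^ n := by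
    have h3 := mul_neg_geom_sum h n
    have h4 : 1 - h = algebraMap K _ (evalAt K q f)⁻¹ * f := by rw [hh]; ring
    rw [h4] at h3
    linear_combination h3
  rw [h2]
  exact neg_mem (Ideal.pow_mem_pow h1 n)

variable {N : Type*} [AddCommGroup N] [Module (Reg K V) N]

theorem mem_supportedAt {p : V} {x : N} :
    x ∈ supportedAt K p N ↔ ∃ n : ℕ, ∀ f ∈ pointIdeal K p ^ n, f • x = 0 := by
  have hdir : Directed (· ≤ ·) fun n : ℕ => Submodule.torsionBySet (Reg K V) N
      ((pointIdeal K p ^ n : Ideal (Reg K V)) : Set (Reg K V)) :=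
    directed_of_isDirected_le fun m n hmn =>
      Submodule.torsionBySet_le_torsionBySet_of_subset (Ideal.pow_le_pow_right hmn)
  rw [supportedAt, Submodule.mem_iSup_of_directed _ hdir]
  refine exists_congr fun n => ?_
  rw [Submodule.mem_torsionBySet_iff]
  exact ⟨fun h f hf => h ⟨f, hf⟩, fun h f => h f f.2⟩

theorem isCoprime_pointIdeal {p p' : V} (h : p ≠ p') :
    IsCoprime (pointIdeal K p) (pointIdeal K p') :=
  Ideal.isCoprime_iff_sup_eq.2 (Ideal.IsMaximal.coprime_of_ne inferInstance inferInstance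
    (pointIdeal_injective h))

/-- A module which is killed by a power of the ideal of a finite set of points is the direct sum of
its parts supported at these points. -/
theorem isInternal_supportedAt {T : Type*} [DecidableEq T] (pt : T → V)
    (hpt : Function.Injective pt) (F : Finset V) (hF : ∀ p ∈ F, ∃ t, pt t = p) (n : ℕ)
    (hN : ∀ f ∈ (∏ p ∈ F, pointIdeal K p) ^ n, ∀ x : N, f • x = 0) :
    DirectSum.IsInternal fun t => supportedAt K (pt t) N := by
  classical
  refine DirectSum.isInternal_submodule_of_iSupIndep_of_iSup_eq_top ?_ ?_
  · intro t
    rw [Submodule.disjoint_def]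
    intro x hx hx'
    -- the elements supported at the other points are killed by ideals coprime to `𝔪 ^ m`
    have h1 : ∀ y ∈ ⨆ j : {j // j ≠ t}, supportedAt K (pt j) N, ∃ J : Ideal (Reg K V),
        (∀ m, IsCoprime J (pointIdeal K (pt t) ^ m)) ∧ ∀ f ∈ J, f • y = 0 := by
      intro y hy
      induction hy using Submodule.iSup_induction' with
      | mem j y hy =>
        obtain ⟨m, hm⟩ := mem_supportedAt.1 hy
        exact ⟨_, fun k => (isCoprime_pointIdeal fun e => j.2 (hpt e)).pow, hm⟩
      | zero => exact ⟨⊤, fun m => by rw [← Ideal.one_eq_top]; exact isCoprime_one_left, by simp⟩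
      | add y z _ _ hy hz =>
        obtain ⟨J, hJ, hJy⟩ := hy
        obtain ⟨J', hJ', hJz⟩ := hz
        refine ⟨J * J', fun m => (hJ m).mul_left (hJ' m), fun f hf => ?_⟩
        have h1 : f ∈ J := Ideal.mul_le_left hf
        have h2 : f ∈ J' := Ideal.mul_le_right hf
        rw [smul_add, hJy f h1, hJz f h2, add_zero]
    rw [iSup_subtype'] at hx'
    replace h1 := h1 x hx'
    obtain ⟨J, hJ, hJx⟩ := h1
    obtain ⟨m, hm⟩ := mem_supportedAt.1 hx
    obtain ⟨f, hf, g, hg, hfg⟩ := Ideal.isCoprime_iff_exists.1 (hJ m)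
    rw [← one_smul (Reg K V) x, ← hfg, add_smul, hJx f hf, hm g hg, add_zero]
  · refine eq_top_iff.2 fun x _ => ?_
    have h1 := Submodule.iSup_torsionBySet_ideal_eq_torsionBySet_iInf (R := Reg K V) (M := N)
      (S := F) (p := fun p => pointIdeal K p ^ n) (by
        intro p _ p' _ h
        exact Ideal.isCoprime_iff_sup_eq.1 (isCoprime_pointIdeal h).pow)
    have h2 : x ∈ ⨆ p ∈ F,
        Submodule.torsionBySet (Reg K V) N (pointIdeal K p ^ n : Ideal (Reg K V)) := by
      rw [h1, Submodule.mem_torsionBySet_iff]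
      rintro ⟨f, hf⟩
      refine hN f ?_ x
      rw [← Finset.prod_pow, Ideal.prod_eq_iInf_of_pairwise_isCoprime]
      · exact hf
      · intro p _ p' _ h
        exact (isCoprime_pointIdeal h).pow
    have hle :
        ⨆ p ∈ F, Submodule.torsionBySet (Reg K V) N (pointIdeal K p ^ n : Ideal (Reg K V)) ≤
        ⨆ t, supportedAt K (pt t) N := iSup₂_le fun p hp => ?_
    · exact hle h2
    obtain ⟨t, rfl⟩ := hF p hp
    exact le_trans (le_iSup (fun n : ℕ => Submodule.torsionBySet (Reg K V) N
      ((pointIdeal K (pt t) ^ n : Ideal (Reg K V)) : Set (Reg K V))) n)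
      (le_iSup (fun t => supportedAt K (pt t) N) t)

end Support

/-! ### The local form of a Soergel bimodule -/

section LocalForm

variable {K : Type u} {V : Type v} [Field K] [AddCommGroup V] [Module K V]
variable {W : Type*} [Group W] {ρ : Representation K W V}

/-- Splittings of finitely many Bott–Samelson bimodules combine to a splitting of their direct
sum. -/
theorem exists_splitting_pi {S' : Set W} {t : W} {a : V} {n : ℕ} (l : Fin n → List W)
    (X : ∀ i, Nonempty (LocalSplitting ρ S' t a (bottSamelson ρ (l i)))) :
    ∃ (m : ℕ) (w : Fin m → List W)
      (I : (∀ j, (bottSamelson ρ (w j)).carrier) →+ ∀ i, (bottSamelson ρ (l i)).carrier)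
      (p : (∀ i, (bottSamelson ρ (l i)).carrier) →+ ∀ j, (bottSamelson ρ (w j)).carrier)
      (σ τ : Reg K V),
      (∀ j, ∀ s ∈ w j, s ∈ S') ∧ evalAt K (ρ t a) σ ≠ 0 ∧ evalAt K (ρ t a) τ ≠ 0 ∧
      (∀ (r : Reg K V) x, I (lm K _ r x) = lm K _ r (I x)) ∧
      (∀ (r : Reg K V) x, I (rm K _ r x) = rm K _ (act ρ t⁻¹ r) (I x)) ∧
      (∀ (r : Reg K V) x, p (lm K _ r x) = lm K _ r (p x)) ∧
      (∀ (r : Reg K V) x, p (rm K _ r x) = rm K _ (act ρ t r) (p x)) ∧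
      (∀ x, p (I x) = lm K _ σ x) ∧
      ∀ x, lm K _ τ (I (p x) - lm K _ σ x) ∈
        rsub K (∀ i, (bottSamelson ρ (l i)).carrier) (pointIdeal K a) := by
  classical
  have hX : ∀ i, ∃ (ι : Type) (_ : Fintype ι) (w : ι → List W)
      (I : ∀ k, (bottSamelson ρ (w k)).carrier →+ (bottSamelson ρ (l i)).carrier)
      (p : ∀ k, (bottSamelson ρ (l i)).carrier →+ (bottSamelson ρ (w k)).carrier)
      (σ τ : Reg K V),
      (∀ k, ∀ s ∈ w k, s ∈ S') ∧ evalAt K (ρ t a) σ ≠ 0 ∧ evalAt K (ρ t a) τ ≠ 0 ∧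
      (∀ k (r : Reg K V) x, I k (lm K _ r x) = lm K _ r (I k x)) ∧
      (∀ k (r : Reg K V) x, I k (rm K _ r x) = rm K _ (act ρ t⁻¹ r) (I k x)) ∧
      (∀ k (r : Reg K V) x, p k (lm K _ r x) = lm K _ r (p k x)) ∧
      (∀ k (r : Reg K V) x, p k (rm K _ r x) = rm K _ (act ρ t r) (p k x)) ∧
      (∀ k x, p k (I k x) = lm K _ σ x) ∧ (∀ k j, k ≠ j → ∀ x, p k (I j x) = 0) ∧
      ∀ x, lm K _ τ (∑ k, I k (p k x) - lm K _ σ x) ∈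
        rsub K (bottSamelson ρ (l i)).carrier (pointIdeal K a) := fun i => by
    obtain ⟨Y⟩ := X i
    obtain @⟨ι, hι, obj, incl, proj, σ, τ, hw, h1, h2, h3, h4, h5, h6, h7, h8, h9⟩ := Y
    choose w hw hobj using hw
    obtain rfl : obj = fun k => bottSamelson ρ (w k) := funext hobj
    exact ⟨ι, hι, w, incl, proj, σ, τ, hw, h1, h2, h3, h4, h5, h6, h7, h8, h9⟩
  choose ι hι w I p σ τ hw hσ hτ hIl hIr hpl hpr hpI hpI0 hIp using hX
  let e := Fintype.equivFin (Σ i, ι i)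
  -- the functions `σ i` are replaced by their product, which multiplies `p` by the cofactors
  let cof : Fin n → Reg K V := fun i => ∏ j ∈ Finset.univ.erase i, σ j
  have hcof : ∀ i, cof i * σ i = ∏ j, σ j := fun i => Finset.prod_erase_mul _ _ (Finset.mem_univ i)
  let I' : (∀ j, (bottSamelson ρ (w (e.symm j).1 (e.symm j).2)).carrier) →+
      ∀ i, (bottSamelson ρ (l i)).carrier :=
    ∑ j, (AddMonoidHom.single (fun i => (bottSamelson ρ (l i)).carrier) (e.symm j).1).comp
      ((I (e.symm j).1 (e.symm j).2).comp (Pi.evalAddMonoidHom _ j))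
  let p' : (∀ i, (bottSamelson ρ (l i)).carrier) →+
      ∀ j, (bottSamelson ρ (w (e.symm j).1 (e.symm j).2)).carrier :=
    AddMonoidHom.pi fun j => (lm K _ (cof (e.symm j).1)).toAddMonoidHom.comp
      ((p (e.symm j).1 (e.symm j).2).comp (Pi.evalAddMonoidHom _ (e.symm j).1))
  have hI' : ∀ x, I' x = ∑ j, Pi.single (e.symm j).1 (I (e.symm j).1 (e.symm j).2 (x j)) :=
      fun x => by
    simp only [I', AddMonoidHom.finsetSum_apply]; rfl
  have hp' : ∀ x j, p' x j =
      lm K _ (cof (e.symm j).1) (p (e.symm j).1 (e.symm j).2 (x (e.symm j).1)) :=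
    fun _ _ => rfl
  have hsl : ∀ i (r : Reg K V) x, (Pi.single i (lm K (bottSamelson ρ (l i)).carrier r x) :
      ∀ i, (bottSamelson ρ (l i)).carrier) = lm K _ r (Pi.single i x) := fun i r x =>
    map_lm (LinearMap.single (Reg K V ⊗[K] Reg K V) (fun i => (bottSamelson ρ (l i)).carrier) i) r x
  have hsr : ∀ i (r : Reg K V) x, (Pi.single i (rm K (bottSamelson ρ (l i)).carrier r x) :
      ∀ i, (bottSamelson ρ (l i)).carrier) = rm K _ r (Pi.single i x) := fun i r x =>
    map_rm (LinearMap.single (Reg K V ⊗[K] Reg K V) (fun i => (bottSamelson ρ (l i)).carrier) i) r x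
  refine ⟨_, fun j => w (e.symm j).1 (e.symm j).2, I', p', ∏ i, σ i, ∏ i, τ i, fun j => hw _ _,
    ?_, ?_, fun r x => ?_, fun r x => ?_, fun r x => ?_, fun r x => ?_, fun x => ?_, fun x => ?_⟩
  · rw [map_prod]; exact Finset.prod_ne_zero_iff.2 fun i _ => hσ i
  · rw [map_prod]; exact Finset.prod_ne_zero_iff.2 fun i _ => hτ i
  · rw [hI', hI', map_sum]
    refine Finset.sum_congr rfl fun j _ => ?_
    rw [← hsl, ← hIl]; rfl
  · rw [hI', hI', map_sum]
    refine Finset.sum_congr rfl fun j _ => ?_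
    rw [← hsr, ← hIr]; rfl
  · funext j
    change _ = lm K _ r (p' x j)
    rw [hp', hp']
    exact (congrArg (lm K _ (cof _)) (hpl _ _ r _)).trans (lm_lm_comm _ _ _)
  · funext j
    change _ = rm K _ (act ρ t r) (p' x j)
    rw [hp', hp']
    exact (congrArg (lm K _ (cof _)) (hpr _ _ r _)).trans (lm_rm_comm _ _ _)
  · funext j
    change p' (I' x) j =
      lm K (bottSamelson ρ (w (e.symm j).1 (e.symm j).2)).carrier (∏ i, σ i) (x j)
    rw [hp', hI', Finset.sum_apply, map_sum, Finset.sum_eq_single j, Pi.single_eq_same, hpI,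
      ← lm_mul_apply, hcof]
    · intro j' _ hj
      have key : ∀ b c : Σ i, ι i, b ≠ c → ∀ y, p b.1 b.2
          ((Pi.single c.1 (I c.1 c.2 y) : ∀ i, (bottSamelson ρ (l i)).carrier) b.1) = 0 := by
        rintro ⟨i, k⟩ ⟨i', k'⟩ hne y
        by_cases hi : i = i'
        · subst hi
          change p i k ((Pi.single i (I i k' y) : ∀ i, (bottSamelson ρ (l i)).carrier) i) = 0
          rw [Pi.single_eq_same]
          exact hpI0 i k k' (fun h => hne (by rw [h])) y
        · change p i k ((Pi.single i' (I i' k' y) : ∀ i, (bottSamelson ρ (l i)).carrier) i) = 0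
          rw [Pi.single_eq_of_ne hi, map_zero]
      exact key _ _ (fun h => hj (e.symm.injective h).symm) _
    · intro h; exact (h (Finset.mem_univ j)).elim
  · refine mem_rsub_pi.2 fun i => ?_
    change lm K _ (∏ i, τ i) (I' (p' x) i - lm K _ (∏ i, σ i) (x i)) ∈ _
    have h1 : I' (p' x) i = lm K _ (cof i) (∑ k, I i k (p i k (x i))) := by
      have h3 : I' (p' x) = ∑ b : Σ i, ι i,
          Pi.single b.1 (I b.1 b.2 (lm K _ (cof b.1) (p b.1 b.2 (x b.1)))) := by
        rw [hI']
        exact e.symm.sum_comp fun b : Σ i, ι i =>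
          (Pi.single b.1 (I b.1 b.2 (lm K _ (cof b.1) (p b.1 b.2 (x b.1)))) :
          ∀ i, (bottSamelson ρ (l i)).carrier)
      rw [h3, Fintype.sum_sigma, Finset.sum_apply, Finset.sum_eq_single i, Finset.sum_apply,
        map_sum]
      · refine Finset.sum_congr rfl fun k _ => ?_
        rw [Pi.single_eq_same, hIl]
      · intro i' _ hi
        rw [Finset.sum_apply]
        exact Finset.sum_eq_zero fun k _ => Pi.single_eq_of_ne hi.symm _
      · intro h; exact (h (Finset.mem_univ i)).elim
    rw [h1, ← hcof, lm_mul_apply, ← map_sub, ← Finset.prod_erase_mul _ _ (Finset.mem_univ i),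
      lm_mul_apply, lm_lm_comm (τ i)]
    exact lm_mem_rsub _ (lm_mem_rsub _ (hIp i (x i)))

end LocalForm

section LocalForm

variable {K : Type u} {V : Type v} [Field K] [AddCommGroup V] [Module K V]
variable {W : Type*} [Group W] {ρ : Representation K W V}

/-- The specialisation at `q` of a direct sum of Bott–Samelson bimodules of words in reflections
fixing `q` is supported at `q`. -/
theorem exists_pow_lm_mem_rsub [NeZero (2 : K)] {q : V} {m : ℕ} (w : Fin m → List W)
    (hw : ∀ j, ∀ s ∈ w j, s * s = 1 ∧ ρ s q = q) :
    ∃ N : ℕ, ∀ f ∈ pointIdeal K q ^ N, ∀ x : ∀ j, (bottSamelson ρ (w j)).carrier,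
      lm K _ f x ∈ rsub K (∀ j, (bottSamelson ρ (w j)).carrier) (pointIdeal K q) := by
  have h1 : ∀ j, ∃ N : ℕ, ∀ f ∈ pointIdeal K q ^ N, ∀ x : (bottSamelson ρ (w j)).carrier,
      lm K _ f x ∈ rsub K (bottSamelson ρ (w j)).carrier (pointIdeal K q) := fun j => by
    obtain ⟨F, hF, N, hN⟩ := exists_finset_support (ρ := ρ) (w j) (fun s hs => (hw j s hs).1) q
      {q} rfl (fun s hs p hp => by rw [Set.mem_singleton_iff.1 hp]; exact (hw j s hs).2)
    refine ⟨N, fun f hf x => hN f (Ideal.pow_right_mono ?_ N hf) x⟩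
    have : F ⊆ {q} := fun p hp => by simpa using hF hp
    rcases Finset.subset_singleton_iff.1 this with h | h
    · rw [h, Finset.prod_empty, Ideal.one_eq_top]; exact le_top
    · rw [h, Finset.prod_singleton]
  choose N hN using h1
  refine ⟨Finset.univ.sup N, fun f hf x => mem_rsub_pi.2 fun j => ?_⟩
  exact hN j f (Ideal.pow_le_pow_right (Finset.le_sup (Finset.mem_univ j)) hf) (x j)

/-- Let `B` be a direct summand of `M`, and suppose that `M` splits near `(q, a)`, through `I` and
`p`, with the graded bimodule `M'`. Then the part of the specialisation of `B` at `a` which is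
supported at `q` is the specialisation at `q` of a graded direct summand `range F` of `M'`. -/
theorem exists_range_equiv [CharZero K] {a q : V} {M M' B : Type*} [AddCommGroup M]
    [Module (Reg K V ⊗[K] Reg K V) M] [AddCommGroup M'] [Module (Reg K V ⊗[K] Reg K V) M']
    [AddCommGroup B] [Module (Reg K V ⊗[K] Reg K V) B] (D : GradingDatum K q M')
    {N : ℕ} (hN : ∀ f ∈ pointIdeal K q ^ N, ∀ x : M', lm K M' f x ∈ rsub K M' (pointIdeal K q))
    (I : M' →+ M) (p : M →+ M') {σ τ : Reg K V} {φ ψ : Reg K V → Reg K V}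
    (hσ : evalAt K q σ ≠ 0) (hτ : evalAt K q τ ≠ 0)
    (hIl : ∀ (r : Reg K V) x, I (lm K _ r x) = lm K _ r (I x))
    (hIr : ∀ (r : Reg K V) x, I (rm K _ r x) = rm K _ (ψ r) (I x))
    (hpl : ∀ (r : Reg K V) x, p (lm K _ r x) = lm K _ r (p x))
    (hpr : ∀ (r : Reg K V) x, p (rm K _ r x) = rm K _ (φ r) (p x))
    (hφψ : ∀ r, φ (ψ r) = r) (hφ : ∀ r ∈ pointIdeal K a, φ r ∈ pointIdeal K q)
    (hψ : ∀ r ∈ pointIdeal K q, ψ r ∈ pointIdeal K a)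
    (hpI : ∀ x, p (I x) = lm K _ σ x)
    (hIp : ∀ x, lm K _ τ (I (p x) - lm K _ σ x) ∈ rsub K M (pointIdeal K a))
    (ι : B →ₗ[Reg K V ⊗[K] Reg K V] M) (π : M →ₗ[Reg K V ⊗[K] Reg K V] B)
    (hπι : ∀ b, π (ι b) = b) :
    ∃ F : Module.End (Reg K V ⊗[K] Reg K V) M', (∀ x, F (F x) = F x) ∧
      (∀ d, ∀ x ∈ D.piece d, F x ∈ D.piece d) ∧
      Nonempty (supportedAt K q (SpecialisationAt K a B) ≃ₗ[Reg K V]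
        SpecialisationAt K q (LinearMap.range F)) := by
  obtain ⟨σ', hσ'⟩ := exists_mul_sub_one_mem_pow hσ (N + 1)
  obtain ⟨τ', hτ'⟩ := exists_mul_sub_one_mem_pow hτ (N + 1)
  have hsplit : ∀ {f g : Reg K V}, f * g - 1 ∈ pointIdeal K q ^ (N + 1) → ∀ x : M',
      lm K _ (f * g) x - x ∈ rsub K M' (pointIdeal K q) := fun {f g} h x => by
    have := hN _ (Ideal.pow_le_pow_right N.le_succ h) x
    rwa [map_sub, map_one] at this
  -- maps which descend to the specialisations
  have hI : ∀ x ∈ rsub K M' (pointIdeal K q), I x ∈ rsub K M (pointIdeal K a) :=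
    fun x hx => map_mem_rsub_of_twist I ψ hIr hψ hx
  have hp : ∀ x ∈ rsub K M (pointIdeal K a), p x ∈ rsub K M' (pointIdeal K q) :=
    fun x hx => map_mem_rsub_of_twist p φ hpr hφ hx
  let I' : M' →+ M := I.comp (lm K M' σ').toAddMonoidHom
  have hI'def : ∀ x, I' x = lm K _ σ' (I x) := fun x => hIl σ' x
  have hI'l : ∀ (r : Reg K V) x, I' (lm K _ r x) = lm K _ r (I' x) := fun r x => by
    rw [hI'def, hI'def, hIl, lm_lm_comm]
  have hI'r : ∀ (r : Reg K V) x, I' (rm K _ r x) = rm K _ (ψ r) (I' x) := fun r x => by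
    rw [hI'def, hI'def, hIr, lm_rm_comm]
  have hI' : ∀ x ∈ rsub K M' (pointIdeal K q), I' x ∈ rsub K M (pointIdeal K a) :=
    fun x hx => map_mem_rsub_of_twist I' ψ hI'r hψ hx
  -- `I' p` is the identity as seen from `q`
  have hpIp : ∀ y, p (I' (p y)) - p y ∈ rsub K M' (pointIdeal K q) := fun y => by
    rw [hI'def, hpl, hpI, ← lm_mul_apply, mul_comm]
    exact hsplit hσ' _
  have hpep : ∀ e : M →ₗ[Reg K V ⊗[K] Reg K V] M, ∀ y,
      p (e (I' (p y))) - p (e y) ∈ rsub K M' (pointIdeal K q) := fun e y => by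
    have h1 : lm K _ τ (p (e (I (p y))) - lm K _ σ (p (e y))) ∈ rsub K M' (pointIdeal K q) := by
      have := hp _ (map_mem_rsub e (hIp y))
      rwa [map_lm, hpl, map_sub, map_sub, map_lm, hpl] at this
    have h2 : p (e (I (p y))) - lm K _ σ (p (e y)) ∈ rsub K M' (pointIdeal K q) := by
      have h3 := lm_mem_rsub τ' h1
      rw [← lm_mul_apply, mul_comm] at h3
      simpa using sub_mem h3 (hsplit hτ' (p (e (I (p y))) - lm K _ σ (p (e y))))
    have h4 := add_mem (lm_mem_rsub σ' h2) (hsplit hσ' (p (e y)))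
    rw [hI'def, map_lm, hpl]
    convert h4 using 1
    rw [map_sub, ← lm_mul_apply, mul_comm σ']
    abel
  -- the idempotent `e` with image `B` becomes the endomorphism `X` of `M'`, idempotent modulo
  -- `M' 𝔪_q`
  let e : M →ₗ[Reg K V ⊗[K] Reg K V] M := ι ∘ₗ π
  have he : ∀ x, e x = ι (π x) := fun _ => rfl
  have hee : ∀ x, e (e x) = e x := fun x => by rw [he, he, hπι]
  let X : Module.End (Reg K V ⊗[K] Reg K V) M' :=
    ofLmRm (p.comp (e.toAddMonoidHom.comp I')) (fun r x => by
      change p (e (I' (lm K _ r x))) = lm K _ r (p (e (I' x)))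
      rw [hI'l, map_lm, hpl]) (fun r x => by
      change p (e (I' (rm K _ r x))) = rm K _ r (p (e (I' x)))
      rw [hI'r, map_rm, hpr, hφψ])
  have hX : ∀ x, X x = p (e (I' x)) := fun _ => rfl
  have hXX : ∀ x, X (X x) - X x ∈ rsub K M' (pointIdeal K q) := fun x => by
    have := hpep e (e (I' x))
    rwa [hee] at this
  obtain ⟨F, P, Q, hFF, hFD, hQP, hPQ⟩ := D.exists_idempotent X hXX
  refine ⟨F, hFF, hFD, ?_⟩
  let C := LinearMap.range F
  have hFC : ∀ c : C, F c = c := by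
    rintro ⟨_, y, rfl⟩
    exact hFF y
  have hrC : ∀ c : C, (c : M') ∈ rsub K M' (pointIdeal K q) → c ∈ rsub K C (pointIdeal K q) :=
    fun c hc => by
      have h1 : F.rangeRestrict c = c := Subtype.ext (hFC c)
      rw [← h1]
      exact map_mem_rsub F.rangeRestrict hc
  -- `c ↦ π (I' (Q c))` induces the isomorphism of the specialisations
  let f : C →+ B := π.toAddMonoidHom.comp (I'.comp (Q.toAddMonoidHom.comp C.subtype.toAddMonoidHom))
  have hf : ∀ c, f c = π (I' (Q (c : M'))) := fun _ => rfl
  have hfl : ∀ (r : Reg K V) c, f (lm K C r c) = lm K B r (f c) := fun r c => by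
    rw [hf, hf, ← map_lm, ← hI'l, ← map_lm]; rfl
  have hfr : ∀ (r : Reg K V) c, f (rm K C r c) = rm K B (ψ r) (f c) := fun r c => by
    rw [hf, hf, ← map_rm, ← hI'r, ← map_rm]; rfl
  let Ψ : SpecialisationAt K q C →ₗ[Reg K V] SpecialisationAt K a B :=
    spMap f hfl fun c hc => map_mem_rsub_of_twist f ψ hfr hψ hc
  have hΨ : ∀ c, Ψ (spMk K _ c) = spMk K _ (f c) := spMap_spMk _ _ _
  have hmem : ∀ z, Ψ z ∈ supportedAt K q (SpecialisationAt K a B) := by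
    intro z
    obtain ⟨c, rfl⟩ := spMk_surjective _ z
    refine mem_supportedAt.2 ⟨N, fun g hg => ?_⟩
    rw [← map_smul, ← lm_spMk, spMk_eq_zero_iff.2 (hrC _ (hN g hg c)), map_zero]
  have hinj : Function.Injective Ψ := by
    refine (injective_iff_map_eq_zero Ψ).2 fun z hz => ?_
    obtain ⟨c, rfl⟩ := spMk_surjective _ z
    rw [hΨ, spMk_eq_zero_iff] at hz
    -- `P Q P Q c` is congruent to `c`, and `X (Q c)` vanishes modulo `M' 𝔪_q`
    have h1 : X (Q c) ∈ rsub K M' (pointIdeal K q) := hp _ (map_mem_rsub ι hz)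
    have h2 := map_mem_rsub P (hQP (Q c))
    have h3 := hPQ (P (Q c))
    have h4 := map_mem_rsub F (hPQ c)
    rw [map_sub] at h2 h4
    refine spMk_eq_zero_iff.2 (hrC c ?_)
    rw [hFC, hFC] at h4
    have h5 := sub_mem (add_mem (map_mem_rsub P h1) (sub_mem h2 h3)) h4
    convert h5 using 1
    abel
  have hsurj : ∀ z ∈ supportedAt K q (SpecialisationAt K a B), ∃ y, Ψ y = z := by
    intro z hz
    obtain ⟨b, rfl⟩ := spMk_surjective _ z
    obtain ⟨k, hk⟩ := mem_supportedAt.1 hz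
    -- the endomorphism `θ` of `B` is multiplication by `σ σ'` as seen from `q`
    let θ : B → B := fun b => π (I' (p (ι b)))
    have hθ : ∀ b, lm K _ τ (θ b - lm K _ (σ * σ') b) ∈ rsub K B (pointIdeal K a) := fun b => by
      have h1 := lm_mem_rsub σ' (map_mem_rsub π (hIp (ι b)))
      rw [map_lm, lm_lm_comm, map_sub, map_lm π, hπι, map_sub, ← lm_mul_apply, mul_comm σ',
        ← map_lm, ← hI'def] at h1
      exact h1
    have hσσ : evalAt K q (σ * σ') ≠ 0 := by
      have h1 : evalAt K q (σ * σ' - 1) = 0 := Ideal.pow_le_self N.succ_ne_zero hσ'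
      rw [map_sub, map_one, sub_eq_zero] at h1
      rw [h1]
      exact one_ne_zero
    have hev : evalAt K q ((τ * (σ * σ')) * (τ * (σ * σ'))) ≠ 0 := by
      simp only [map_mul] at hσσ ⊢
      exact mul_ne_zero (mul_ne_zero hτ hσσ) (mul_ne_zero hτ hσσ)
    obtain ⟨η, hη⟩ := exists_mul_sub_one_mem_pow hev k
    have hθl : ∀ (r : Reg K V) b, θ (lm K _ r b) = lm K _ r (θ b) := fun r b => by
      change π (I' (p (ι (lm K _ r b)))) = lm K _ r (π (I' (p (ι b))))
      rw [map_lm, hpl, hI'l, map_lm]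
    have hθs : ∀ b, τ • spMk K (pointIdeal K a) (θ b) =
        (τ * (σ * σ')) • spMk K (pointIdeal K a) b := fun b => by
        have h1 := spMk_eq_zero_iff.2 (hθ b)
        rwa [map_sub, map_sub, sub_eq_zero, lm_spMk, ← lm_mul_apply, lm_spMk] at h1
    let b₁ : B := lm K B (η * (τ * τ)) b
    have hb₁ : spMk K (pointIdeal K a) (θ (θ b₁)) = spMk K (pointIdeal K a) b := by
      have h1 := hk _ hη
      rw [sub_smul, one_smul, sub_eq_zero] at h1
      rw [← h1, hθl, hθl, lm_spMk, mul_smul, mul_smul, hθs, smul_comm τ, hθs, ← mul_smul,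
        ← mul_smul, show η * (τ * (σ * σ')) * (τ * (σ * σ')) = τ * (σ * σ') * (τ * (σ * σ')) * η by ring]
    -- the preimage is the class of `F (P x)`: its image is the class of `π (I' (p (ι (θ b₁))))`, that
    -- is of `θ (θ b₁)`, since `Q F P` is congruent to `Q P Q P`, hence to `X ^ 2` and to `X`
    let x : M' := p (ι b₁)
    have h1 := map_mem_rsub Q (hPQ (P x))
    have h2 := hQP (Q (P x))
    have h3 := map_mem_rsub X (hQP x)
    rw [map_sub] at h1 h3
    have h4 : Q (F (P x)) - p (ι (θ b₁)) ∈ rsub K M' (pointIdeal K q) := by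
      have h5 := add_mem (add_mem (sub_mem h2 h1) h3) (hXX x)
      have h6 : X x = p (ι (θ b₁)) := rfl
      rw [← h6]
      convert h5 using 1
      abel
    have h7 := map_mem_rsub_of_twist (π.toAddMonoidHom.comp I') ψ (fun r x => by
      change π (I' (rm K _ r x)) = rm K _ (ψ r) (π (I' x))
      rw [hI'r, map_rm]) hψ h4
    rw [map_sub] at h7
    refine ⟨spMk K _ (F.rangeRestrict (P x)), ?_⟩
    rw [hΨ, ← hb₁, ← sub_eq_zero, ← map_sub]
    exact spMk_eq_zero_iff.2 h7
  exact ⟨(LinearEquiv.ofBijective (Ψ.codRestrict _ hmem) ⟨fun x y h => hinj (Subtype.ext_iff.1 h),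
    fun z => by
      obtain ⟨y, hy⟩ := hsurj z z.2
      exact ⟨y, Subtype.ext hy⟩⟩).symm⟩

/-- If the Bott–Samelson bimodules containing `B` as a summand split near `(t a, a)` into
Bott–Samelson bimodules for `S'`, then the part of the specialisation of `B` at `a` which is
supported at `t a` is the specialisation of a Soergel bimodule for `S'`. -/
theorem isSoergelModuleAt_of_splitting [CharZero K] {S' : Set W} {t : W} {a : V}
    (hS' : ∀ s ∈ S', (∃ α, IsReflectionAlong ρ s α) ∧ ρ s (ρ t a) = ρ t a)
    {n : ℕ} (l : Fin n → List W)
    (X : ∀ i, Nonempty (LocalSplitting ρ S' t a (bottSamelson ρ (l i))))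
    {B : Type*} [AddCommGroup B] [Module (Reg K V ⊗[K] Reg K V) B]
    (ι : B →ₗ[Reg K V ⊗[K] Reg K V] ∀ i, (bottSamelson ρ (l i)).carrier)
    (π : (∀ i, (bottSamelson ρ (l i)).carrier) →ₗ[Reg K V ⊗[K] Reg K V] B)
    (hπι : ∀ b, π (ι b) = b) :
    IsSoergelModuleAt ρ S' (ρ t a) (supportedAt K (ρ t a) (SpecialisationAt K a B)) := by
  obtain ⟨m, w, I, p, σ, τ, hw, hσ, hτ, hIl, hIr, hpl, hpr, hpI, hIp⟩ := exists_splitting_pi l X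
  have hwS := fun j s hs => hS' s (hw j s hs)
  choose D₀ hD₀ using fun j => exists_gradingDatum_bottSamelson ρ (w j) (hwS j)
  obtain ⟨D, hD⟩ := GradingDatum.exists_pi D₀
  obtain ⟨N, hN⟩ := exists_pow_lm_mem_rsub (ρ := ρ) w fun j s hs =>
    ⟨(hwS j s hs).1.choose_spec.mul_self, (hwS j s hs).2⟩
  obtain ⟨F, hFF, hFD, hiso⟩ := exists_range_equiv D hN I p hσ hτ hIl hIr hpl hpr
    (fun r => act_act_inv ρ t r) (fun r hr => act_mem_pointIdeal hr)
    (fun r hr => by simpa using act_mem_pointIdeal (ρ := ρ) (w := t⁻¹) hr) hpI hIp ι π hπι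
  refine ⟨LinearMap.range F, inferInstance, inferInstance, fun n =>
    { carrier := {c | ∀ j,
        (c : ∀ j, (bottSamelson ρ (w j)).carrier) j ∈ (bottSamelson ρ (w j)).deg n}
      add_mem' := fun hx hy j => add_mem (hx j) (hy j)
      zero_mem' := fun j => zero_mem _
      neg_mem' := fun hx j => neg_mem (hx j) }, ⟨m, w, 0, (LinearMap.range F).subtype,
      F.rangeRestrict, hw, ?_, fun n c hc j => ?_, fun n x hx j => ?_⟩, hiso⟩
  · rintro ⟨_, y, rfl⟩
    exact Subtype.ext (hFF y)
  · rw [Pi.zero_apply, add_zero]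
    exact hc j
  · simp only [Pi.zero_apply, add_zero] at hx
    change F x j ∈ _
    by_cases hn : ∃ d : ℕ, n = 2 * d
    · obtain ⟨d, rfl⟩ := hn
      rw [← hD₀]
      exact (hD d _).1 (hFD d x ((hD d x).2 fun j => by rw [hD₀]; exact hx j)) j
    · have hx0 : x = 0 := funext fun j => by
        have := hx j
        rwa [bottSamelson_deg_eq_bot ρ (w j) n (by simpa using hn)] at this
      rw [hx0, map_zero]
      exact zero_mem _

end LocalForm

/-! ### Roots and the length function -/

section Roots

variable {K : Type u} {V : Type v} [Field K] [AddCommGroup V] [Module K V]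
variable {k : Type*} [Field k] [Algebra k K]
variable {W : Type*} [Group W] {I : Type*} {M : CoxeterMatrix I} {cs : CoxeterSystem M W}
variable {ρ : Representation K W V} {α : I → Module.Dual K V}

/-- The forms `α i`, being linearly independent, have a dual family in `V`. -/
theorem exists_dual_family [FiniteDimensional K V] (hα : LinearIndependent K α) :
    ∃ ω : I → V, (∀ i, α i (ω i) = 1) ∧ ∀ i j, i ≠ j → α i (ω j) = 0 := by
  classical
  have h1 : ∀ j, ∃ f : Module.Dual K (Module.Dual K V), ∀ i, f (α i) = if i = j then 1 else 0 := by
    intro j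
    obtain ⟨g, hg⟩ := LinearMap.exists_extend ((Finsupp.lapply j) ∘ₗ hα.repr)
    refine ⟨g, fun i => ?_⟩
    have h2 := LinearMap.congr_fun hg ⟨α i, Submodule.subset_span ⟨i, rfl⟩⟩
    simp only [LinearMap.comp_apply, Submodule.subtype_apply] at h2
    rw [h2, hα.repr_eq_single i _ rfl]
    simp [Finsupp.single_apply]
  choose f hf using h1
  refine ⟨fun j => (Module.evalEquiv K V).symm (f j), fun i => ?_, fun i j hij => ?_⟩
  · simp [hf]
  · simp [hf, hij]

/-- A dual family recovers the coefficients of a linear combination of the forms `α i`. -/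
theorem sum_apply_dual_family {ω : I → V} (h1 : ∀ i, α i (ω i) = 1)
    (h2 : ∀ i j, i ≠ j → α i (ω j) = 0) (c : I →₀ k) (j : I) :
    (c.sum fun j e => algebraMap k K e • α j) (ω j) = algebraMap k K (c j) := by
  classical
  rw [Finsupp.sum, LinearMap.sum_apply, Finset.sum_eq_single j]
  · rw [LinearMap.smul_apply, h1, smul_eq_mul, mul_one]
  · intro i _ hij
    simp [h2 i j hij]
  · intro hj
    simp [Finsupp.notMem_support_iff.1 hj]

variable [LinearOrder k]

variable (cs ρ α) in
/-- `β` is a root of the reflection `r`: the pair `(r, β)` is a translate of a pair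
`(s_i, α_i)`. -/
def IsRootOf (r : W) (β : Module.Dual K V) : Prop :=
  ∃ x i, r = x⁻¹ * cs.simple i * x ∧ β = α i ∘ₗ ρ x

theorem IsReflectionAlong.conj {s : W} {β : Module.Dual K V} (h : IsReflectionAlong ρ s β) (x : W) :
    IsReflectionAlong ρ (x⁻¹ * s * x) (β ∘ₗ ρ x) := by
  obtain ⟨v, hv, hx⟩ := h.exists_eq
  refine ⟨?_, ρ x⁻¹ v, ?_, fun y => ?_⟩
  · have : x⁻¹ * s * x * (x⁻¹ * s * x) = x⁻¹ * (s * s) * x := by group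
    rw [this, h.mul_self]
    group
  · simpa using hv
  · simp [hx]

theorem IsReflectionAlong.fixes_iff [NeZero (2 : K)] {s : W} {β : Module.Dual K V}
    (h : IsReflectionAlong ρ s β) (p : V) : ρ s p = p ↔ β p = 0 := by
  obtain ⟨v, hv, hx⟩ := h.exists_eq
  rw [hx, sub_eq_self, smul_eq_zero, or_iff_left]
  rintro rfl
  rw [map_zero] at hv
  exact two_ne_zero hv.symm

namespace IsSimpleSystem

variable (hα : IsSimpleSystem cs ρ k α)
include hα

/-- The involution `s_i` fixes the hyperplane `ker (α i)`. It is not a transvection, since the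
characteristic is not two, so that it is a reflection. -/
theorem isReflectionAlong_simple (i : I) : IsReflectionAlong ρ (cs.simple i) (α i) := by
  obtain ⟨u, hu⟩ : ∃ u, α i u = 1 := by
    obtain ⟨x, hx⟩ := DFunLike.ne_iff.1 (hα.linearIndependent.ne_zero i)
    exact ⟨(α i x)⁻¹ • x, by rw [map_smul, smul_eq_mul, inv_mul_cancel₀ hx]⟩
  have hs : ∀ x, ρ (cs.simple i) x = x - α i x • (u - ρ (cs.simple i) u) := fun x => by
    have h1 := (hα.apply_eq_zero_iff i (x - α i x • u)).1 (by simp [hu])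
    rw [map_sub, map_smul, sub_eq_iff_eq_add] at h1
    rw [h1, smul_sub]
    abel
  refine ⟨cs.simple_mul_simple_self i, _, ?_, hs⟩
  set v := u - ρ (cs.simple i) u with hv
  have hv0 : v ≠ 0 := fun h0 => by
    have := (hα.apply_eq_zero_iff i u).2 (by rw [hs, h0, smul_zero, sub_zero])
    exact one_ne_zero (hu.symm.trans this)
  -- evaluate `s² = 1` at `u`
  have h2 : ρ (cs.simple i) (ρ (cs.simple i) u) = u := by
    rw [← Module.End.mul_apply, ← map_mul, cs.simple_mul_simple_self, map_one, Module.End.one_apply]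
  rw [hs (ρ _ u), hs u, hu, one_smul, map_sub, hu] at h2
  have h3 : (α i v - 2) • v = 0 := by
    rw [← sub_eq_zero] at h2
    rw [← h2]
    module
  exact sub_eq_zero.1 ((smul_eq_zero.1 h3).resolve_right hv0)

theorem isReflectionAlong {r : W} {β : Module.Dual K V} (h : IsRootOf cs ρ α r β) :
    IsReflectionAlong ρ r β := by
  obtain ⟨x, i, rfl, rfl⟩ := h
  exact (hα.isReflectionAlong_simple i).conj x

end IsSimpleSystem

namespace IsRootOf

theorem simple (i : I) : IsRootOf cs ρ α (cs.simple i) (α i) :=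
  ⟨1, i, by simp, by ext; simp⟩

theorem conj {r : W} {β : Module.Dual K V} (h : IsRootOf cs ρ α r β) (y : W) :
    IsRootOf cs ρ α (y⁻¹ * r * y) (β ∘ₗ ρ y) := by
  obtain ⟨x, i, rfl, rfl⟩ := h
  exact ⟨x * y, i, by group, by ext; simp⟩

theorem conj_inv {r : W} {β : Module.Dual K V} (h : IsRootOf cs ρ α r β) (y : W) :
    IsRootOf cs ρ α (y * r * y⁻¹) (β ∘ₗ ρ y⁻¹) := by
  simpa using h.conj y⁻¹

theorem isReflection {r : W} {β : Module.Dual K V} (h : IsRootOf cs ρ α r β) :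
    cs.IsReflection r := by
  obtain ⟨x, i, rfl, rfl⟩ := h
  exact ⟨x⁻¹, i, by simp⟩

variable (hα : IsSimpleSystem cs ρ k α)
include hα

theorem comp_self {r : W} {β : Module.Dual K V} (h : IsRootOf cs ρ α r β) : β ∘ₗ ρ r = -β :=
  LinearMap.ext fun x => (hα.isReflectionAlong h).apply x

theorem ne_zero [NeZero (2 : K)] {r : W} {β : Module.Dual K V} (h : IsRootOf cs ρ α r β) :
    β ≠ 0 := by
  obtain ⟨v, hv, -⟩ := (hα.isReflectionAlong h).exists_eq
  rintro rfl
  exact two_ne_zero hv.symm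

theorem neg {r : W} {β : Module.Dual K V} (h : IsRootOf cs ρ α r β) :
    IsRootOf cs ρ α r (-β) := by
  have h1 := h.conj r
  rwa [h.comp_self hα, h.isReflection.inv, h.isReflection.mul_self, one_mul] at h1

/-- A reflection is determined by its reflecting hyperplane: otherwise the product of two
reflections would be a transvection, whose fixed space has codimension one although it is not an
involution. -/
theorem eq_of_smul [NeZero (2 : K)] [FiniteDimensional K V] (hρ : IsReflectionFaithful cs ρ)
    {r r' : W} {β : Module.Dual K V} {c : K} (h : IsRootOf cs ρ α r β)
    (h' : IsRootOf cs ρ α r' (c • β)) : r = r' := by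
  obtain ⟨v, hv, hx⟩ := (hα.isReflectionAlong h).exists_eq
  obtain ⟨v', hv', hx'⟩ := (hα.isReflectionAlong h').exists_eq
  rw [LinearMap.smul_apply, smul_eq_mul] at hv'
  have h1 : ∀ x, ρ (r * r') x = x + β x • (v - c • v') := fun x => by
    rw [map_mul, Module.End.mul_apply, hx', hx, LinearMap.smul_apply, map_sub, map_smul,
      smul_eq_mul, smul_eq_mul]
    have : c * β x * β v' = 2 * β x := by rw [← hv']; ring
    rw [this]
    module
  have hu : β (v - c • v') = 0 := by
    rw [map_sub, map_smul, smul_eq_mul, hv, hv', sub_self]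
  have h0 : v - c • v' = 0 := by
    by_contra h0
    have hker : LinearMap.ker (ρ (r * r') - 1) = LinearMap.ker β := by
      ext x
      rw [LinearMap.mem_ker, LinearMap.mem_ker, LinearMap.sub_apply, h1, Module.End.one_apply,
        add_sub_cancel_left, smul_eq_zero, or_iff_left h0]
    have h2 := (hρ.codim_one_iff (r * r')).1 (by
      rw [hker]
      exact Module.Dual.finrank_ker_add_one_of_ne_zero (h.ne_zero hα))
    obtain ⟨x, hx0⟩ := DFunLike.ne_iff.1 (h.ne_zero hα)
    have h3 : ρ (r * r') (ρ (r * r') x) = x := by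
      rw [← Module.End.mul_apply, ← map_mul, h2.mul_self, map_one, Module.End.one_apply]
    rw [h1 x, h1, map_add, map_smul, hu, smul_zero, add_zero, add_assoc, add_eq_left, ← two_smul K,
      smul_smul] at h3
    exact (mul_ne_zero two_ne_zero hx0) ((smul_eq_zero.1 h3).resolve_right h0)
  have h4 : r * r' = 1 := hρ.faithful (LinearMap.ext fun x => by
    rw [h1, h0, smul_zero, add_zero, map_one, Module.End.one_apply])
  rw [eq_inv_of_mul_eq_one_left h4, h'.isReflection.inv]

end IsRootOf

variable (k) in
/-- `β` is a linear combination of the forms `α i` with coefficients `≥ 0` in `k`. For a root this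
means that `β` is positive. -/
def IsNonneg (α : I → Module.Dual K V) (β : Module.Dual K V) : Prop :=
  ∃ c : I →₀ k, (∀ j, 0 ≤ c j) ∧ β = c.sum fun j e => algebraMap k K e • α j

theorem IsNonneg.zero : IsNonneg k α 0 := ⟨0, fun _ => le_rfl, by simp⟩

variable [IsStrictOrderedRing k]

theorem IsNonneg.simple (i : I) : IsNonneg k α (α i) := by
  classical
  refine ⟨Finsupp.single i 1, fun j => ?_, ?_⟩
  · by_cases h : i = j <;> simp [h]
  · rw [Finsupp.sum_single_index] <;> simp

theorem IsNonneg.add {β γ : Module.Dual K V} (hβ : IsNonneg k α β) (hγ : IsNonneg k α γ) :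
    IsNonneg k α (β + γ) := by
  classical
  obtain ⟨c, hc, rfl⟩ := hβ
  obtain ⟨d, hd, rfl⟩ := hγ
  refine ⟨c + d, fun j => add_nonneg (hc j) (hd j), ?_⟩
  rw [Finsupp.sum_add_index'] <;> simp [add_smul]

theorem IsNonneg.smul {β : Module.Dual K V} (hβ : IsNonneg k α β) {e : k} (he : 0 ≤ e) :
    IsNonneg k α (algebraMap k K e • β) := by
  classical
  obtain ⟨c, hc, rfl⟩ := hβ
  refine ⟨e • c, fun j => mul_nonneg he (hc j), ?_⟩
  rw [Finsupp.sum_smul_index' (by simp), Finsupp.smul_sum]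
  simp [mul_smul]

theorem IsNonneg.sum {ι : Type*} {s : Finset ι} {β : ι → Module.Dual K V}
    (hβ : ∀ i ∈ s, IsNonneg k α (β i)) : IsNonneg k α (∑ i ∈ s, β i) :=
  Finset.sum_induction _ _ (fun _ _ => IsNonneg.add) IsNonneg.zero hβ

theorem IsNonneg.eq_zero [FiniteDimensional K V] (hα : LinearIndependent K α)
    {β : Module.Dual K V} (h : IsNonneg k α β) (h' : IsNonneg k α (-β)) : β = 0 := by
  obtain ⟨ω, h1, h2⟩ := exists_dual_family hα
  obtain ⟨c, hc, hβ⟩ := h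
  obtain ⟨d, hd, hβ'⟩ := h'
  have h0 : c = 0 := Finsupp.ext fun j => by
    have h3 := sum_apply_dual_family h1 h2 c j
    have h4 := sum_apply_dual_family h1 h2 d j
    rw [← hβ] at h3
    rw [← hβ', LinearMap.neg_apply, h3, ← map_neg] at h4
    have h5 := (algebraMap k K).injective h4
    exact le_antisymm (by have := hd j; rw [← h5] at this; exact neg_nonneg.1 this) (hc j)
  rw [hβ, h0, Finsupp.sum_zero_index]

namespace IsRootOf

variable (hα : IsSimpleSystem cs ρ k α)
include hα

theorem nonneg_or {r : W} {β : Module.Dual K V} (h : IsRootOf cs ρ α r β) :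
    IsNonneg k α β ∨ IsNonneg k α (-β) := by
  obtain ⟨x, i, rfl, rfl⟩ := h
  obtain ⟨c, hc | hc, hx⟩ := hα.same_sign x i
  · exact Or.inl ⟨c, hc, hx⟩
  · refine Or.inr ⟨-c, fun j => neg_nonneg.2 (hc j), ?_⟩
    rw [hx, Finsupp.sum_neg_index (by simp), Finsupp.sum, Finsupp.sum, ← Finset.sum_neg_distrib]
    exact Finset.sum_congr rfl fun j _ => by
      rw [map_neg (algebraMap k K)]
      exact (neg_smul (algebraMap k K (c j)) (α j)).symm

theorem exists_of_isReflection {r : W} (hr : cs.IsReflection r) :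
    ∃ β, IsRootOf cs ρ α r β ∧ IsNonneg k α β := by
  obtain ⟨x, i, rfl⟩ := hr
  have h := (IsRootOf.simple (cs := cs) (ρ := ρ) (α := α) i).conj_inv x
  rcases h.nonneg_or hα with h1 | h1
  · exact ⟨_, h, h1⟩
  · exact ⟨_, h.neg hα, h1⟩

theorem not_neg [NeZero (2 : K)] [FiniteDimensional K V] {r : W} {β : Module.Dual K V}
    (h : IsRootOf cs ρ α r β) (hβ : IsNonneg k α β) : ¬ IsNonneg k α (-β) :=
  fun h' => h.ne_zero hα (hβ.eq_zero hα.linearIndependent h')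

variable [NeZero (2 : K)] [FiniteDimensional K V] (hρ : IsReflectionFaithful cs ρ)
include hρ

/-- The simple reflection `s_i` keeps all positive roots positive, except for those of `s_i`. -/
theorem nonneg_comp_simple {r : W} {β : Module.Dual K V} (h : IsRootOf cs ρ α r β)
    (hβ : IsNonneg k α β) {i : I} (hr : r ≠ cs.simple i) :
    IsNonneg k α (β ∘ₗ ρ (cs.simple i)) := by
  obtain ⟨ω, h1, h2⟩ := exists_dual_family hα.linearIndependent
  rcases (h.conj (cs.simple i)).nonneg_or hα with h3 | ⟨d, hd, hβd⟩
  · exact h3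
  exfalso
  obtain ⟨c, hc, hβc⟩ := hβ
  have h4 : ∀ j, j ≠ i → c j = 0 := fun j hj => by
    have h5 := sum_apply_dual_family h1 h2 c j
    have h6 := sum_apply_dual_family h1 h2 d j
    rw [← hβc] at h5
    rw [← hβd, LinearMap.neg_apply, LinearMap.comp_apply,
      (hα.apply_eq_zero_iff i (ω j)).1 (h2 i j hj.symm), h5, ← map_neg] at h6
    have h7 := (algebraMap k K).injective h6
    exact le_antisymm (by have := hd j; rw [← h7] at this; exact neg_nonneg.1 this) (hc j)
  have h5 : β = algebraMap k K (c i) • α i := by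
    rw [hβc, Finsupp.sum, Finset.sum_eq_single i]
    · intro j _ hj
      rw [h4 j hj, map_zero, zero_smul]
    · intro hi
      rw [Finsupp.notMem_support_iff.1 hi, map_zero, zero_smul]
  rw [h5] at h
  exact hr (IsRootOf.eq_of_smul hα hρ (IsRootOf.simple i) h).symm

/-- Strong exchange: if the positive root `β` of `r` becomes negative under the product of a word,
then a letter of the word can be deleted to obtain a word with product multiplied by `r`. -/
theorem exists_word {r : W} {β : Module.Dual K V} (h : IsRootOf cs ρ α r β)
    (hβ : IsNonneg k α β) (l : List I) (hl : IsNonneg k α (-(β ∘ₗ ρ (cs.wordProd l)))) :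
    ∃ l' : List I, l'.length + 1 = l.length ∧ cs.wordProd l' = r * cs.wordProd l := by
  induction l generalizing r β with
  | nil =>
    refine absurd ?_ (h.not_neg hα hβ)
    convert hl using 2
    ext; simp
  | cons i l ih =>
    by_cases hr : r = cs.simple i
    · exact ⟨l, rfl, by rw [hr, cs.wordProd_cons, cs.simple_mul_simple_cancel_left]⟩
    · obtain ⟨l', hl', hr'⟩ := ih (h.conj (cs.simple i)) (h.nonneg_comp_simple hα hρ hβ hr) (by
        convert hl using 2
        rw [cs.wordProd_cons, map_mul]
        rfl)
      refine ⟨i :: l', by simp [hl'], ?_⟩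
      rw [cs.wordProd_cons, hr', cs.wordProd_cons, cs.inv_simple]
      simp [mul_assoc]

theorem length_mul_lt {r : W} {β : Module.Dual K V} (h : IsRootOf cs ρ α r β)
    (hβ : IsNonneg k α β) {x : W} (hx : IsNonneg k α (-(β ∘ₗ ρ x))) :
    cs.length (r * x) < cs.length x := by
  obtain ⟨l, hl, rfl⟩ := cs.exists_isReduced x
  obtain ⟨l', hl', hr⟩ := h.exists_word hα hρ hβ l hx
  rw [← hr, hl.eq]
  have := cs.length_wordProd_le l'
  omega

/-- Multiplication from the left by a reflection with positive root `β` makes `x` shorter exactly if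
`x⁻¹ β` is negative. -/
theorem length_mul_lt_iff {r : W} {β : Module.Dual K V} (h : IsRootOf cs ρ α r β)
    (hβ : IsNonneg k α β) {x : W} :
    cs.length (r * x) < cs.length x ↔ IsNonneg k α (-(β ∘ₗ ρ x)) := by
  refine ⟨fun hx => ?_, h.length_mul_lt hα hρ hβ⟩
  refine ((h.conj x).nonneg_or hα).resolve_left fun h1 => ?_
  have h2 := h.length_mul_lt hα hρ hβ (x := r * x) (by
    rw [map_mul, Module.End.mul_eq_comp, ← LinearMap.comp_assoc, h.comp_self hα]
    simpa using h1)
  rw [← mul_assoc, h.isReflection.mul_self, one_mul] at h2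
  omega

theorem length_mul_right_lt_iff {r : W} {β : Module.Dual K V} (h : IsRootOf cs ρ α r β)
    (hβ : IsNonneg k α β) {x : W} :
    cs.length (x * r) < cs.length x ↔ IsNonneg k α (-(β ∘ₗ ρ x⁻¹)) := by
  rw [← h.length_mul_lt_iff hα hρ hβ, ← cs.length_inv (x * r), mul_inv_rev, h.isReflection.inv,
    cs.length_inv x]

end IsRootOf

end Roots

/-! ### Stabilisers of points of the Tits cone -/

section Stabiliser

variable {K : Type u} {V : Type v} [Field K] [AddCommGroup V] [Module K V]
variable {k : Type*} [Field k] [LinearOrder k] [Algebra k K]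
variable {W : Type*} [Group W] {I : Type*} {M : CoxeterMatrix I} {cs : CoxeterSystem M W}
variable {ρ : Representation K W V} {α : I → Module.Dual K V}

theorem mem_stab {a : V} {x : W} : x ∈ stab ρ a ↔ ρ x a = a := Iff.rfl

theorem apply_inv_eq_iff {x : W} {a b : V} : ρ x⁻¹ a = b ↔ ρ x b = a := by
  constructor <;> rintro rfl <;> simp

variable (k cs ρ α) in
/-- `t` sends the positive roots vanishing at `a` to positive roots. -/
def PreservesPos (a : V) (t : W) : Prop :=
  ∀ r β, IsRootOf cs ρ α r β → β a = 0 → IsNonneg k α β → IsNonneg k α (β ∘ₗ ρ t⁻¹)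

theorem comp_apply_eq_zero {β : Module.Dual K V} {t : W} {a d : V} (h : ρ t d = a) (hβ : β d = 0) :
    (β ∘ₗ ρ t⁻¹) a = 0 := by
  rw [LinearMap.comp_apply, apply_inv_eq_iff.2 h, hβ]

theorem exists_minimalReps (a : V) (x : W) : ∃ y ∈ stab ρ a, x * y ∈ minimalReps cs ρ a := by
  obtain ⟨y, hy, hmin⟩ := WellFounded.has_min (measure fun y => cs.length (x * y)).wf
    {y | y ∈ stab ρ a} ⟨1, one_mem (stab ρ a)⟩
  refine ⟨y, hy, fun z hz => ?_⟩
  have := hmin (y * z) (mul_mem hy hz)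
  rw [mul_assoc]
  exact not_lt.1 this

variable (hα : IsSimpleSystem cs ρ k α) (hρ : IsReflectionFaithful cs ρ)

include hα in
theorem PreservesPos.neg_of_neg {a : V} {t : W} (ht : PreservesPos k cs ρ α a t) {r : W}
    {β : Module.Dual K V} (h : IsRootOf cs ρ α r β) (ha : β a = 0)
    (hβ : IsNonneg k α (-β)) : IsNonneg k α (-(β ∘ₗ ρ t⁻¹)) :=
  ht r (-β) (h.neg hα) (by simp [ha]) hβ

variable [NeZero (2 : K)]

include hα in
theorem IsRootOf.mem_stab_iff {r : W} {β : Module.Dual K V} (h : IsRootOf cs ρ α r β) (a : V) :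
    r ∈ stab ρ a ↔ β a = 0 :=
  (hα.isReflectionAlong h).fixes_iff a

variable [IsStrictOrderedRing k]

variable [FiniteDimensional K V]

include hα in
theorem PreservesPos.nonneg_of_comp {a : V} {t : W} (ht : PreservesPos k cs ρ α a t) {r : W}
    {β : Module.Dual K V} (h : IsRootOf cs ρ α r β) (ha : β a = 0)
    (hβ : IsNonneg k α (β ∘ₗ ρ t⁻¹)) : IsNonneg k α β := by
  refine (h.nonneg_or hα).resolve_right fun h1 => (h.conj_inv t).not_neg hα hβ ?_
  exact ht r (-β) (h.neg hα) (by simp [ha]) h1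

include hα hρ

/-- A minimal coset representative `t` preserves positivity: `t β < 0` would mean that the
reflection in `β`, an element of the stabiliser, shortens `t` from the right. -/
theorem preservesPos_of_mem_minimalReps {a : V} {t : W} (ht : t ∈ minimalReps cs ρ a) :
    PreservesPos k cs ρ α a t := by
  intro r β h ha hβ
  refine ((h.conj_inv t).nonneg_or hα).resolve_right fun h1 => ?_
  exact (ht r ((h.mem_stab_iff hα a).2 ha)).not_gt ((h.length_mul_right_lt_iff hα hρ hβ).2 h1)

/-- A nontrivial element `z` of the stabiliser of a dominant point `d` has a right descent in this
stabiliser. -/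
theorem exists_simple_of_mem_stab {d : V} (hd : d ∈ dominantChamber k α) {z : W}
    (hz : z ∈ stab ρ d) (h1 : z ≠ 1) :
    ∃ i, α i d = 0 ∧ cs.length (z * cs.simple i) < cs.length z ∧
      IsNonneg k α (-(α i ∘ₗ ρ z⁻¹)) := by
  obtain ⟨i, hi⟩ := cs.exists_rightDescent_of_ne_one h1
  have h2 := ((IsRootOf.simple (ρ := ρ) (α := α) i).length_mul_right_lt_iff hα hρ
    (IsNonneg.simple i)).1 hi
  refine ⟨i, ?_, hi, h2⟩
  obtain ⟨c, hc, hβ⟩ := h2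
  choose e he hde using hd
  have h3 := LinearMap.congr_fun hβ d
  rw [LinearMap.neg_apply, LinearMap.comp_apply, apply_inv_eq_iff.2 hz, Finsupp.sum,
    LinearMap.sum_apply, hde i] at h3
  have h4 : -algebraMap k K (e i) = algebraMap k K (∑ j ∈ c.support, c j * e j) := by
    rw [h3, map_sum]
    exact Finset.sum_congr rfl fun j _ => by
      rw [LinearMap.smul_apply, hde j, smul_eq_mul, map_mul]
  rw [← map_neg] at h4
  have h5 := (algebraMap k K).injective h4
  have h6 : 0 ≤ ∑ j ∈ c.support, c j * e j :=
    Finset.sum_nonneg fun j _ => mul_nonneg (hc j) (he j)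
  rw [← h5, neg_nonneg] at h6
  rw [hde i, le_antisymm h6 (he i), map_zero]

/-- The stabiliser of a dominant point is generated by simple reflections. -/
theorem closure_simple_eq_stab {d : V} (hd : d ∈ dominantChamber k α) :
    Subgroup.closure (cs.simple '' {i | α i d = 0}) = stab ρ d := by
  refine le_antisymm ((Subgroup.closure_le _).2 ?_) fun z hz => ?_
  · rintro _ ⟨i, hi, rfl⟩
    exact ((IsRootOf.simple (cs := cs) (ρ := ρ) (α := α) i).mem_stab_iff hα d).2 hi
  · induction hn : cs.length z using Nat.strong_induction_on generalizing z with
    | _ n ih =>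
      by_cases h1 : z = 1
      · rw [h1]; exact one_mem _
      · obtain ⟨i, hi, hlt, -⟩ := exists_simple_of_mem_stab hα hρ hd hz h1
        have hs := ((IsRootOf.simple (cs := cs) (ρ := ρ) (α := α) i).mem_stab_iff hα d).2 hi
        have h2 := ih _ (hn ▸ hlt) _ (mul_mem hz hs) rfl
        have h3 := mul_mem h2 (Subgroup.subset_closure (Set.mem_image_of_mem cs.simple hi))
        rwa [cs.simple_mul_simple_cancel_right] at h3

/-- The identity is the only element of the stabiliser of a dominant point which preserves the
positivity of the roots vanishing there. -/
theorem eq_one_of_preservesPos {d : V} (hd : d ∈ dominantChamber k α) {z : W}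
    (hz : z ∈ stab ρ d) (hpos : PreservesPos k cs ρ α d z) : z = 1 := by
  by_contra h1
  obtain ⟨i, hi, -, hneg⟩ := exists_simple_of_mem_stab hα hρ hd hz h1
  have h2 := IsRootOf.simple (cs := cs) (ρ := ρ) (α := α) i
  exact (h2.conj_inv z).not_neg hα (hpos _ _ h2 hi (IsNonneg.simple i)) hneg

/-- A point `a` of the Tits cone is of the form `w d` for a dominant `d` and an element `w` for
which both `w` and `w⁻¹` preserve positivity of the roots concerned. -/
theorem exists_dominant {a : V} (ha : a ∈ titsCone ρ k α) : ∃ d ∈ dominantChamber k α, ∃ w,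
    ρ w d = a ∧ PreservesPos k cs ρ α d w ∧ PreservesPos k cs ρ α a w⁻¹ := by
  obtain ⟨x, d, hd, rfl⟩ := Set.mem_iUnion.1 ha
  obtain ⟨y, hy, hxy⟩ := exists_minimalReps (cs := cs) (ρ := ρ) d x
  have hP := preservesPos_of_mem_minimalReps hα hρ hxy
  have h1 : ρ (x * y) d = ρ x d := by rw [map_mul, Module.End.mul_apply, mem_stab.1 hy]
  refine ⟨d, hd, x * y, h1, hP, fun r β h ha hβ => ?_⟩
  rw [← h1] at ha
  rw [inv_inv]
  refine hP.nonneg_of_comp hα (h.conj (x * y)) ha ?_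
  rw [LinearMap.comp_assoc, ← Module.End.mul_eq_comp, ← map_mul, mul_inv_cancel, map_one]
  exact hβ

/-- An element preserving the positivity of the roots vanishing at a point `a` of the Tits cone is
determined by its value at `a`. -/
theorem eq_of_preservesPos {a : V} (ha : a ∈ titsCone ρ k α) {t t' : W}
    (ht : PreservesPos k cs ρ α a t) (ht' : PreservesPos k cs ρ α a t')
    (htt : ρ t a = ρ t' a) : t = t' := by
  obtain ⟨d, hd, w, rfl, hw, hw'⟩ := exists_dominant hα hρ ha
  have hz : ρ (w⁻¹ * (t⁻¹ * t') * w) d = d := by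
    simp only [map_mul, Module.End.mul_apply]
    rw [← htt]
    simp
  have h1 : w⁻¹ * (t⁻¹ * t') * w = 1 := by
    refine eq_one_of_preservesPos hα hρ hd hz fun r β h hβd hβ => ?_
    have e1 : ρ (t⁻¹ * t') (ρ w d) = ρ w d := by
      rw [map_mul, Module.End.mul_apply, ← htt]; simp
    have h2 := h.conj_inv w
    have h3 := ht' _ _ h2 (comp_apply_eq_zero rfl hβd) (hw _ _ h hβd hβ)
    have h4 := ht.nonneg_of_comp hα (h2.conj_inv (t⁻¹ * t'))
      (comp_apply_eq_zero e1 (comp_apply_eq_zero rfl hβd)) (by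
        convert h3 using 1
        rw [LinearMap.comp_assoc, ← Module.End.mul_eq_comp, ← map_mul]
        congr 2
        group)
    have h5 := hw' _ _ ((h2.conj_inv (t⁻¹ * t')))
      (comp_apply_eq_zero e1 (comp_apply_eq_zero rfl hβd)) h4
    convert h5 using 1
    simp only [LinearMap.comp_assoc, ← Module.End.mul_eq_comp, ← map_mul]
    congr 2
    group
  have h2 : t⁻¹ * t' = 1 := by
    have := congrArg (fun z => w * z * w⁻¹) h1
    simpa [mul_assoc] using this
  exact inv_mul_eq_one.1 h2

/-- The minimal coset representatives are the elements preserving the positivity of the roots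
vanishing at `a`. -/
theorem mem_minimalReps_iff {a : V} (ha : a ∈ titsCone ρ k α) {t : W} :
    t ∈ minimalReps cs ρ a ↔ PreservesPos k cs ρ α a t := by
  refine ⟨preservesPos_of_mem_minimalReps hα hρ, fun ht => ?_⟩
  obtain ⟨y, hy, hty⟩ := exists_minimalReps (cs := cs) (ρ := ρ) a t
  rwa [eq_of_preservesPos hα hρ ha ht (preservesPos_of_mem_minimalReps hα hρ hty)
    (by rw [map_mul, Module.End.mul_apply, mem_stab.1 hy])]

/-- A simple reflection which moves `t a` maps the minimal representative `t` to a minimal one. -/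
theorem simple_mul_mem_minimalReps {a : V} (ha : a ∈ titsCone ρ k α) {t : W}
    (ht : t ∈ minimalReps cs ρ a) {i : I} (hi : ρ (cs.simple i) (ρ t a) ≠ ρ t a) :
    cs.simple i * t ∈ minimalReps cs ρ a := by
  rw [mem_minimalReps_iff hα hρ ha] at ht ⊢
  intro r β h hβa hβ
  have h1 := (h.conj_inv t).nonneg_comp_simple hα hρ (ht r β h hβa hβ) (i := i) (by
    intro h2
    rw [← h2] at hi
    exact hi (((h.conj_inv t).mem_stab_iff hα _).2 (comp_apply_eq_zero rfl hβa)))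
  rw [mul_inv_rev, cs.inv_simple, map_mul]
  exact h1

/-- A simple reflection which fixes `t a` is conjugate by `t` to a simple reflection of the
stabiliser of `a`. -/
theorem conj_simple_mem_stabSimple {a : V} {t : W} (ht : PreservesPos k cs ρ α a t) {i : I}
    (hi : ρ (cs.simple i) (ρ t a) = ρ t a) : t⁻¹ * cs.simple i * t ∈ stabSimple cs ρ a := by
  have h := IsRootOf.simple (cs := cs) (ρ := ρ) (α := α) i
  have h' := h.conj t
  have hia : (α i ∘ₗ ρ t) a = 0 := (h.mem_stab_iff hα _).1 hi
  refine ⟨h'.isReflection, (h'.mem_stab_iff hα a).2 hia, fun r hr hra hlt => ?_⟩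
  obtain ⟨γ, hγ, hγpos⟩ := IsRootOf.exists_of_isReflection hα hr
  have hγa := (hγ.mem_stab_iff hα a).1 hra
  by_contra hne
  have hne' : t * r * t⁻¹ ≠ cs.simple i := fun h2 => hne (by rw [← h2]; group)
  have h2 := (hγ.conj_inv t).nonneg_comp_simple hα hρ (ht _ _ hγ hγa hγpos) hne'
  have h3 := (hγ.length_mul_lt_iff hα hρ hγpos).1 hlt
  have h4 := ht.neg_of_neg hα (hγ.conj _) (by
    rw [LinearMap.comp_apply, mem_stab.1 ((h'.mem_stab_iff hα a).2 hia), hγa]) h3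
  refine ((hγ.conj_inv t).conj (cs.simple i)).not_neg hα h2 ?_
  convert h4 using 2
  simp only [LinearMap.comp_assoc, ← Module.End.mul_eq_comp, ← map_mul]
  congr 2
  group

/-- The simple reflections of the stabiliser of `w d`, for a dominant point `d`, are the conjugates
of the simple reflections fixing `d`. -/
theorem stabSimple_eq {d : V} (hd : d ∈ dominantChamber k α) {w : W}
    (hw : PreservesPos k cs ρ α d w) (hw' : PreservesPos k cs ρ α (ρ w d) w⁻¹) :
    stabSimple cs ρ (ρ w d) = (fun r => w * r * w⁻¹) '' (cs.simple '' {i | α i d = 0}) := by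
  have hwi : ρ w⁻¹ (ρ w d) = d := by simp
  ext r
  constructor
  · rintro ⟨hr, hra, hmin⟩
    have hz : w⁻¹ * r * w ∈ stab ρ d := by
      rw [mem_stab, map_mul, map_mul, Module.End.mul_apply, Module.End.mul_apply, mem_stab.1 hra,
        hwi]
    have hz1 : w⁻¹ * r * w ≠ 1 := fun h1 => by
      have h2 : r = 1 := by
        have := congrArg (fun z => w * z * w⁻¹) h1
        simpa [mul_assoc] using this
      have := hr.odd_length
      rw [h2, cs.length_one] at this
      simp at this
    obtain ⟨i, hi, -, hneg⟩ := exists_simple_of_mem_stab hα hρ hd hz hz1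
    have h := IsRootOf.simple (cs := cs) (ρ := ρ) (α := α) i
    have h0 : (α i ∘ₗ ρ w⁻¹) (ρ w d) = 0 := comp_apply_eq_zero rfl hi
    refine ⟨_, ⟨i, hi, rfl⟩, hmin _ (h.conj_inv w).isReflection
      (((h.conj_inv w).mem_stab_iff hα _).2 h0) ?_⟩
    refine ((h.conj_inv w).length_mul_lt_iff hα hρ (hw _ _ h hi (IsNonneg.simple i))).2 ?_
    have h2 := hw.neg_of_neg hα (h.conj_inv (w⁻¹ * r * w)) (comp_apply_eq_zero hz hi) hneg
    convert h2 using 2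
    simp only [LinearMap.comp_assoc, ← Module.End.mul_eq_comp, ← map_mul]
    congr 2
    rw [mul_inv_rev, mul_inv_rev, hr.inv]
    group
  · rintro ⟨_, ⟨i, hi, rfl⟩, rfl⟩
    have h1 := conj_simple_mem_stabSimple hα hρ hw' (i := i) (by
      rw [hwi]
      exact ((IsRootOf.simple (cs := cs) (ρ := ρ) (α := α) i).mem_stab_iff hα d).2 hi)
    rwa [inv_inv] at h1

end Stabiliser

/-! ### Coxeter systems generated by simple reflections -/

section AlternatingWords

open CoxeterSystem

/-- Two alternating words of length `n` in involutions `a` and `b`, with different last letters,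
differ by `(a b) ^ n`. -/
theorem inv_prod_alternatingWord_mul {G : Type*} [Group G] (n : ℕ) {a b : G} (ha : a * a = 1)
    (hb : b * b = 1) :
    (alternatingWord b a n).prod⁻¹ * (alternatingWord a b n).prod = (a * b) ^ n := by
  induction n generalizing a b with
  | zero => simp [alternatingWord]
  | succ n ih =>
    have h1 := ih hb ha
    have h2 : a * (b * a) ^ n * b = (a * b) ^ (n + 1) := by
      clear ih h1
      induction n with
      | zero => simp
      | succ n ih => rw [pow_succ' (a * b), ← ih, pow_succ' (b * a)]; simp only [mul_assoc]
    rw [alternatingWord_succ, alternatingWord_succ, List.concat_eq_append, List.concat_eq_append,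
      List.prod_append, List.prod_append, List.prod_singleton, List.prod_singleton, mul_inv_rev,
      inv_eq_of_mul_eq_one_left ha, ← h2, ← h1]
    simp only [mul_assoc]

theorem map_alternatingWord {A B : Type*} (f : A → B) (i j : A) (n : ℕ) :
    (alternatingWord i j n).map f = alternatingWord (f i) (f j) n := by
  induction n generalizing i j with
  | zero => simp [alternatingWord]
  | succ n ih => simp [alternatingWord_succ, ih]

/-- An element `y` without right descent `i` is a product of an element without right descents `i`
and `j` and an alternating word in `i` and `j` ending in `j`, whose lengths add up. -/
theorem exists_eq_mul_alternatingWord {J : Type*} {N : CoxeterMatrix J} {G : Type*} [Group G]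
    (cs : CoxeterSystem N G) (y : G) (i j : J) (hi : ¬ cs.IsRightDescent y i) :
    ∃ (u : G) (n : ℕ), y = u * cs.wordProd (alternatingWord i j n) ∧
      cs.length y = cs.length u + n ∧ ¬ cs.IsRightDescent u i ∧ ¬ cs.IsRightDescent u j := by
  induction hn : cs.length y using Nat.strong_induction_on generalizing y i j with
  | _ m ih =>
    by_cases hj : cs.IsRightDescent y j
    · have h1 := cs.isRightDescent_iff.1 hj
      obtain ⟨u, n, hy, hl, hu, hu'⟩ := ih _ (hn ▸ hj) (y * cs.simple j) j i
        (cs.isRightDescent_iff_not_isRightDescent_mul.1 hj) rfl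
      refine ⟨u, n + 1, ?_, by omega, hu', hu⟩
      rw [alternatingWord_succ, cs.wordProd_concat, ← mul_assoc, ← hy,
        cs.simple_mul_simple_cancel_right]
    · exact ⟨y, 0, by simp [alternatingWord], by omega, hi, hj⟩

end AlternatingWords

section Parabolic

variable {K : Type u} {V : Type v} [Field K] [AddCommGroup V] [Module K V]
variable {k : Type*} [Field k] [LinearOrder k] [Algebra k K]
variable {W : Type*} [Group W] {I : Type*} {M : CoxeterMatrix I} {cs : CoxeterSystem M W}
variable {ρ : Representation K W V} {α : I → Module.Dual K V}

open CoxeterSystem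

/-- The Coxeter matrix of a set of involutions in a group. -/
def orderMatrix (S : Set W) (hS : ∀ s ∈ S, s * s = 1) : CoxeterMatrix S where
  M := Matrix.of fun s t => orderOf ((s : W) * t)
  isSymm := by
    ext s t
    have h : (s : W) * t = ((t : W) * s)⁻¹ := by
      rw [mul_inv_rev, inv_eq_of_mul_eq_one_left (hS s s.2), inv_eq_of_mul_eq_one_left (hS t t.2)]
    simp only [Matrix.transpose_apply, Matrix.of_apply]
    rw [h, orderOf_inv]
  diagonal s := by simp [hS s s.2]
  off_diagonal s t hst h := by
    rw [Matrix.of_apply, orderOf_eq_one_iff] at h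
    refine hst (Subtype.ext ?_)
    rw [eq_inv_of_mul_eq_one_left h, inv_eq_of_mul_eq_one_left (hS t t.2)]

theorem IsCoxeterPair.conj {H : Subgroup W} {S : Set W} (h : IsCoxeterPair H S) (g : W) :
    IsCoxeterPair (H.map (MulAut.conj g).toMonoidHom) ((fun r => g * r * g⁻¹) '' S) := by
  obtain ⟨N, cs', hcs⟩ := h
  let e : S ≃ ((fun r => g * r * g⁻¹) '' S : Set W) :=
    Equiv.Set.image _ S (fun x y hxy => by simpa using hxy)
  refine ⟨N.reindex e, (cs'.reindex e).map
    (H.equivMapOfInjective _ (MulAut.conj g).injective), fun s => ?_⟩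
  obtain ⟨s, rfl⟩ := e.surjective s
  rw [CoxeterSystem.map_simple, CoxeterSystem.reindex_simple, e.symm_apply_apply]
  change g * (cs'.simple s : W) * g⁻¹ = _
  rw [hcs]
  rfl

theorem stab_apply_eq_map (w : W) (d : V) :
    stab ρ (ρ w d) = (stab ρ d).map (MulAut.conj w).toMonoidHom := by
  ext x
  rw [Subgroup.mem_map_equiv]
  change ρ x (ρ w d) = ρ w d ↔ ρ _ d = d
  rw [MulAut.conj_symm_apply, map_mul, map_mul, Module.End.mul_apply, Module.End.mul_apply,
    apply_inv_eq_iff, eq_comm]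

variable [IsStrictOrderedRing k] [NeZero (2 : K)] [FiniteDimensional K V]
variable (hα : IsSimpleSystem cs ρ k α) (hρ : IsReflectionFaithful cs ρ)
include hα hρ

/-- A word in `s_i` and `s_j` which alternates, ends in `s_j` and is shorter than the order of
`s_i s_j` keeps the root `α i` positive: the first letter under which the root becomes negative
would give a relation of the form `(s_i s_j) ^ m = 1`. -/
theorem nonneg_comp_alternatingWord {i j : I} {n : ℕ}
    (hn : ∀ m, 0 < m → m ≤ n → (cs.simple i * cs.simple j) ^ m ≠ 1) :
    IsNonneg k α (α i ∘ₗ ρ (cs.wordProd (alternatingWord i j n))⁻¹) := by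
  induction n with
  | zero =>
    have h0 := IsNonneg.simple (k := k) (α := α) i
    convert h0 using 1
    ext
    simp [alternatingWord]
  | succ n ih =>
    have h1 := ih fun m h0 h => hn m h0 (h.trans n.le_succ)
    set v := cs.wordProd (alternatingWord i j n) with hv
    have h2 := (IsRootOf.simple (cs := cs) (ρ := ρ) (α := α) i).conj_inv v
    have h3 : cs.wordProd (alternatingWord i j (n + 1)) =
        cs.simple (if Even n then j else i) * v := by
      rw [alternatingWord_succ', cs.wordProd_cons]
    have h4 := h2.nonneg_comp_simple hα hρ h1 (i := if Even n then j else i) fun h5 => by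
      have h6 : cs.wordProd (alternatingWord i j (n + 1)) =
          cs.wordProd (alternatingWord j i (n + 1)) := by
        rw [h3, ← h5, alternatingWord_succ, cs.wordProd_concat, ← hv]
        group
      refine hn (n + 1) n.succ_pos le_rfl ?_
      rw [← inv_prod_alternatingWord_mul (n + 1) (cs.simple_mul_simple_self i)
        (cs.simple_mul_simple_self j), inv_mul_eq_one, ← map_alternatingWord, ← map_alternatingWord]
      exact h6.symm
    rw [h3, mul_inv_rev, cs.inv_simple, map_mul]
    exact h4

/-- The same positivity for a product `u v`, where `v` is the alternating word and `u` keeps `α i`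
and `α j` positive: the root `v α_i` is a linear combination of `α i` and `α j` only. -/
theorem nonneg_comp_mul_alternatingWord {i j : I} {n : ℕ}
    (hn : ∀ m, 0 < m → m ≤ n → (cs.simple i * cs.simple j) ^ m ≠ 1) {u : W}
    (hi : IsNonneg k α (α i ∘ₗ ρ u⁻¹)) (hj : IsNonneg k α (α j ∘ₗ ρ u⁻¹)) :
    IsNonneg k α (α i ∘ₗ ρ (u * cs.wordProd (alternatingWord i j n))⁻¹) := by
  obtain ⟨ω, h1, h2⟩ := exists_dual_family hα.linearIndependent
  obtain ⟨c, hc, h3⟩ := nonneg_comp_alternatingWord hα hρ hn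
  have hc0 : ∀ l, l ≠ i → l ≠ j → c l = 0 := fun l hli hlj => by
    have h4 := sum_apply_dual_family h1 h2 c l
    have h5 : ∀ n, ∀ i j, l ≠ i → l ≠ j →
        ρ (cs.wordProd (alternatingWord i j n)) (ω l) = ω l := fun n => by
      induction n with
      | zero => simp [alternatingWord]
      | succ n ih =>
        intro i j hi hj
        rw [alternatingWord_succ, cs.wordProd_concat, map_mul, Module.End.mul_apply,
          (hα.apply_eq_zero_iff j _).1 (h2 j l hj.symm), ih j i hj hi]
    rw [← h3, LinearMap.comp_apply, apply_inv_eq_iff.2 (h5 n i j hli hlj), h2 i l hli.symm] at h4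
    exact (algebraMap k K).injective (by rw [← h4, map_zero])
  have h4 : α i ∘ₗ ρ (u * cs.wordProd (alternatingWord i j n))⁻¹ =
      ∑ l ∈ c.support, algebraMap k K (c l) • (α l ∘ₗ ρ u⁻¹) := by
    rw [mul_inv_rev, map_mul, Module.End.mul_eq_comp, ← LinearMap.comp_assoc, h3]
    ext x
    simp [Finsupp.sum, LinearMap.sum_apply]
  rw [h4]
  refine IsNonneg.sum fun l hl => IsNonneg.smul ?_ (hc l)
  by_cases hli : l = i
  · rwa [hli]
  by_cases hlj : l = j
  · rwa [hlj]
  exact absurd (hc0 l hli hlj) (Finsupp.mem_support_iff.1 hl)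

/-- A set of simple reflections and the subgroup generated by it are a Coxeter system. The lengths
in the abstract Coxeter group of the matrix of orders govern the positivity of roots, so that its
map to `W` is injective. -/
theorem isCoxeterPair_closure (J : Set I) :
    IsCoxeterPair (Subgroup.closure (cs.simple '' J)) (cs.simple '' J) := by
  set S := cs.simple '' J
  have hS : ∀ s ∈ S, s * s = 1 := by
    rintro _ ⟨i, -, rfl⟩
    exact cs.simple_mul_simple_self i
  have hix : ∀ s : S, ∃ i, cs.simple i = s := fun s => by
    obtain ⟨_, i, -, rfl⟩ := s
    exact ⟨i, rfl⟩
  choose ix hix using hix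
  let N := orderMatrix S hS
  let csG := N.toCoxeterSystem
  have hlift : N.IsLiftable fun s : S => (s : W) := fun s t => pow_orderOf_eq_one _
  let φ : N.Group →* W := csG.lift ⟨_, hlift⟩
  have hφ : ∀ s, φ (csG.simple s) = s := fun s => csG.lift_apply_simple hlift s
  have hφw : ∀ l, φ (csG.wordProd l) = cs.wordProd (l.map ix) := fun l => by
    induction l with
    | nil => simp
    | cons s l ih => rw [csG.wordProd_cons, map_mul, hφ, ih, List.map_cons, cs.wordProd_cons, hix]
  -- if `s` does not shorten `y` from the right, then `y` keeps the root of `s` positive: split off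
  -- an alternating word in `s` and a right descent `t` of `y`
  have key : ∀ (y : N.Group) (s : S), ¬ csG.IsRightDescent y s →
      IsNonneg k α (α (ix s) ∘ₗ ρ (φ y)⁻¹) := by
    intro y
    induction hn : csG.length y using Nat.strong_induction_on generalizing y with
    | _ m ih =>
      intro s hs
      by_cases hy : y = 1
      · have h0 := IsNonneg.simple (k := k) (α := α) (ix s)
        convert h0 using 1
        ext
        simp [hy]
      obtain ⟨t, ht⟩ := csG.exists_rightDescent_of_ne_one hy
      obtain ⟨u, n, hyu, hl, hus, hut⟩ := exists_eq_mul_alternatingWord csG y s t hs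
      -- the word is nonempty since `t` is a right descent of `y`, but not of `u`
      have hn0 : n ≠ 0 := by
        rintro rfl
        rw [show csG.wordProd (alternatingWord s t 0) = 1 by simp [alternatingWord], mul_one] at hyu
        exact hut (hyu ▸ ht)
      have h1 := ih _ (by omega) u rfl s hus
      have h2 := ih _ (by omega) u rfl t hut
      have h3 : csG.IsReduced (alternatingWord t s (n + 1)) := by
        refine le_antisymm (csG.length_wordProd_le _) ?_
        rw [length_alternatingWord]
        have h4 := csG.not_isRightDescent_iff.1 hs
        have h5 := csG.length_mul_le u (csG.wordProd (alternatingWord t s (n + 1)))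
        rw [alternatingWord_succ, csG.wordProd_concat, ← mul_assoc, ← hyu] at h5
        rw [alternatingWord_succ, csG.wordProd_concat]
        omega
      have h4 : ∀ m, 0 < m → m ≤ n → ((s : W) * t) ^ m ≠ 1 := by
        intro m hm hmn h5
        have h6 : N t s ∣ m := by
          rw [N.symmetric]
          exact orderOf_dvd_of_pow_eq_one h5
        have h7 := Nat.le_of_dvd hm h6
        refine csG.not_isReduced_alternatingWord t s (fun h0 => ?_) (by omega) h3
        rw [h0, zero_dvd_iff] at h6
        omega
      rw [hyu, map_mul, hφw, map_alternatingWord]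
      refine nonneg_comp_mul_alternatingWord hα hρ ?_ h1 h2
      rwa [hix, hix]
  have hinj : Function.Injective φ := by
    refine (injective_iff_map_eq_one φ).2 fun y hy => ?_
    by_contra h1
    obtain ⟨s, hs⟩ := csG.exists_rightDescent_of_ne_one h1
    have h2 := key _ s (csG.isRightDescent_iff_not_isRightDescent_mul.1 hs)
    rw [map_mul, hy, one_mul, hφ, ← hix, cs.inv_simple,
      (IsRootOf.simple (cs := cs) (ρ := ρ) (α := α) (ix s)).comp_self hα] at h2
    exact (IsRootOf.simple (cs := cs) (ρ := ρ) (α := α) (ix s)).not_neg hα (IsNonneg.simple _) h2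
  have hrange : φ.range = Subgroup.closure S := by
    rw [MonoidHom.range_eq_map, ← csG.subgroup_closure_range_simple, MonoidHom.map_closure,
      ← Set.range_comp]
    congr 1
    ext s
    constructor
    · rintro ⟨t, rfl⟩
      rw [Function.comp_apply, hφ]
      exact t.2
    · intro hs
      exact ⟨⟨s, hs⟩, hφ _⟩
  refine ⟨N, csG.map ((MonoidHom.ofInjective hinj).trans (MulEquiv.subgroupCongr hrange)),
    fun s => ?_⟩
  rw [csG.map_simple]
  exact hφ s

/-- The stabiliser of a point of the Tits cone is a Coxeter group, with `stabSimple` as the set of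
its simple reflections. -/
theorem isCoxeterPair_stab {a : V} (ha : a ∈ titsCone ρ k α) :
    IsCoxeterPair (stab ρ a) (stabSimple cs ρ a) := by
  obtain ⟨d, hd, w, rfl, hw, hw'⟩ := exists_dominant hα hρ ha
  rw [stabSimple_eq hα hρ hd hw hw', stab_apply_eq_map, ← closure_simple_eq_stab hα hρ hd]
  exact (isCoxeterPair_closure hα hρ _).conj w

end Parabolic

/-! ### Specialisation of Soergel bimodules at points of the Tits cone -/

section Specialisation

variable {K : Type u} {V : Type v} [Field K] [AddCommGroup V] [Module K V]
variable {W : Type*} [Group W] {ρ : Representation K W V}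

/-- A power of the product of finitely many maximal ideals of points of `O` kills the specialisation
at `a` of a summand of Bott–Samelson bimodules. -/
theorem exists_finset_smul_eq_zero [NeZero (2 : K)] {n : ℕ} (l : Fin n → List W)
    (hl : ∀ i, ∀ s ∈ l i, s * s = 1) (a : V) (O : Set V) (ha : a ∈ O)
    (hO : ∀ i, ∀ s ∈ l i, ∀ p ∈ O, ρ s p ∈ O)
    {B : Type*} [AddCommGroup B] [Module (Reg K V ⊗[K] Reg K V) B]
    (ι : B →ₗ[Reg K V ⊗[K] Reg K V] ∀ i, (bottSamelson ρ (l i)).carrier)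
    (π : (∀ i, (bottSamelson ρ (l i)).carrier) →ₗ[Reg K V ⊗[K] Reg K V] B)
    (hπι : ∀ b, π (ι b) = b) :
    ∃ F : Finset V, ↑F ⊆ O ∧ ∃ N : ℕ, ∀ f ∈ (∏ p ∈ F, pointIdeal K p) ^ N,
      ∀ x : SpecialisationAt K a B, f • x = 0 := by
  classical
  choose F hF N hN using fun i => exists_finset_support (ρ := ρ) (l i) (hl i) a O ha (hO i)
  refine ⟨Finset.univ.biUnion F, fun p hp => ?_, Finset.univ.sup N, fun f hf x => ?_⟩
  · obtain ⟨i, -, hi⟩ := Finset.mem_biUnion.1 (Finset.mem_coe.1 hp)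
    exact hF i hi
  · obtain ⟨b, rfl⟩ := spMk_surjective _ x
    rw [← lm_spMk, spMk_eq_zero_iff, ← hπι b, ← map_lm]
    refine map_mem_rsub π (mem_rsub_pi.2 fun i => hN i f ?_ (ι b i))
    refine Ideal.pow_right_mono ?_ _ (Ideal.pow_le_pow_right (Finset.le_sup (Finset.mem_univ i)) hf)
    exact Ideal.le_of_dvd (Finset.prod_dvd_prod_of_subset _ _ _
      (Finset.subset_biUnion_of_mem F (Finset.mem_univ i)))

end Specialisation

end SoergelSpec
end

open SoergelSpec in
theorem theorem2p4
    {K : Type u} [Field K] [IsAlgClosed K]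
    {k : Type*} [Field k] [LinearOrder k] [IsStrictOrderedRing k] [Algebra k K]
    {V : Type v} [AddCommGroup V] [Module K V] [FiniteDimensional K V]
    {W : Type*} [Group W] [DecidableEq W] {I : Type*} {M : CoxeterMatrix I}
    (cs : CoxeterSystem M W)
    (ρ : Representation K W V) (hρ : SoergelSpec.IsReflectionFaithful cs ρ)
    (α : I → Module.Dual K V) (hα : SoergelSpec.IsSimpleSystem cs ρ k α)
    (a : V) (ha : a ∈ SoergelSpec.titsCone ρ k α)
    {B : Type*} [AddCommGroup B]
    [Module (SoergelSpec.Reg K V ⊗[K] SoergelSpec.Reg K V) B]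
    (deg : ℤ → AddSubgroup B)
    (hB : SoergelSpec.IsSoergelBimodule ρ (Set.range cs.simple) B deg) :
    DirectSum.IsInternal (fun t : SoergelSpec.minimalReps cs ρ a =>
      SoergelSpec.supportedAt K (ρ (t : W) a) (SoergelSpec.SpecialisationAt K a B)) ∧
    ∀ t ∈ SoergelSpec.minimalReps cs ρ a,
      SoergelSpec.IsCoxeterPair
        ((SoergelSpec.stab ρ a).map (MulAut.conj t).toMonoidHom)
        ((fun r => t * r * t⁻¹) '' SoergelSpec.stabSimple cs ρ a) ∧
      SoergelSpec.IsSoergelModuleAt ρ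
        ((fun r => t * r * t⁻¹) '' SoergelSpec.stabSimple cs ρ a) (ρ t a)
        (SoergelSpec.supportedAt K (ρ t a) (SoergelSpec.SpecialisationAt K a B)) := by
  have : CharZero K := charZero_of_injective_algebraMap (algebraMap k K).injective
  obtain ⟨n, l, d, ι, π, hl, hπι, -, -⟩ := hB
  have hpos : ∀ t ∈ minimalReps cs ρ a, PreservesPos k cs ρ α a t := fun t ht =>
    preservesPos_of_mem_minimalReps hα hρ ht
  have hone : (1 : W) ∈ minimalReps cs ρ a := fun x _ => by
    rw [cs.length_one]
    exact Nat.zero_le _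
  have hinj : Function.Injective fun t : minimalReps cs ρ a => ρ (t : W) a := fun t t' h =>
    Subtype.ext (eq_of_preservesPos hα hρ ha (hpos t t.2) (hpos t' t'.2) h)
  constructor
  · obtain ⟨F, hF, N, hN⟩ := exists_finset_smul_eq_zero (ρ := ρ) l (fun i s hs => by
      obtain ⟨j, rfl⟩ := hl i s hs
      exact cs.simple_mul_simple_self j) a {p | ∃ t : minimalReps cs ρ a, ρ (t : W) a = p}
      ⟨⟨1, hone⟩, by simp⟩ (by
        rintro i s hs _ ⟨t, rfl⟩
        obtain ⟨j, rfl⟩ := hl i s hs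
        by_cases hj : ρ (cs.simple j) (ρ (t : W) a) = ρ (t : W) a
        · exact ⟨t, hj.symm⟩
        · refine ⟨⟨_, simple_mul_mem_minimalReps hα hρ ha t.2 hj⟩, ?_⟩
          rw [map_mul]
          rfl) ι π hπι
    exact isInternal_supportedAt _ hinj F (fun p hp => hF hp) N hN
  · intro t ht
    refine ⟨(isCoxeterPair_stab hα hρ ha).conj t, ?_⟩
    refine isSoergelModuleAt_of_splitting ?_ l (fun i => ?_) ι π hπι
    · rintro _ ⟨r, ⟨hr, hra, -⟩, rfl⟩
      obtain ⟨β, hβ, -⟩ := IsRootOf.exists_of_isReflection hα hr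
      refine ⟨⟨_, hα.isReflectionAlong (hβ.conj_inv t)⟩, ?_⟩
      simp [mem_stab.1 hra]
    · refine nonempty_localSplitting ρ (T := minimalReps cs ρ a)
        (S' := fun t => (fun r => t * r * t⁻¹) '' stabSimple cs ρ a) ?_ (l i) ?_ ?_ ?_ t ht
      · intro t ht hta
        have h1 : (⟨t, ht⟩ : minimalReps cs ρ a) = ⟨1, hone⟩ := hinj (by simp [hta])
        exact congrArg Subtype.val h1
      · intro s hs
        obtain ⟨j, rfl⟩ := hl i s hs
        exact ⟨_, hα.isReflectionAlong_simple j⟩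
      · intro s hs t ht hst
        obtain ⟨j, rfl⟩ := hl i s hs
        exact ⟨_, conj_simple_mem_stabSimple hα hρ (hpos t ht) hst, by group⟩
      · intro s hs t ht hst
        obtain ⟨j, rfl⟩ := hl i s hs
        refine ⟨simple_mul_mem_minimalReps hα hρ ha ht hst, ?_⟩
        rintro _ ⟨r, hr, rfl⟩
        refine ⟨r, hr, ?_⟩
        simp only [mul_inv_rev, mul_assoc, cs.inv_simple, cs.simple_mul_simple_self, mul_one,
          cs.simple_mul_simple_cancel_left]
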